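/- **Setting.** Let $D,G,\Sigma\in\mathbb R^{d\times d}$ with $\Sigma$ symmetric positive definite, let $\gamma\in L^1(\mathbb R^+)$ and $\varphi\in L^2(\mathbb R)$ be functions with values in $\mathbb R^{d\times d}$, and let $W,\widetilde W$ be two-sided $d$-dimensional Brownian motions that are either the same or independent of each other. Let $F=F_0+G\dot W$, where $$F_0(t)=\int_{-\infty}^{\infty}\varphi(t-s)\,\mathrm d\widetilde W(s),\qquad t\in\mathbb R$$ (a Wiener integral; a jointly measurable version of $F_0$ is taken), and let $V_0\sim\mathcal N(0,\Sigma)$ be independent of $F$. Consider the generalized Langevin equation $$\dot V(t)=-DV(t)-\int_0^t\gamma(t-s)V(s)\,\mathrm ds+F(t),\qquad V(0)=V_0,$$ which is understood in integrated form: almost surely, for all $t\ge 0$, $$V(t)=V_0-D\int_0^tV(s)\,\mathrm ds-\int_0^t\!\int_0^\tau\gamma(\tau-s)V(s)\,\mathrm ds\,\mathrm d\tau+\int_0^tF_0(\tau)\,\mathrm d\tau+GW(t),$$ with paths of $V$ that are integrable on bounded intervals. Write $A^*$ for the transpose of a matrix $A$, let $*$ between functions denote convolution, put $\overset{\leftarrow}{\varphi}{}^*(s)=\varphi(-s)^*$,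 and define $$\gamma_\Sigma(t)=\begin{cases}\gamma(t)\Sigma,&t>0,\\ \Sigma\gamma(-t)^*,&t<0,\\ (\gamma(0)\Sigma+\Sigma\gamma(0)^*)/2,&t=0.\end{cases}$$ **Theorem.** There is a unique function $r:[0,\infty)\to\mathbb R^{d\times d}$ (the differential resolvent) with $$r'(t)=-Dr(t)-\int_0^t\gamma(t-s)r(s)\,\mathrm ds\quad(t\ge 0),\qquad r(0)=I.$$ The generalized Langevin equation has a solution $V$, which is unique up to indistinguishability, and $V=(V(t))_{t\ge 0}$ is a centered Gaussian process. The process $V$ is stationary (equivalently, in the strict sense or in the second order sense) if and only if $$GG^*=D\Sigma+\Sigma D^*$$ and, for almost every $t\in\mathbb R$, $$(\varphi*\overset{\leftarrow}{\varphi}{}^*)(t)=\begin{cases}\gamma_\Sigma(t)-\varphi(t)G^*-G\varphi(-t)^*,&\text{if }\widetilde W=W,\\ \gamma_\Sigma(t),&\text{if }W\text{ and }\widetilde W\text{ are independent.}\end{cases}$$ In this case the autocorrelation function of $V$ satisfies $$C_V(t)=\mathbb E\bigl(V(s+t)V(s)^*\bigr)=r(t)\Sigma\qquad\text{for all }s,t\ge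 0.$$ -/

import Mathlib

open MeasureTheory ProbabilityTheory Filter Set
open scoped Topology Matrix NNReal ENNReal Matrix.Norms.L2Operator

noncomputable section

namespace GLE

/-- Real `d × d` matrices, normed by the spectral norm. -/
abbrev Mat (d : ℕ) : Type := Matrix (Fin d) (Fin d) ℝ

/-- The state space of column vectors. -/
abbrev Vec (d : ℕ) : Type := Fin d → ℝ

variable {Ω : Type*} [MeasurableSpace Ω] {d : ℕ}

/-- The matrix `E (X Y*)` of mixed second moments. -/
def crossMoment (P : Measure Ω) (X Y : Ω → Vec d) : Mat d :=
  Matrix.of fun i j => ∫ ω, X ω i * Y ω j ∂P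

/-- A two-sided `d`-dimensional standard Brownian motion: a centered Gaussian process on `ℝ` with
almost surely continuous paths, with uncorrelated (hence independent) components, and with
`E (W_i(s) W_i(t)) = min |s| |t|` if `s` and `t` have the same sign and `0` otherwise. -/
structure IsTwoSidedBrownian (W : ℝ → Ω → Vec d) (P : Measure Ω) : Prop where
  isGaussianProcess : IsGaussianProcess W P
  mean_zero : ∀ t, ∫ ω, W t ω ∂P = 0
  covariance : ∀ s t, crossMoment P (W s) (W t) = ((|s| + |t| - |s - t|) / 2) • (1 : Mat d)
  continuous_paths : ∀ᵐ ω ∂P, Continuous fun t => W t ω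

/-- A matrix-valued step function `∑ i, coeff i · 1_(left i, right i]`. -/
structure StepFunction (d : ℕ) where
  n : ℕ
  left : Fin n → ℝ
  right : Fin n → ℝ
  left_le_right : ∀ i, left i ≤ right i
  coeff : Fin n → Mat d

/-- The function on `ℝ` described by the step data. -/
def StepFunction.toFun (g : StepFunction d) (s : ℝ) : Mat d :=
  ∑ i, (Ioc (g.left i) (g.right i)).indicator (fun _ => g.coeff i) s

/-- The elementary stochastic integral `∑ i, coeff i (W(right i) - W(left i))`. -/
def StepFunction.integral (g : StepFunction d) (W : ℝ → Ω → Vec d) (ω : Ω) : Vec d :=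
  ∑ i, g.coeff i *ᵥ (W (g.right i) ω - W (g.left i) ω)

/-- `X = ∫ f(s) dW(s)` for a deterministic `f ∈ L²(ℝ)`, in the sense of Wiener: `X` is the limit in
mean square of the elementary integrals of step functions that converge to `f` in `L²(ℝ)`. -/
def IsWienerIntegral (W : ℝ → Ω → Vec d) (P : Measure Ω) (f : ℝ → Mat d) (X : Ω → Vec d) : Prop :=
  MemLp f 2 volume ∧ AEStronglyMeasurable X P ∧
    ∃ g : ℕ → StepFunction d,
      Tendsto (fun n => eLpNorm (fun s => f s - (g n).toFun s) 2 volume) atTop (𝓝 0) ∧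
      Tendsto (fun n => eLpNorm (fun ω => X ω - (g n).integral W ω) 2 P) atTop (𝓝 0)

/-- The primitive `∫_0^t F(τ) dτ = ∫_0^t F₀(τ) dτ + G W(t)` of the force `F = F₀ + G dW/dt`. The
force itself is a random distribution, and it is the distributional derivative of this process. -/
def integratedForce (F₀ : ℝ → Ω → Vec d) (G : Mat d) (W : ℝ → Ω → Vec d) (t : ℝ) (ω : Ω) : Vec d :=
  (∫ τ in (0 : ℝ)..t, F₀ τ ω) + G *ᵥ W t ω

/-- `V` is a strong solution of the generalized Langevin equation
`dV/dt (t) = -D V(t) - ∫_0^t γ(t-s) V(s) ds + F(t)`, `V(0) = V₀`, where `Z` is the primitive of the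
force `F`: almost surely, the path of `V` is integrable on bounded intervals and the integrated
equation holds at all times `t ≥ 0`. -/
def IsStrongSolution (P : Measure Ω) (D : Mat d) (γ : ℝ → Mat d) (Z : ℝ → Ω → Vec d)
    (V₀ : Ω → Vec d) (V : ℝ → Ω → Vec d) : Prop :=
  ∀ᵐ ω ∂P,
    (∀ t, 0 ≤ t → IntervalIntegrable (fun s => V s ω) volume 0 t) ∧
    ∀ t, 0 ≤ t →
      V t ω = V₀ ω - D *ᵥ (∫ s in (0 : ℝ)..t, V s ω)
        - (∫ τ in (0 : ℝ)..t, ∫ s in (0 : ℝ)..τ, γ (τ - s) *ᵥ V s ω) + Z t ω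

/-- `r` solves `r'(t) = -D r(t) - ∫_0^t γ(t-s) r(s) ds` for `t ≥ 0`, with `r(0) = I`. -/
def IsDifferentialResolvent (D : Mat d) (γ : ℝ → Mat d) (r : ℝ → Mat d) : Prop :=
  r 0 = 1 ∧ ∀ t, 0 ≤ t →
    HasDerivWithinAt r (-(D * r t) - ∫ s in (0 : ℝ)..t, γ (t - s) * r s) (Ici 0) t

/-- Strict stationarity on `[0, ∞)`: the finite-dimensional laws are invariant under time shifts. -/
def IsStationary (P : Measure Ω) (V : ℝ → Ω → Vec d) : Prop :=
  ∀ h : ℝ≥0, ∀ I : Finset ℝ≥0,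
    P.map (fun ω (t : I) => V ((t : ℝ≥0) + h) ω) = P.map (fun ω (t : I) => V (t : ℝ≥0) ω)

/-- Second order (wide sense) stationarity on `[0, ∞)`. -/
def IsSecondOrderStationary (P : Measure Ω) (V : ℝ → Ω → Vec d) : Prop :=
  (∀ t, 0 ≤ t → MemLp (V t) 2 P) ∧
  (∀ t, 0 ≤ t → ∫ ω, V t ω ∂P = ∫ ω, V 0 ω ∂P) ∧
  ∀ s t, 0 ≤ s → 0 ≤ t → crossMoment P (V (s + t)) (V s) = crossMoment P (V t) (V 0)

/-- The extension `γ_Σ` of `γ Σ` to the real line (`S` stands for `Σ`). -/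
def gammaExt (γ : ℝ → Mat d) (S : Mat d) (t : ℝ) : Mat d :=
  if 0 < t then γ t * S
  else if t < 0 then S * (γ (-t))ᵀ
  else (1 / 2 : ℝ) • (γ 0 * S + S * (γ 0)ᵀ)

/-- The transposed time reversal `s ↦ φ(-s)*`. -/
def revT (φ : ℝ → Mat d) (s : ℝ) : Mat d := (φ (-s))ᵀ

/-- Convolution `(f * g)(t) = ∫ f(s) g(t - s) ds` of matrix-valued functions. -/
def matConv (f g : ℝ → Mat d) : ℝ → Mat d :=
  MeasureTheory.convolution f g (ContinuousLinearMap.mul ℝ (Mat d)) volume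

/-- The fluctuation-dissipation relation, in the case where the Brownian motion `W'` that drives
`F₀` is equal to `W`, and in the case where the two are independent. -/
def FluctuationDissipation (P : Measure Ω) (W W' : ℝ → Ω → Vec d) (G S : Mat d)
    (γ φ : ℝ → Mat d) : Prop :=
  (W' = W → ∀ᵐ t : ℝ,
    matConv φ (revT φ) t = gammaExt γ S t - φ t * Gᵀ - G * revT φ t) ∧
  (IndepFun (fun ω t => W t ω) (fun ω t => W' t ω) P → ∀ᵐ t : ℝ,
    matConv φ (revT φ) t = gammaExt γ S t)

end GLE

end

/-!
In integrated form, and after an application of Fubini's theorem to friction and memory, the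
Langevin equation reads `V + N * V = f` almost surely, with the bounded continuous kernel
`N(t) = D + ∫₀ᵗ γ` (`kern`) and the forcing `f(t) = V₀ + ∫₀ᵗ F` (`isStrongSolution_iff`). This is a
linear Volterra equation, so that `V = f - ρ * f` with the resolvent `ρ` of `N`
(`exists_resolvent`), which gives existence and pathwise uniqueness. The differential resolvent is
`r = 1 - ∫ρ`, the solution of `r + N * r = 1`.

Since `V₀` and the two Brownian motions are Gaussian, and the force and `V` are obtained from them
by linear operations and limits in mean square, `V` stays in the closed linear span of a Gaussian
process (`MemClosedSpan`). Hence `V` is a centered Gaussian process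
(`isGaussianProcess_of_memClosedSpan`), and its finite-dimensional distributions are determined by
its covariance (`map_eq_of_crossMoment_eq`), so that both notions of stationarity agree.

It remains to compare covariances. With the formal covariance `G G* δ + k` of the force, the forcing
has the covariance `S + covInc (G G*) k` (`crossMoment_integratedForce`), where `covInc B k` is the
covariance of a process with stationary increments. As `E (V(t) V(0)*) = r(t) S` in any case
(`resolve₂_zero_right`), `V` is stationary exactly if `E (V(s) V(t)*) = C(s - t)`, with the extension
`C` of `r S` to the line by `C(-u) = C(u)*` (`corr`). The operator `1 + N *` in both time variables
is invertible on continuous kernels (`resolve₂_eq_iff`); it maps the covariance of `V` to that of the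
forcing, and it maps the kernel `C(s - t)` to `S + covInc (D S + S D*) γ_S` (`volterra₂_corr`). So
stationarity means `covInc (G G*) k = covInc (D S + S D*) γ_S` for nonnegative times, and since
`covInc B k` determines both `B` and `k` (`covInc_eq_iff`), this is the fluctuation-dissipation
relation.
-/

noncomputable section

namespace GLE

/-! ### Convolution on the half line -/

section Volterra

variable {A E F E₁ E₂ E₃ : Type*}
  [NormedAddCommGroup F] [NormedSpace ℝ F]
  [NormedAddCommGroup E₁] [NormedSpace ℝ E₁] [NormedAddCommGroup E₂] [NormedSpace ℝ E₂]
  [NormedAddCommGroup E₃] [NormedSpace ℝ E₃]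

/-- Fubini's theorem on the triangle `0 ≤ u ≤ s ≤ t`. -/
theorem integral_triangle_swap {k : ℝ → ℝ → F} {t : ℝ} (ht : 0 ≤ t)
    (hk : Integrable ({p : ℝ × ℝ | p.2 ≤ p.1}.indicator (Function.uncurry k))
      ((volume.restrict (Ioc 0 t)).prod (volume.restrict (Ioc 0 t)))) :
    ∫ s in (0 : ℝ)..t, ∫ u in (0 : ℝ)..s, k s u = ∫ u in (0 : ℝ)..t, ∫ s in u..t, k s u := by
  have h1 : ∀ s ∈ Ioc 0 t, ∫ u in (0 : ℝ)..s, k s u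
      = ∫ u in Ioc 0 t, {p : ℝ × ℝ | p.2 ≤ p.1}.indicator (Function.uncurry k) (s, u) := by
    intro s hs
    rw [intervalIntegral.integral_of_le hs.1.le]
    have : (fun u => {p : ℝ × ℝ | p.2 ≤ p.1}.indicator (Function.uncurry k) (s, u))
        = (Iic s).indicator (fun u => k s u) := by
      ext u; simp [indicator, Function.uncurry]
    rw [this, setIntegral_indicator measurableSet_Iic, Ioc_inter_Iic, min_eq_right hs.2]
  have h2 : ∀ u ∈ Ioc 0 t, ∫ s in u..t, k s u
      = ∫ s in Ioc 0 t, {p : ℝ × ℝ | p.2 ≤ p.1}.indicator (Function.uncurry k) (s, u) := by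
    intro u hu
    rw [intervalIntegral.integral_of_le hu.2, ← integral_Icc_eq_integral_Ioc]
    have : (fun s => {p : ℝ × ℝ | p.2 ≤ p.1}.indicator (Function.uncurry k) (s, u))
        = (Ici u).indicator (fun s => k s u) := by
      ext s; simp [indicator, Function.uncurry]
    rw [this, setIntegral_indicator measurableSet_Ici]
    congr 2
    ext s
    simp only [mem_Icc, mem_inter_iff, mem_Ioc, mem_Ici]
    have := hu.1
    constructor
    · rintro ⟨a, b⟩; exact ⟨⟨by linarith, b⟩, a⟩
    · rintro ⟨⟨a, b⟩, c⟩; exact ⟨c, b⟩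
  rw [intervalIntegral.integral_of_le ht, intervalIntegral.integral_of_le ht,
    setIntegral_congr_fun measurableSet_Ioc h1, setIntegral_congr_fun measurableSet_Ioc h2]
  exact integral_integral_swap hk

/-- The inner integrals over a triangle depend integrably on the outer variable. -/
theorem intervalIntegrable_triangle {k : ℝ → ℝ → F} {t : ℝ} (ht : 0 ≤ t)
    (hk : Integrable ({p : ℝ × ℝ | p.2 ≤ p.1}.indicator (Function.uncurry k))
      ((volume.restrict (Ioc 0 t)).prod (volume.restrict (Ioc 0 t)))) :
    IntervalIntegrable (fun s => ∫ u in (0 : ℝ)..s, k s u) volume 0 t := by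
  rw [intervalIntegrable_iff_integrableOn_Ioc_of_le ht]
  refine hk.integral_prod_left.congr ?_
  filter_upwards [ae_restrict_mem measurableSet_Ioc] with s hs
  rw [intervalIntegral.integral_of_le hs.1.le]
  have : (fun u => {p : ℝ × ℝ | p.2 ≤ p.1}.indicator (Function.uncurry k) (s, u))
      = (Iic s).indicator (fun u => k s u) := by
    ext u; simp [indicator, Function.uncurry]
  rw [this, setIntegral_indicator measurableSet_Iic, Ioc_inter_Iic, min_eq_right hs.2]

/-- The causal convolution `∫_0^t x(t-s) y(s) ds` of two functions on the half line, with respect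
to the bilinear map `L`. -/
def cconv (L : E₁ →L[ℝ] E₂ →L[ℝ] E₃) (x : ℝ → E₁) (y : ℝ → E₂) (t : ℝ) : E₃ :=
  ∫ s in (0 : ℝ)..t, L (x (t - s)) (y s)

theorem cconv_congr (L : E₁ →L[ℝ] E₂ →L[ℝ] E₃) {x x' : ℝ → E₁} {y y' : ℝ → E₂} {t : ℝ}
    (ht : 0 ≤ t) (hx : ∀ s, 0 ≤ s → x s = x' s) (hy : ∀ s, 0 ≤ s → y s = y' s) :
    cconv L x y t = cconv L x' y' t := by
  refine intervalIntegral.integral_congr fun s hs => ?_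
  rw [uIcc_of_le ht] at hs
  simp only [hx _ (sub_nonneg.2 hs.2), hy _ hs.1]

theorem continuous_cconv (L : E₁ →L[ℝ] E₂ →L[ℝ] E₃) {x : ℝ → E₁} {y : ℝ → E₂}
    (hx : Continuous x) (hy : Continuous y) : Continuous (cconv L x y) := by
  unfold cconv
  refine intervalIntegral.continuous_parametric_intervalIntegral_of_continuous ?_ continuous_id
  change Continuous fun p : ℝ × ℝ => L (x (p.1 - p.2)) (y p.2)
  fun_prop

/-- A continuous kernel applied to an integrable function is integrable. -/
theorem intervalIntegrable_bilin (L : E₁ →L[ℝ] E₂ →L[ℝ] E₃) {x : ℝ → E₁} {y : ℝ → E₂} {a b : ℝ}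
    (hx : Continuous x) (hy : IntervalIntegrable y volume a b) :
    IntervalIntegrable (fun s => L (x s) (y s)) volume a b := by
  obtain ⟨C, hC⟩ := isCompact_uIcc.exists_bound_of_continuousOn (s := uIcc a b) hx.continuousOn
  rw [intervalIntegrable_iff] at hy ⊢
  refine L.integrable_of_bilin_of_bdd_left C hx.aestronglyMeasurable ?_ hy
  filter_upwards [ae_restrict_mem measurableSet_uIoc] with s hs using hC s (uIoc_subset_uIcc hs)

theorem cconv_add_right (L : E₁ →L[ℝ] E₂ →L[ℝ] E₃) {x : ℝ → E₁} {y z : ℝ → E₂} {t : ℝ}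
    (hx : Continuous x) (hy : IntervalIntegrable y volume 0 t)
    (hz : IntervalIntegrable z volume 0 t) :
    cconv L x (fun s => y s + z s) t = cconv L x y t + cconv L x z t := by
  unfold cconv
  have hx' : Continuous fun s => x (t - s) := by fun_prop
  rw [← intervalIntegral.integral_add (intervalIntegrable_bilin L hx' hy)
    (intervalIntegrable_bilin L hx' hz)]
  simp

theorem cconv_sub_right (L : E₁ →L[ℝ] E₂ →L[ℝ] E₃) {x : ℝ → E₁} {y z : ℝ → E₂} {t : ℝ}
    (hx : Continuous x) (hy : IntervalIntegrable y volume 0 t)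
    (hz : IntervalIntegrable z volume 0 t) :
    cconv L x (fun s => y s - z s) t = cconv L x y t - cconv L x z t := by
  unfold cconv
  have hx' : Continuous fun s => x (t - s) := by fun_prop
  rw [← intervalIntegral.integral_sub (intervalIntegrable_bilin L hx' hy)
    (intervalIntegrable_bilin L hx' hz)]
  simp

theorem cconv_add_left (L : E₁ →L[ℝ] E₂ →L[ℝ] E₃) {x y : ℝ → E₁} {z : ℝ → E₂} {t : ℝ}
    (hx : Continuous x) (hy : Continuous y) (hz : IntervalIntegrable z volume 0 t) :
    cconv L (fun s => x s + y s) z t = cconv L x z t + cconv L y z t := by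
  unfold cconv
  have hx' : Continuous fun s => x (t - s) := by fun_prop
  have hy' : Continuous fun s => y (t - s) := by fun_prop
  rw [← intervalIntegral.integral_add (intervalIntegrable_bilin L hx' hz)
    (intervalIntegrable_bilin L hy' hz)]
  simp

/-- Associativity of the causal convolution, the last factor being merely integrable. -/
theorem cconv_assoc {G : Type*} [NormedAddCommGroup G] [NormedSpace ℝ G] [CompleteSpace F]
    [CompleteSpace E₁] [CompleteSpace E₂] [CompleteSpace E₃] [CompleteSpace G]
    (L₁ : E₁ →L[ℝ] E₂ →L[ℝ] E₃) (L₂ : E₃ →L[ℝ] F →L[ℝ] G)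
    {H : Type*} [NormedAddCommGroup H] [NormedSpace ℝ H] [CompleteSpace H]
    (L₃ : E₂ →L[ℝ] F →L[ℝ] H) (L₄ : E₁ →L[ℝ] H →L[ℝ] G)
    (hL : ∀ a b c, L₄ a (L₃ b c) = L₂ (L₁ a b) c)
    {x : ℝ → E₁} {y : ℝ → E₂} {z : ℝ → F} {t : ℝ} (ht : 0 ≤ t)
    (hx : Continuous x) (hy : Continuous y) (hz : IntervalIntegrable z volume 0 t) :
    cconv L₄ x (cconv L₃ y z) t = cconv L₂ (cconv L₁ x y) z t := by
  have hzt : IntegrableOn z (Ioc 0 t) := (intervalIntegrable_iff_integrableOn_Ioc_of_le ht).1 hz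
  have hsub : ∀ s ∈ Ioc 0 t, IntervalIntegrable z volume 0 s := fun s hs =>
    hz.mono_set (by rw [uIcc_of_le hs.1.le, uIcc_of_le ht]; exact Icc_subset_Icc_right hs.2)
  have h1 : cconv L₄ x (cconv L₃ y z) t
      = ∫ s in (0 : ℝ)..t, ∫ u in (0 : ℝ)..s, L₂ (L₁ (x (t - s)) (y (s - u))) (z u) := by
    refine intervalIntegral.integral_congr_ae (Eventually.of_forall fun s hs => ?_)
    rw [uIoc_of_le ht] at hs
    have hy' : Continuous fun u => y (s - u) := by fun_prop
    simp only [cconv]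
    rw [← (L₄ (x (t - s))).intervalIntegral_comp_comm
      (intervalIntegrable_bilin L₃ hy' (hsub s hs))]
    simp only [hL]
  have hxy : Continuous fun p : ℝ × ℝ => L₁ (x (t - p.1)) (y (p.1 - p.2)) := by fun_prop
  have hcpt : IsCompact (Icc (0 : ℝ) t ×ˢ Icc (0 : ℝ) t) := isCompact_Icc.prod isCompact_Icc
  obtain ⟨C, hC⟩ := hcpt.exists_bound_of_continuousOn hxy.continuousOn
  have hint : Integrable (fun p : ℝ × ℝ => L₂ (L₁ (x (t - p.1)) (y (p.1 - p.2))) (z p.2))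
      ((volume.restrict (Ioc 0 t)).prod (volume.restrict (Ioc 0 t))) := by
    refine L₂.integrable_of_bilin_of_bdd_left C hxy.aestronglyMeasurable ?_
      (Integrable.comp_snd hzt _)
    rw [Measure.prod_restrict]
    filter_upwards [ae_restrict_mem (measurableSet_Ioc.prod measurableSet_Ioc)] with p hp
    exact hC p ⟨Ioc_subset_Icc_self hp.1, Ioc_subset_Icc_self hp.2⟩
  rw [h1, integral_triangle_swap ht]
  · refine intervalIntegral.integral_congr fun u _ => ?_
    simp only [cconv]
    have hc : Continuous fun v => L₁ (x (t - u - v)) (y v) := by fun_prop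
    have e1 := ((L₂.flip (z u)).intervalIntegral_comp_comm
      (hc.intervalIntegrable (μ := volume) 0 (t - u)))
    simp only [ContinuousLinearMap.flip_apply] at e1
    rw [← e1]
    have e2 := intervalIntegral.integral_comp_sub_right
      (fun v => L₂ (L₁ (x (t - u - v)) (y v)) (z u)) (a := u) (b := t) u
    simp only [sub_self] at e2
    rw [← e2]
    refine intervalIntegral.integral_congr fun s _ => ?_
    have : t - u - (s - u) = t - s := by ring
    simp only [this]
  · refine Integrable.indicator hint (measurableSet_le measurable_snd measurable_fst)

end Volterra

/-! ### Resolvents of continuous Volterra kernels -/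

section Resolvent

variable {A : Type*} [NormedRing A] [NormedAlgebra ℝ A]

local notation "μl" => ContinuousLinearMap.mul ℝ A

/-- The Volterra operator of a bounded continuous kernel has no nonzero fixed points: Gronwall's
lemma for `t ↦ ∫_0^t ‖x‖`. -/
theorem eq_zero_of_add_cconv_eq_zero {N x : ℝ → A} {M : ℝ} (hM : ∀ t, ‖N t‖ ≤ M)
    (hx : Continuous x) (h : ∀ t, 0 ≤ t → x t + cconv μl N x t = 0) {t : ℝ} (ht : 0 ≤ t) :
    x t = 0 := by
  have hM0 : 0 ≤ M := (norm_nonneg _).trans (hM 0)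
  have hbound : ∀ s, 0 ≤ s → ‖x s‖ ≤ M * ∫ u in (0 : ℝ)..s, ‖x u‖ := by
    intro s hs
    rw [eq_neg_of_add_eq_zero_left (h s hs), norm_neg, ← intervalIntegral.integral_const_mul]
    refine intervalIntegral.norm_integral_le_of_norm_le hs (Eventually.of_forall fun u _ => ?_)
      ((continuous_const.mul hx.norm).intervalIntegrable _ _)
    exact (norm_mul_le _ _).trans (mul_le_mul_of_nonneg_right (hM _) (norm_nonneg _))
  have hder : ∀ s, HasDerivAt (fun s => ∫ u in (0 : ℝ)..s, ‖x u‖) ‖x s‖ s := fun s =>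
    intervalIntegral.integral_hasDerivAt_right (hx.norm.intervalIntegrable _ _)
      (hx.norm.stronglyMeasurableAtFilter _ _) hx.norm.continuousAt
  have hz := eq_zero_of_abs_deriv_le_mul_abs_self_of_eq_zero_right (a := 0) (b := t) (K := M)
    (f := fun s => ∫ u in (0 : ℝ)..s, ‖x u‖) (f' := fun s => ‖x s‖)
    (fun s _ => (hder s).continuousAt.continuousWithinAt)
    (fun s _ => (hder s).hasDerivWithinAt) (by simp)
    (fun s hs => by
      rw [norm_norm, Real.norm_of_nonneg
        (intervalIntegral.integral_nonneg hs.1 fun _ _ => norm_nonneg _)]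
      exact hbound s hs.1) t ⟨ht, le_rfl⟩
  have := hbound t ht
  rw [hz, mul_zero] at this
  exact norm_le_zero_iff.1 this

variable [CompleteSpace A]

/-- Existence of the resolvent, by the contraction principle in a space of exponentially weighted
functions. -/
theorem exists_right_resolvent {N : ℝ → A} {M : ℝ} (hM : ∀ t, ‖N t‖ ≤ M) (hN : Continuous N) :
    ∃ ρ : ℝ → A, Continuous ρ ∧ ∀ t, 0 ≤ t → ρ t + cconv μl N ρ t = N t := by
  have hM0 : 0 ≤ M := (norm_nonneg _).trans (hM 0)
  -- With the weight `exp (-l t)` the Volterra operator has norm at most `M / l < 1`.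
  set l : ℝ := M + 1 with hl
  have hl0 : 0 < l := by positivity
  set w : ℝ → A := fun t => Real.exp (-(l * t)) • N t with hw
  have hwc : Continuous w := by fun_prop
  have hwint : ∀ t, 0 ≤ t → ∫ s in (0 : ℝ)..t, M * Real.exp (-(l * (t - s))) ≤ M / l := by
    intro t ht
    have hder : ∀ s ∈ uIcc 0 t, HasDerivAt (fun s => M / l * Real.exp (-(l * (t - s))))
        (M * Real.exp (-(l * (t - s)))) s := by
      intro s _
      have h1 : HasDerivAt (fun s => -(l * (t - s))) l s := by
        have := (((hasDerivAt_id s).const_sub t).const_mul l).neg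
        exact this.congr_deriv (by simp)
      exact ((h1.exp).const_mul (M / l)).congr_deriv (by field_simp)
    rw [intervalIntegral.integral_eq_sub_of_hasDerivAt hder
      ((by fun_prop : Continuous fun s => M * Real.exp (-(l * (t - s)))).intervalIntegrable _ _)]
    have : 0 ≤ M / l * Real.exp (-(l * (t - 0))) := by positivity
    simp only [sub_self, mul_zero, neg_zero, Real.exp_zero, mul_one]
    linarith
  have hwn : ∀ t, 0 ≤ t → ‖w t‖ ≤ M := by
    intro t ht
    simp only [hw, norm_smul, Real.norm_eq_abs, abs_of_pos (Real.exp_pos _)]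
    have h1 : Real.exp (-(l * t)) ≤ 1 := Real.exp_le_one_iff.2 (by nlinarith)
    calc _ ≤ 1 * M := mul_le_mul h1 (hM t) (norm_nonneg _) zero_le_one
      _ = M := one_mul M
  have hwn' : ∀ t, ‖w t‖ ≤ M * Real.exp (-(l * t)) := by
    intro t
    simp only [hw, norm_smul, Real.norm_eq_abs, abs_of_pos (Real.exp_pos _)]
    rw [mul_comm]
    exact mul_le_mul_of_nonneg_right (hM t) (Real.exp_pos _).le
  have hcb : ∀ (u : ℝ → A) (c : ℝ), 0 ≤ c → (∀ s, ‖u s‖ ≤ c) → ∀ t, 0 ≤ t →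
      ‖cconv μl w u t‖ ≤ M / l * c := by
    intro u c hc hu t ht
    have : ‖cconv μl w u t‖ ≤ ∫ s in (0 : ℝ)..t, M * Real.exp (-(l * (t - s))) * c := by
      refine intervalIntegral.norm_integral_le_of_norm_le ht (Eventually.of_forall fun s _ => ?_)
        ((by fun_prop : Continuous _).intervalIntegrable _ _)
      exact (norm_mul_le _ _).trans (mul_le_mul (hwn' _) (hu s) (norm_nonneg _) (by positivity))
    rw [intervalIntegral.integral_mul_const] at this
    exact this.trans (mul_le_mul_of_nonneg_right (hwint t ht) hc)
  have hmax : ∀ t : ℝ, 0 ≤ max t 0 := fun t => le_max_right _ _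
  let Φ : BoundedContinuousFunction ℝ A → BoundedContinuousFunction ℝ A := fun u =>
    BoundedContinuousFunction.ofNormedAddCommGroup
      (fun t => w (max t 0) - cconv μl w u (max t 0))
      ((hwc.comp (by fun_prop)).sub ((continuous_cconv _ hwc u.continuous).comp (by fun_prop)))
      (M + M / l * ‖u‖)
      (fun t => (norm_sub_le _ _).trans (add_le_add (hwn _ (hmax t))
        (hcb u _ (norm_nonneg _) u.norm_coe_le_norm _ (hmax t))))
  have hΦ : ContractingWith (Real.toNNReal (M / l)) Φ := by
    refine ⟨?_, LipschitzWith.of_dist_le_mul fun u v => ?_⟩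
    · rw [Real.toNNReal_lt_one, div_lt_one hl0]; linarith
    · rw [Real.coe_toNNReal _ (by positivity)]
      refine (BoundedContinuousFunction.dist_le (by positivity)).2 fun t => ?_
      have e : Φ u t - Φ v t = - cconv μl w (fun s => u s - v s) (max t 0) := by
        rw [cconv_sub_right _ hwc (u.continuous.intervalIntegrable _ _)
          (v.continuous.intervalIntegrable _ _)]
        simp only [Φ, BoundedContinuousFunction.coe_ofNormedAddCommGroup]
        abel
      rw [dist_eq_norm, e, norm_neg]
      refine hcb _ _ dist_nonneg (fun s => ?_) _ (hmax t)
      rw [← dist_eq_norm]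
      exact BoundedContinuousFunction.dist_coe_le_dist s
  obtain ⟨u, hu⟩ : ∃ u, Φ u = u := ⟨_, hΦ.fixedPoint_isFixedPt⟩
  refine ⟨fun t => Real.exp (l * t) • u t, by fun_prop, fun t ht => ?_⟩
  have hut : w t - cconv μl w u t = u t := by
    have := congrArg (fun f : BoundedContinuousFunction ℝ A => f t) hu
    simpa [Φ, max_eq_left ht] using this
  have hc : cconv μl N (fun t => Real.exp (l * t) • u t) t = Real.exp (l * t) • cconv μl w u t := by
    unfold cconv
    rw [← intervalIntegral.integral_smul]
    refine intervalIntegral.integral_congr fun s _ => ?_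
    simp only [hw, ContinuousLinearMap.mul_apply', mul_smul_comm, smul_mul_assoc, smul_smul]
    rw [← Real.exp_add]
    congr 2
    ring
  rw [hc, ← smul_add, ← hut, sub_add_cancel]
  simp only [hw, smul_smul]
  rw [← Real.exp_add]
  simp

/-- A bounded continuous kernel has a two-sided resolvent. -/
theorem exists_resolvent {N : ℝ → A} {M : ℝ} (hM : ∀ t, ‖N t‖ ≤ M) (hN : Continuous N) :
    ∃ ρ : ℝ → A, Continuous ρ ∧ (∀ t, 0 ≤ t → ρ t + cconv μl N ρ t = N t) ∧
      ∀ t, 0 ≤ t → ρ t + cconv μl ρ N t = N t := by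
  obtain ⟨ρ, hρ, hr⟩ := exists_right_resolvent hM hN
  refine ⟨ρ, hρ, hr, fun t ht => ?_⟩
  -- The difference of the two convolutions is annihilated by `1 + N *`.
  have hd := eq_zero_of_add_cconv_eq_zero (x := fun s => cconv μl ρ N s - cconv μl N ρ s) hM
    ((continuous_cconv _ hρ hN).sub (continuous_cconv _ hN hρ)) (fun s hs => by
      have hc1 := continuous_cconv μl hρ hN
      have hc2 := continuous_cconv μl hN hρ
      rw [cconv_sub_right _ hN (hc1.intervalIntegrable _ _) (hc2.intervalIntegrable _ _)]
      have e1 : cconv μl N (cconv μl ρ N) s = cconv μl (cconv μl N ρ) N s :=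
        cconv_assoc _ _ _ _ (fun a b c => by simp [mul_assoc]) hs hN hρ
          (hN.intervalIntegrable _ _)
      have e2 : cconv μl ρ N s + cconv μl (cconv μl N ρ) N s = cconv μl N N s := by
        rw [← cconv_add_left _ hρ hc2 (hN.intervalIntegrable _ _)]
        exact cconv_congr _ hs hr (fun _ _ => rfl)
      have e3 : cconv μl N ρ s + cconv μl N (cconv μl N ρ) s = cconv μl N N s := by
        rw [← cconv_add_right _ hN (hρ.intervalIntegrable _ _) (hc2.intervalIntegrable _ _)]
        exact cconv_congr _ hs (fun _ _ => rfl) hr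
      rw [e1]
      calc _ = (cconv μl ρ N s + cconv μl (cconv μl N ρ) N s)
          - (cconv μl N ρ s + cconv μl N (cconv μl N ρ) s) := by abel
        _ = 0 := by rw [e2, e3, sub_self]) ht
  rw [sub_eq_zero.1 hd]
  exact hr t ht

variable {E : Type*} [NormedAddCommGroup E] [NormedSpace ℝ E] [CompleteSpace E]

/-- A Volterra equation of the second kind is solved by the resolvent. -/
theorem eq_sub_cconv_of_add_cconv_eq (L : A →L[ℝ] E →L[ℝ] E)
    (hL : ∀ a b x, L a (L b x) = L (a * b) x) {N ρ : ℝ → A} (hN : Continuous N)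
    (hρ : Continuous ρ) (hl : ∀ t, 0 ≤ t → ρ t + cconv μl ρ N t = N t) {x f : ℝ → E}
    {t : ℝ} (ht : 0 ≤ t) (hx : IntervalIntegrable x volume 0 t)
    (hf : IntervalIntegrable f volume 0 t)
    (h : ∀ s, 0 ≤ s → s ≤ t → x s + cconv L N x s = f s) :
    x t = f t - cconv L ρ f t := by
  have hfx : cconv L ρ (cconv L N x) t = cconv L ρ f t - cconv L ρ x t := by
    rw [← cconv_sub_right _ hρ hf hx]
    refine intervalIntegral.integral_congr fun s hs => ?_
    rw [uIcc_of_le ht] at hs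
    simp only [← h s hs.1 hs.2, add_sub_cancel_left]
  rw [cconv_assoc μl L L L (fun a b c => by simp [hL]) ht hρ hN hx] at hfx
  have : cconv L N x t = cconv L ρ x t + cconv L (cconv μl ρ N) x t := by
    rw [← cconv_add_left _ hρ (continuous_cconv _ hρ hN) hx]
    exact cconv_congr _ ht (fun s hs => (hl s hs).symm) fun _ _ => rfl
  have h' := h t ht le_rfl
  rw [this, hfx, add_sub_cancel] at h'
  rw [← h', add_sub_cancel_right]

/-- The converse of `eq_sub_cconv_of_add_cconv_eq`. -/
theorem add_cconv_eq_of_eq_sub_cconv (L : A →L[ℝ] E →L[ℝ] E)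
    (hL : ∀ a b x, L a (L b x) = L (a * b) x) {N ρ : ℝ → A} (hN : Continuous N)
    (hρ : Continuous ρ) (hr : ∀ t, 0 ≤ t → ρ t + cconv μl N ρ t = N t) {f : ℝ → E}
    (hf : Continuous f) {t : ℝ} (ht : 0 ≤ t) :
    (f t - cconv L ρ f t) + cconv L N (fun s => f s - cconv L ρ f s) t = f t := by
  have hfi := hf.intervalIntegrable (μ := volume) 0 t
  rw [cconv_sub_right _ hN hfi ((continuous_cconv _ hρ hf).intervalIntegrable _ _),
    cconv_assoc μl L L L (fun a b c => by simp [hL]) ht hN hρ hfi]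
  have : cconv L N f t = cconv L ρ f t + cconv L (cconv μl N ρ) f t := by
    rw [← cconv_add_left _ hρ (continuous_cconv _ hN hρ) hfi]
    exact cconv_congr _ ht (fun s hs => (hr s hs).symm) fun _ _ => rfl
  rw [this]; abel

end Resolvent

/-! ### The integrated memory kernel and the differential resolvent -/

section Kernel

theorem integrable_indicator_Ici {B : Type*} [NormedAddCommGroup B] {γ : ℝ → B}
    (hγ : IntegrableOn γ (Ioi 0) volume) : Integrable ((Ici 0).indicator γ) volume :=
  (integrable_indicator_iff measurableSet_Ici).2 ((integrableOn_Ici_iff_integrableOn_Ioi).2 hγ)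

variable {A : Type*} [NormedRing A] [NormedAlgebra ℝ A]

local notation "μl" => ContinuousLinearMap.mul ℝ A

/-- The kernel `N(t) = D + ∫_0^t γ` of the time-integrated Volterra operator. The extension by `D`
to negative times makes it bounded and continuous on the whole line. -/
def kern (D : A) (γ : ℝ → A) (t : ℝ) : A := D + ∫ s in (0 : ℝ)..t, (Ici 0).indicator γ s

variable {D : A} {γ : ℝ → A}

theorem continuous_kern (hγ : IntegrableOn γ (Ioi 0) volume) : Continuous (kern D γ) :=
  continuous_const.add (intervalIntegral.continuous_primitive
    (fun _ _ => (integrable_indicator_Ici hγ).intervalIntegrable) 0)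

theorem norm_kern_le (hγ : IntegrableOn γ (Ioi 0) volume) (t : ℝ) :
    ‖kern D γ t‖ ≤ ‖D‖ + ∫ s, ‖(Ici 0).indicator γ s‖ := by
  refine (norm_add_le _ _).trans (add_le_add le_rfl ?_)
  exact intervalIntegral.norm_integral_le_integral_norm_uIoc.trans
    (setIntegral_le_integral (integrable_indicator_Ici hγ).norm
      (Eventually.of_forall fun _ => norm_nonneg _))

theorem integral_eq_kern_sub {t : ℝ} (ht : 0 ≤ t) :
    ∫ s in (0 : ℝ)..t, γ s = kern D γ t - D := by
  rw [kern, add_sub_cancel_left]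
  refine intervalIntegral.integral_congr fun s hs => ?_
  rw [uIcc_of_le ht] at hs
  exact (indicator_of_mem (show s ∈ Ici 0 from hs.1) γ).symm

variable {E : Type*} [NormedAddCommGroup E] [NormedSpace ℝ E]

theorem integrable_memory_triangle (L : A →L[ℝ] E →L[ℝ] E) (hγ : IntegrableOn γ (Ioi 0) volume)
    {v : ℝ → E} {t : ℝ} (ht : 0 ≤ t) (hv : IntervalIntegrable v volume 0 t) :
    Integrable ({p : ℝ × ℝ | p.2 ≤ p.1}.indicator
      (Function.uncurry fun τ s => L (γ (τ - s)) (v s)))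
      ((volume.restrict (Ioc 0 t)).prod (volume.restrict (Ioc 0 t))) := by
  have hv' : Integrable ((Ioc 0 t).indicator v) volume := (integrable_indicator_iff
    measurableSet_Ioc).2 ((intervalIntegrable_iff_integrableOn_Ioc_of_le ht).1 hv)
  have h := hv'.convolution_integrand L.flip (integrable_indicator_Ici hγ)
  rw [Measure.prod_restrict]
  refine (h.restrict (s := Ioc 0 t ×ˢ Ioc 0 t)).congr ?_
  filter_upwards [ae_restrict_mem (measurableSet_Ioc.prod measurableSet_Ioc)] with p hp
  rw [indicator_of_mem hp.2, ContinuousLinearMap.flip_apply]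
  by_cases h : p.2 ≤ p.1
  · rw [indicator_of_mem (show p.1 - p.2 ∈ Ici 0 from sub_nonneg.2 h),
      indicator_of_mem (show p ∈ {p : ℝ × ℝ | p.2 ≤ p.1} from h)]
    rfl
  · rw [indicator_of_notMem (show p.1 - p.2 ∉ Ici 0 from fun h' => h (sub_nonneg.1 h')),
      indicator_of_notMem (show p ∉ {p : ℝ × ℝ | p.2 ≤ p.1} from h)]
    simp

theorem intervalIntegrable_memory (L : A →L[ℝ] E →L[ℝ] E) (hγ : IntegrableOn γ (Ioi 0) volume)
    {v : ℝ → E} {t : ℝ} (ht : 0 ≤ t) (hv : IntervalIntegrable v volume 0 t) :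
    IntervalIntegrable (fun τ => ∫ s in (0 : ℝ)..τ, L (γ (τ - s)) (v s)) volume 0 t :=
  intervalIntegrable_triangle ht (integrable_memory_triangle L hγ ht hv)

variable [CompleteSpace A]

/-- The time integral of friction and memory is the convolution with `kern D γ`. -/
theorem integral_friction_add_memory [CompleteSpace E] (L : A →L[ℝ] E →L[ℝ] E)
    (hγ : IntegrableOn γ (Ioi 0) volume)
    {v : ℝ → E} {t : ℝ} (ht : 0 ≤ t) (hv : IntervalIntegrable v volume 0 t) :
    L D (∫ s in (0 : ℝ)..t, v s) + ∫ τ in (0 : ℝ)..t, ∫ s in (0 : ℝ)..τ, L (γ (τ - s)) (v s)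
      = cconv L (kern D γ) v t := by
  have hin : ∀ u ∈ uIcc 0 t, ∫ s in u..t, L (γ (s - u)) (v u) = L (kern D γ (t - u) - D) (v u) := by
    intro u hu
    rw [uIcc_of_le ht] at hu
    have hγi : IntervalIntegrable γ volume 0 (t - u) := by
      rw [intervalIntegrable_iff_integrableOn_Ioc_of_le (sub_nonneg.2 hu.2)]
      exact hγ.mono_set Ioc_subset_Ioi_self
    have := (L.flip (v u)).intervalIntegral_comp_comm hγi
    simp only [ContinuousLinearMap.flip_apply] at this
    rw [← integral_eq_kern_sub (sub_nonneg.2 hu.2), ← this]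
    have e := intervalIntegral.integral_comp_sub_right (fun s => L (γ s) (v u)) (a := u) (b := t) u
    simpa using e
  have hk : Continuous fun s => kern D γ (t - s) - D :=
    ((continuous_kern hγ).comp (by fun_prop)).sub continuous_const
  rw [integral_triangle_swap ht (integrable_memory_triangle L hγ ht hv),
    intervalIntegral.integral_congr hin, ← (L D).intervalIntegral_comp_comm hv,
    ← intervalIntegral.integral_add (intervalIntegrable_bilin L continuous_const hv)
      (intervalIntegrable_bilin L hk hv)]
  refine intervalIntegral.integral_congr fun s _ => ?_
  simp

theorem hasDerivAt_one_sub_integral {ρ : ℝ → A} (hρ : Continuous ρ) (t : ℝ) :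
    HasDerivAt (fun t => 1 - ∫ s in (0 : ℝ)..t, ρ s) (-ρ t) t :=
  (intervalIntegral.integral_hasDerivAt_right (hρ.intervalIntegrable _ _)
    (hρ.stronglyMeasurableAtFilter _ _) hρ.continuousAt).const_sub 1

/-- The resolvent `ρ` of the integrated kernel is minus the right-hand side of the differential
resolvent equation for `r = 1 - ∫_0^t ρ`. -/
theorem friction_add_memory_resolvent (hγ : IntegrableOn γ (Ioi 0) volume) {ρ : ℝ → A}
    (hρ : Continuous ρ) (hr : ∀ t, 0 ≤ t → ρ t + cconv μl (kern D γ) ρ t = kern D γ t)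
    {t : ℝ} (ht : 0 ≤ t) :
    D * (1 - ∫ s in (0 : ℝ)..t, ρ s)
      + ∫ s in (0 : ℝ)..t, γ (t - s) * (1 - ∫ u in (0 : ℝ)..s, ρ u) = ρ t := by
  have hγi : ∀ t : ℝ, 0 ≤ t → IntervalIntegrable γ volume 0 t := fun t ht => by
    rw [intervalIntegrable_iff_integrableOn_Ioc_of_le ht]
    exact hγ.mono_set Ioc_subset_Ioi_self
  have hγt : IntervalIntegrable (fun s => γ (t - s)) volume 0 t := by
    simpa using ((hγi t ht).comp_sub_left t).symm
  have hprim : Continuous fun s => ∫ u in (0 : ℝ)..s, ρ u :=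
    intervalIntegral.continuous_primitive (fun _ _ => hρ.intervalIntegrable _ _) 0
  have hγp : IntervalIntegrable (fun s => γ (t - s) * ∫ u in (0 : ℝ)..s, ρ u) volume 0 t :=
    intervalIntegrable_bilin (μl).flip hprim hγt
  have hsw : ∫ s in (0 : ℝ)..t, γ (t - s) * ∫ u in (0 : ℝ)..s, ρ u
      = ∫ u in (0 : ℝ)..t, (kern D γ (t - u) - D) * ρ u := by
    have e1 : ∫ s in (0 : ℝ)..t, γ (t - s) * ∫ u in (0 : ℝ)..s, ρ u
        = ∫ s in (0 : ℝ)..t, ∫ u in (0 : ℝ)..s, γ (t - s) * ρ u := by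
      refine intervalIntegral.integral_congr fun s _ => ?_
      exact ((μl (γ (t - s))).intervalIntegral_comp_comm (hρ.intervalIntegrable 0 s)).symm
    rw [e1, integral_triangle_swap ht]
    · refine intervalIntegral.integral_congr fun u hu => ?_
      rw [uIcc_of_le ht] at hu
      have hsub : IntervalIntegrable (fun s => γ (t - s)) volume u t :=
        hγt.mono_set (by
          rw [uIcc_of_le hu.2, uIcc_of_le ht]; exact Icc_subset_Icc_left hu.1)
      have := ((μl).flip (ρ u)).intervalIntegral_comp_comm hsub
      simp only [ContinuousLinearMap.flip_apply, ContinuousLinearMap.mul_apply'] at this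
      simp only [this]
      rw [intervalIntegral.integral_comp_sub_left (fun s => γ s) t, sub_self,
        integral_eq_kern_sub (D := D) (sub_nonneg.2 hu.2)]
    · refine Integrable.indicator ?_ (measurableSet_le measurable_snd measurable_fst)
      refine Integrable.op_fst_snd (op := fun a b : A => a * b) (by fun_prop)
        ⟨1, fun x y => by simpa using norm_mul_le x y⟩ (f := fun s => γ (t - s)) (g := ρ)
        ((intervalIntegrable_iff_integrableOn_Ioc_of_le ht).1 hγt)
        ((intervalIntegrable_iff_integrableOn_Ioc_of_le ht).1 (hρ.intervalIntegrable _ _))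
  have hk : Continuous fun s => kern D γ (t - s) := (continuous_kern hγ).comp (by fun_prop)
  have hγ1 : ∫ s in (0 : ℝ)..t, γ (t - s) = kern D γ t - D := by
    rw [intervalIntegral.integral_comp_sub_left (fun s => γ s) t, sub_self, sub_zero,
        integral_eq_kern_sub (D := D) ht]
  have hD : D * ∫ s in (0 : ℝ)..t, ρ s = ∫ s in (0 : ℝ)..t, D * ρ s :=
    ((μl D).intervalIntegral_comp_comm (hρ.intervalIntegrable 0 t)).symm
  simp only [mul_sub, mul_one]
  rw [intervalIntegral.integral_sub hγt hγp, hγ1, hsw]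
  simp only [sub_mul]
  rw [intervalIntegral.integral_sub
    ((by fun_prop : Continuous fun s => kern D γ (t - s) * ρ s).intervalIntegrable _ _)
    ((by fun_prop : Continuous fun s => D * ρ s).intervalIntegrable _ _), hD]
  have := hr t ht
  rw [cconv] at this
  simp only [ContinuousLinearMap.mul_apply'] at this
  rw [← eq_sub_iff_add_eq] at this
  rw [this]
  abel

end Kernel

section Differential

variable {d : ℕ} {D : Mat d} {γ : ℝ → Mat d}

local notation "μl" => ContinuousLinearMap.mul ℝ (Mat d)

theorem isDifferentialResolvent_one_sub_integral (hγ : IntegrableOn γ (Ioi 0) volume)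
    {ρ : ℝ → Mat d} (hρ : Continuous ρ)
    (hr : ∀ t, 0 ≤ t → ρ t + cconv μl (kern D γ) ρ t = kern D γ t) :
    IsDifferentialResolvent D γ fun t => 1 - ∫ s in (0 : ℝ)..t, ρ s := by
  refine ⟨by simp, fun t ht => ?_⟩
  refine (hasDerivAt_one_sub_integral hρ t).hasDerivWithinAt.congr_deriv ?_
  rw [← friction_add_memory_resolvent hγ hρ hr ht]
  abel

/-- The integrated form of the differential resolvent equation. -/
theorem IsDifferentialResolvent.add_cconv (hγ : IntegrableOn γ (Ioi 0) volume) {r : ℝ → Mat d}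
    (h : IsDifferentialResolvent D γ r) {t : ℝ} (ht : 0 ≤ t) :
    IntervalIntegrable r volume 0 t ∧ r t + cconv μl (kern D γ) r t = 1 := by
  have hc : ContinuousOn r (uIcc 0 t) := by
    rw [uIcc_of_le ht]
    exact fun s hs => (h.2 s hs.1).continuousWithinAt.mono Icc_subset_Ici_self
  have hi := hc.intervalIntegrable (μ := volume)
  have hm := intervalIntegrable_memory μl hγ ht hi
  have hDr : IntervalIntegrable (fun s => -(D * r s)) volume 0 t :=
    (intervalIntegrable_bilin μl continuous_const hi).neg
  have hftc := intervalIntegral.integral_eq_sub_of_hasDeriv_right hc (fun s hs => by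
    rw [min_eq_left ht, max_eq_right ht] at hs
    exact (h.2 s hs.1.le).mono fun x hx => hs.1.le.trans (le_of_lt hx)) (hDr.sub hm)
  rw [intervalIntegral.integral_sub hDr hm, intervalIntegral.integral_neg, h.1] at hftc
  have hD : ∫ s in (0 : ℝ)..t, D * r s = D * ∫ s in (0 : ℝ)..t, r s :=
    (μl D).intervalIntegral_comp_comm hi
  rw [hD] at hftc
  refine ⟨hi, ?_⟩
  rw [← integral_friction_add_memory μl hγ ht hi]
  simp only [ContinuousLinearMap.mul_apply'] at hftc ⊢
  rw [eq_comm, ← sub_eq_iff_eq_add', ← neg_inj, neg_sub, ← hftc]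
  abel

theorem IsDifferentialResolvent.eqOn (hγ : IntegrableOn γ (Ioi 0) volume) {r r₁ : ℝ → Mat d}
    (h : IsDifferentialResolvent D γ r) (h₁ : IsDifferentialResolvent D γ r₁) :
    EqOn r₁ r (Ici 0) := by
  obtain ⟨ρ, hρ, -, hl⟩ := exists_resolvent (norm_kern_le (D := D) hγ) (continuous_kern hγ)
  intro t ht
  rw [eq_sub_cconv_of_add_cconv_eq μl (fun a b x => by simp [mul_assoc]) (continuous_kern hγ) hρ hl
      ht (h.add_cconv hγ ht).1 intervalIntegrable_const fun s hs _ => (h.add_cconv hγ hs).2,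
    eq_sub_cconv_of_add_cconv_eq μl (fun a b x => by simp [mul_assoc]) (continuous_kern hγ) hρ hl
      ht (h₁.add_cconv hγ ht).1 intervalIntegrable_const fun s hs _ => (h₁.add_cconv hγ hs).2]

end Differential

/-! ### Covariance kernels of processes with stationary increments -/

section Increments

theorem intervalIntegrable_of_loc {G : Type*} [NormedAddCommGroup G] {k : ℝ → G}
    (hk : LocallyIntegrable k volume) (a b : ℝ) : IntervalIntegrable k volume a b :=
  (hk.integrableOn_isCompact isCompact_uIcc).intervalIntegrable

variable {F : Type*} [NormedAddCommGroup F] [NormedSpace ℝ F]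

/-- The second primitive `∫_0^x ∫_0^y k` of a function `k`. -/
def prim₂ (k : ℝ → F) (x : ℝ) : F := ∫ y in (0 : ℝ)..x, ∫ u in (0 : ℝ)..y, k u

/-- The kernel `min(s,t) B + ∫_0^s ∫_0^t k(a-b) db da`, the covariance of the integral of a
stationary noise with covariance `B δ + k`, written with the second primitive of `k`. -/
def covInc (B : F) (k : ℝ → F) (s t : ℝ) : F :=
  min s t • B + (prim₂ k s + prim₂ k (-t) - prim₂ k (s - t))

variable {k : ℝ → F}

theorem continuous_prim (hk : LocallyIntegrable k volume) :
    Continuous fun y => ∫ u in (0 : ℝ)..y, k u :=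
  intervalIntegral.continuous_primitive (fun _ _ => (intervalIntegrable_of_loc hk _ _)) 0

theorem continuous_prim₂ (hk : LocallyIntegrable k volume) : Continuous (prim₂ k) :=
  intervalIntegral.continuous_primitive
    (fun _ _ => (continuous_prim hk).intervalIntegrable _ _) 0

theorem continuous_covInc (hk : LocallyIntegrable k volume) (B : F) :
    Continuous fun p : ℝ × ℝ => covInc B k p.1 p.2 := by
  have := continuous_prim₂ hk
  unfold covInc
  fun_prop

theorem integral_integral_sub (hk : LocallyIntegrable k volume) (s t : ℝ) :
    ∫ a in (0 : ℝ)..s, ∫ b in (0 : ℝ)..t, k (a - b)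
      = prim₂ k s + prim₂ k (-t) - prim₂ k (s - t) := by
  have hc := continuous_prim hk
  have h1 : ∀ a, ∫ b in (0 : ℝ)..t, k (a - b)
      = (∫ u in (0 : ℝ)..a, k u) - ∫ u in (0 : ℝ)..(a - t), k u := by
    intro a
    rw [intervalIntegral.integral_comp_sub_left k a, sub_zero,
      intervalIntegral.integral_interval_sub_left (intervalIntegrable_of_loc hk _ _)
        (intervalIntegrable_of_loc hk _ _)]
  simp only [h1]
  rw [intervalIntegral.integral_sub (hc.intervalIntegrable _ _)
    ((by fun_prop : Continuous fun a => ∫ u in (0 : ℝ)..(a - t), k u).intervalIntegrable _ _),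
    intervalIntegral.integral_comp_sub_right (fun a => ∫ u in (0 : ℝ)..a, k u) t, zero_sub]
  have := intervalIntegral.integral_interval_sub_left
    (hc.intervalIntegrable (μ := volume) 0 (s - t))
    (hc.intervalIntegrable (μ := volume) 0 (-t))
  simp only [prim₂]
  rw [← this]
  abel

theorem prim₂_neg_comp (x : ℝ) : prim₂ (fun u => k (-u)) x = prim₂ k (-x) := by
  have h1 : ∀ y, ∫ u in (0 : ℝ)..y, k (-u) = -∫ u in (0 : ℝ)..(-y), k u := by
    intro y
    rw [intervalIntegral.integral_comp_neg, intervalIntegral.integral_symm, neg_zero]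
  have h2 := intervalIntegral.integral_comp_neg (a := 0) (b := x)
    (fun y => ∫ u in (0 : ℝ)..y, k u)
  simp only [prim₂, h1, intervalIntegral.integral_neg]
  rw [h2, intervalIntegral.integral_symm, neg_neg, neg_zero]

theorem prim₂_add {k' : ℝ → F} (hk : LocallyIntegrable k volume)
    (hk' : LocallyIntegrable k' volume) (x : ℝ) :
    prim₂ (fun u => k u + k' u) x = prim₂ k x + prim₂ k' x := by
  simp only [prim₂]
  rw [← intervalIntegral.integral_add ((continuous_prim hk).intervalIntegrable _ _)
    ((continuous_prim hk').intervalIntegrable _ _)]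
  congr 1; ext y
  exact intervalIntegral.integral_add (intervalIntegrable_of_loc hk _ _)
    (intervalIntegrable_of_loc hk' _ _)

variable [CompleteSpace F]

/-- The density of `∫_0^s ∫_0^t k(a-b) db da` has no atom on the diagonal: such a kernel is a
multiple of `min(s,t)` only if it vanishes. -/
theorem ae_eq_zero_of_covInc_eq_zero (hk : LocallyIntegrable k volume) {B : F}
    (h : ∀ s t, 0 ≤ s → 0 ≤ t → covInc B k s t = 0) : B = 0 ∧ k =ᵐ[volume] 0 := by
  set K : ℝ → F := fun y => ∫ u in (0 : ℝ)..y, k u with hK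
  have hKc : Continuous K := continuous_prim hk
  have hder : ∀ x, HasDerivAt (prim₂ k) (K x) x := fun x =>
    intervalIntegral.integral_hasDerivAt_right (hKc.intervalIntegrable _ _)
      (hKc.stronglyMeasurableAtFilter _ _) hKc.continuousAt
  have hder' : ∀ t s, HasDerivAt (fun s => prim₂ k s + prim₂ k (-t) - prim₂ k (s - t))
      (K s - K (s - t)) s := fun t s =>
    ((hder s).add_const _).sub ((hder (s - t)).comp_sub_const s t)
  -- Off the diagonal the kernel is differentiable in `s`.
  have h1 : ∀ t s, 0 < s → s < t → K s - K (s - t) = -B := by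
    intro t s hs hst
    have e : (fun s => prim₂ k s + prim₂ k (-t) - prim₂ k (s - t)) =ᶠ[𝓝 s] fun s => s • (-B) := by
      filter_upwards [lt_mem_nhds hs, gt_mem_nhds hst] with x hx hxt
      have := h x t hx.le (hx.trans hxt).le
      rw [covInc, min_eq_left hxt.le] at this
      rw [smul_neg, eq_neg_iff_add_eq_zero, add_comm, this]
    have hd := ((hasDerivAt_id s).smul_const (-B)).congr_of_eventuallyEq e
    simpa using (hder' t s).unique hd
  have h2 : ∀ t s, 0 < t → t < s → K s - K (s - t) = 0 := by
    intro t s ht hst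
    have e : (fun s => prim₂ k s + prim₂ k (-t) - prim₂ k (s - t)) =ᶠ[𝓝 s] fun _ => -(t • B) := by
      filter_upwards [lt_mem_nhds hst] with x hx
      have := h x t (ht.trans hx).le ht.le
      rw [covInc, min_eq_right hx.le] at this
      rw [eq_neg_iff_add_eq_zero, add_comm, this]
    have hd := (hasDerivAt_const s (-(t • B))).congr_of_eventuallyEq e
    exact (hder' t s).unique hd
  have hK0 : K 0 = 0 := by simp [hK]
  -- The limits `s → t` from both sides.
  have h3 : ∀ t, 0 < t → K t = -B := by
    intro t ht
    have hl : Tendsto (fun s => K s - K (s - t)) (𝓝[<] t) (𝓝 (K t - K (t - t))) :=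
      ((by fun_prop : Continuous fun s => K s - K (s - t)).tendsto t).mono_left inf_le_left
    have hl' : Tendsto (fun s => K s - K (s - t)) (𝓝[<] t) (𝓝 (-B)) := by
      refine tendsto_const_nhds.congr' ?_
      filter_upwards [Ioo_mem_nhdsLT ht] with s hs using (h1 t s hs.1 hs.2).symm
    have := tendsto_nhds_unique hl hl'
    rwa [sub_self, hK0, sub_zero] at this
  have h4 : ∀ t, 0 < t → K t = 0 := by
    intro t ht
    have hl : Tendsto (fun s => K s - K (s - t)) (𝓝[>] t) (𝓝 (K t - K (t - t))) :=
      ((by fun_prop : Continuous fun s => K s - K (s - t)).tendsto t).mono_left inf_le_left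
    have hl' : Tendsto (fun s => K s - K (s - t)) (𝓝[>] t) (𝓝 0) := by
      refine tendsto_const_nhds.congr' ?_
      filter_upwards [self_mem_nhdsWithin] with s hs using (h2 t s ht hs).symm
    have := tendsto_nhds_unique hl hl'
    rwa [sub_self, hK0, sub_zero] at this
  have hB : B = 0 := by
    have := (h3 1 one_pos).symm.trans (h4 1 one_pos)
    exact neg_eq_zero.1 this
  have h5 : ∀ x, K x = 0 := by
    intro x
    rcases lt_trichotomy x 0 with hx | hx | hx
    · have hl : Tendsto (fun s => K s - K (s - (s - x))) (𝓝[>] 0) (𝓝 (K 0 - K x)) := by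
        have : Continuous fun s => K s - K (s - (s - x)) := by fun_prop
        have := (this.tendsto 0).mono_left (nhdsWithin_le_nhds (s := Ioi 0))
        simpa only [sub_sub_cancel] using this
      have hl' : Tendsto (fun s => K s - K (s - (s - x))) (𝓝[>] 0) (𝓝 0) := by
        refine tendsto_const_nhds.congr' ?_
        filter_upwards [self_mem_nhdsWithin] with s hs
        rw [h1 (s - x) s hs (by linarith), hB, neg_zero]
      have := tendsto_nhds_unique hl hl'
      rwa [hK0, zero_sub, neg_eq_zero] at this
    · rw [hx, hK0]
    · exact h4 x hx
  refine ⟨hB, ?_⟩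
  filter_upwards [LocallyIntegrable.ae_hasDerivAt_integral hk] with x hx
  have h6 : HasDerivAt K (k x) x := hx 0
  have h7 : K = fun _ => 0 := funext h5
  rw [h7] at h6
  exact h6.unique (hasDerivAt_const x 0)

theorem covInc_eq_iff {k' : ℝ → F} (hk : LocallyIntegrable k volume)
    (hk' : LocallyIntegrable k' volume) {B B' : F} :
    (∀ s t, 0 ≤ s → 0 ≤ t → covInc B k s t = covInc B' k' s t) ↔ B = B' ∧ k =ᵐ[volume] k' := by
  constructor
  · intro h
    have hsub : ∀ x, prim₂ (fun u => k u - k' u) x = prim₂ k x - prim₂ k' x := by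
      intro x
      simp only [prim₂]
      rw [← intervalIntegral.integral_sub ((continuous_prim hk).intervalIntegrable _ _)
        ((continuous_prim hk').intervalIntegrable _ _)]
      congr 1; ext y
      exact intervalIntegral.integral_sub (intervalIntegrable_of_loc hk _ _)
        (intervalIntegrable_of_loc hk' _ _)
    obtain ⟨h1, h2⟩ := ae_eq_zero_of_covInc_eq_zero (k := fun u => k u - k' u) (B := B - B')
      (hk.sub hk') (fun s t hs ht => by
        have := sub_eq_zero.2 (h s t hs ht)
        rw [← this]
        simp only [covInc, hsub, smul_sub]
        abel)
    refine ⟨sub_eq_zero.1 h1, ?_⟩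
    filter_upwards [h2] with x hx using sub_eq_zero.1 hx
  · rintro ⟨rfl, h⟩ s t - -
    have : ∀ x, prim₂ k x = prim₂ k' x := by
      intro x
      simp only [prim₂]
      congr 1; ext y
      exact intervalIntegral.integral_congr_ae (h.mono fun u hu _ => hu)
    simp only [covInc, this]

end Increments

/-! ### The Volterra equation in both time variables -/

section TwoTimes

variable {d : ℕ}

local notation "μl" => ContinuousLinearMap.mul ℝ (Mat d)

theorem mul_assoc_mulL (a b x : Mat d) : (μl) a ((μl) b x) = (μl) (a * b) x := by
  simp [mul_assoc]

theorem integral_transpose {α : Type*} [MeasurableSpace α] (μ : Measure α) (f : α → Mat d) :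
    (∫ x, f x ∂μ)ᵀ = ∫ x, (f x)ᵀ ∂μ :=
  (((Matrix.transposeLinearEquiv (Fin d) (Fin d) ℝ ℝ).toContinuousLinearEquiv).integral_comp_comm
    f).symm

theorem intervalIntegral_transpose (f : ℝ → Mat d) (a b : ℝ) :
    (∫ x in a..b, f x)ᵀ = ∫ x in a..b, (f x)ᵀ := by
  simp only [intervalIntegral, Matrix.transpose_sub, integral_transpose]

/-- Application of `1 + N *` to a kernel in the first variable. -/
def volterra₁ (N : ℝ → Mat d) (X : ℝ → ℝ → Mat d) (s t : ℝ) : Mat d :=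
  X s t + cconv μl N (fun a => X a t) s

/-- Application of `1 + N *` to a kernel in both variables, the second one being transposed. If
`X` is the covariance of `V`, this is the covariance of `V + N * V`. -/
def volterra₂ (N : ℝ → Mat d) (X : ℝ → ℝ → Mat d) (s t : ℝ) : Mat d :=
  volterra₁ N X s t + (cconv μl N (fun b => (volterra₁ N X s b)ᵀ) t)ᵀ

/-- Application of `1 - ρ *` to a kernel in the second variable. -/
def resolve₁ (ρ : ℝ → Mat d) (X : ℝ → ℝ → Mat d) (s t : ℝ) : Mat d :=
  X s t - (cconv μl ρ (fun b => (X s b)ᵀ) t)ᵀ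

/-- Application of `1 - ρ *` to a kernel in both variables. -/
def resolve₂ (ρ : ℝ → Mat d) (X : ℝ → ℝ → Mat d) (s t : ℝ) : Mat d :=
  resolve₁ ρ X s t - cconv μl ρ (fun a => resolve₁ ρ X a t) s

theorem continuous_cconv_param {N : ℝ → Mat d} {X : ℝ → ℝ → Mat d} (hN : Continuous N)
    (hX : Continuous fun p : ℝ × ℝ => X p.1 p.2) :
    Continuous fun p : ℝ × ℝ => cconv μl N (fun a => X a p.2) p.1 := by
  unfold cconv
  refine intervalIntegral.continuous_parametric_intervalIntegral_of_continuous
    (f := fun (p : ℝ × ℝ) a => μl (N (p.1 - a)) (X a p.2)) ?_ continuous_fst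
  change Continuous fun q : (ℝ × ℝ) × ℝ => N (q.1.1 - q.2) * X q.2 q.1.2
  have : Continuous fun q : (ℝ × ℝ) × ℝ => X q.2 q.1.2 :=
    hX.comp (f := fun q : (ℝ × ℝ) × ℝ => (q.2, q.1.2)) (by fun_prop)
  fun_prop

theorem continuous_resolve₁ {ρ : ℝ → Mat d} {X : ℝ → ℝ → Mat d} (hρ : Continuous ρ)
    (hX : Continuous fun p : ℝ × ℝ => X p.1 p.2) :
    Continuous fun p : ℝ × ℝ => resolve₁ ρ X p.1 p.2 := by
  refine hX.sub (Continuous.matrix_transpose ?_)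
  have hX' : Continuous fun p : ℝ × ℝ => (X p.2 p.1)ᵀ :=
    (hX.comp (f := fun p : ℝ × ℝ => (p.2, p.1)) (by fun_prop)).matrix_transpose
  exact (continuous_cconv_param (X := fun b s => (X s b)ᵀ) hρ hX').comp
    (f := fun p : ℝ × ℝ => (p.2, p.1)) (by fun_prop)

theorem continuous_volterra₁ {N : ℝ → Mat d} {X : ℝ → ℝ → Mat d} (hN : Continuous N)
    (hX : Continuous fun p : ℝ × ℝ => X p.1 p.2) :
    Continuous fun p : ℝ × ℝ => volterra₁ N X p.1 p.2 :=
  hX.add (continuous_cconv_param hN hX)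

variable {N ρ : ℝ → Mat d}

/-- A kernel on the quadrant solves the Volterra equation in both variables if and only if it is
given by the resolvent. -/
theorem resolve₂_eq_iff (hN : Continuous N) (hρ : Continuous ρ)
    (hr : ∀ t, 0 ≤ t → ρ t + cconv μl N ρ t = N t) (hl : ∀ t, 0 ≤ t → ρ t + cconv μl ρ N t = N t)
    {X C : ℝ → ℝ → Mat d} (hX : Continuous fun p : ℝ × ℝ => X p.1 p.2)
    (hC : Continuous fun p : ℝ × ℝ => C p.1 p.2) :
    (∀ s t, 0 ≤ s → 0 ≤ t → resolve₂ ρ X s t = C s t) ↔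
      ∀ s t, 0 ≤ s → 0 ≤ t → volterra₂ N C s t = X s t := by
  constructor
  · intro h s t hs ht
    have h1 : ∀ t, 0 ≤ t → volterra₁ N C s t = resolve₁ ρ X s t := by
      intro t ht
      have hB : Continuous fun a => resolve₁ ρ X a t :=
        (continuous_resolve₁ hρ hX).comp (f := fun a => (a, t)) (by fun_prop)
      rw [← add_cconv_eq_of_eq_sub_cconv μl mul_assoc_mulL hN hρ hr hB hs, volterra₁, ← h s t hs ht]
      congr 1
      exact cconv_congr _ hs (fun _ _ => rfl) fun a ha => (h a t ha ht).symm
    have hXs : Continuous fun b => (X s b)ᵀ :=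
      (hX.comp (f := fun b => (s, b)) (by fun_prop)).matrix_transpose
    have h2 := add_cconv_eq_of_eq_sub_cconv μl mul_assoc_mulL hN hρ hr hXs ht
    rw [volterra₂, h1 t ht]
    rw [cconv_congr (y' := fun b => (X s b)ᵀ - cconv μl ρ (fun b => (X s b)ᵀ) b) μl ht
      (fun _ _ => rfl) (fun b hb => by rw [h1 b hb]; simp [resolve₁])]
    rw [← Matrix.transpose_inj, ← h2]
    simp [resolve₁]
  · intro h s t hs ht
    have h1 : ∀ s, 0 ≤ s → volterra₁ N C s t = resolve₁ ρ X s t := by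
      intro s hs
      have hXs : Continuous fun b => (X s b)ᵀ :=
        (hX.comp (f := fun b => (s, b)) (by fun_prop)).matrix_transpose
      have hV : Continuous fun b => (volterra₁ N C s b)ᵀ :=
        ((continuous_volterra₁ hN hC).comp (f := fun b => (s, b)) (by fun_prop)).matrix_transpose
      have := eq_sub_cconv_of_add_cconv_eq μl mul_assoc_mulL hN hρ hl ht
        (hV.intervalIntegrable _ _) (hXs.intervalIntegrable _ _) (fun b hb _ => by
          rw [← h s b hs hb]; simp [volterra₂])
      rw [← Matrix.transpose_inj, this]
      simp [resolve₁]
    have hB : Continuous fun a => resolve₁ ρ X a t :=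
      (continuous_resolve₁ hρ hX).comp (f := fun a => (a, t)) (by fun_prop)
    have hCt : Continuous fun a => C a t := hC.comp (f := fun a => (a, t)) (by fun_prop)
    exact (eq_sub_cconv_of_add_cconv_eq μl mul_assoc_mulL hN hρ hl hs
      (hCt.intervalIntegrable _ _) (hB.intervalIntegrable _ _) (fun a ha _ => h1 a ha)).symm

theorem volterra₂_transpose (hN : Continuous N) {X : ℝ → ℝ → Mat d}
    (hX : Continuous fun p : ℝ × ℝ => X p.1 p.2) (hsymm : ∀ s t, (X s t)ᵀ = X t s) {s t : ℝ} :
    (volterra₂ N X s t)ᵀ = volterra₂ N X t s := by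
  have hX1 : ∀ t, Continuous fun a => X a t := fun t =>
    hX.comp (f := fun a => (a, t)) (by fun_prop)
  have hX2 : ∀ t, Continuous fun a => X t a := fun t =>
    hX.comp (f := fun a => (t, a)) (by fun_prop)
  have key : ∀ s t, volterra₂ N X s t = X s t + (∫ a in (0 : ℝ)..s, N (s - a) * X a t)
      + ((∫ b in (0 : ℝ)..t, X s b * (N (t - b))ᵀ)
      + ∫ b in (0 : ℝ)..t, ∫ a in (0 : ℝ)..s, N (s - a) * X a b * (N (t - b))ᵀ) := by
    intro s t
    have hI : Continuous fun b => cconv μl N (fun a => X a b) s :=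
      (continuous_cconv_param hN hX).comp (f := fun b => (s, b)) (by fun_prop)
    have e : ∀ b, (∫ a in (0 : ℝ)..s, N (s - a) * X a b) * (N (t - b))ᵀ
        = ∫ a in (0 : ℝ)..s, N (s - a) * X a b * (N (t - b))ᵀ := by
      intro b
      have := hX1 b
      exact (((μl).flip (N (t - b))ᵀ).intervalIntegral_comp_comm
        ((by fun_prop : Continuous fun a => N (s - a) * X a b).intervalIntegrable 0 s)).symm
    simp only [volterra₂, volterra₁, cconv, ContinuousLinearMap.mul_apply'] at hI ⊢
    rw [intervalIntegral_transpose]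
    simp only [Matrix.transpose_mul, Matrix.transpose_transpose, add_mul]
    rw [intervalIntegral.integral_add]
    · simp only [e]
    · have := hX2 s
      exact (by fun_prop : Continuous fun b => X s b * (N (t - b))ᵀ).intervalIntegrable _ _
    · exact (by fun_prop : Continuous fun b => (∫ a in (0 : ℝ)..s, N (s - a) * X a b)
        * (N (t - b))ᵀ).intervalIntegrable _ _
  rw [key, key]
  simp only [Matrix.transpose_add, intervalIntegral_transpose, Matrix.transpose_mul,
    Matrix.transpose_transpose, hsymm, ← mul_assoc]
  rw [intervalIntegral_intervalIntegral_swap]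
  · abel
  · have hc : Continuous (Function.uncurry fun b a => N (t - b) * X b a * (N (s - a))ᵀ) := by
      change Continuous fun p : ℝ × ℝ => N (t - p.1) * X p.1 p.2 * (N (s - p.2))ᵀ
      fun_prop
    exact (hc.continuousOn.integrableOn_compact (isCompact_uIcc.prod isCompact_uIcc)).mono_set
      (prod_mono uIoc_subset_uIcc uIoc_subset_uIcc)

/-- The stationary correlation kernel `C(u) = r(u) S` for `u ≥ 0`, `C(-u) = C(u)*`. -/
def corr (r : ℝ → Mat d) (S : Mat d) (u : ℝ) : Mat d :=
  if 0 ≤ u then r u * S else S * (r (-u))ᵀ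

variable {r : ℝ → Mat d} {S : Mat d}

theorem continuous_corr (hr : Continuous r) (h0 : r 0 = 1) : Continuous (corr r S) := by
  refine Continuous.if_le (by fun_prop) (by fun_prop) continuous_const continuous_id ?_
  intro x hx
  rw [← hx, neg_zero, h0]
  simp

theorem corr_transpose (hS : Sᵀ = S) (h0 : r 0 = 1) (u : ℝ) : (corr r S u)ᵀ = corr r S (-u) := by
  rcases lt_trichotomy u 0 with h | h | h
  · simp [corr, h.le, h.not_ge, hS]
  · subst h; simp [corr, h0, hS]
  · simp [corr, h.le, h.not_ge, hS]

/-- On the octant `t ≤ s`, the Volterra operator in both variables turns the correlation kernel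
`C(s - t)` into the covariance of a process with stationary increments. -/
theorem volterra₂_corr_of_le (hN : Continuous N) (hr : Continuous r) (h0 : r 0 = 1)
    (hrN : ∀ t, 0 ≤ t → r t + cconv μl N r t = 1) {s t : ℝ} (ht : 0 ≤ t)
    (hts : t ≤ s) :
    volterra₂ N (fun s t => corr r S (s - t)) s t =
      S + ((∫ u in (0 : ℝ)..s, N u) * S + S * (∫ u in (0 : ℝ)..t, N u)ᵀ
        - (∫ u in (0 : ℝ)..(s - t), N u) * S) := by
  have hcorr := continuous_corr (S := S) hr h0
  -- The kernel after application of `1 + N *` in the first variable.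
  have h1 : ∀ b, 0 ≤ b → b ≤ s → volterra₁ N (fun s t => corr r S (s - t)) s b
      = S + ∫ a in (0 : ℝ)..b, N (s - a) * S * (r (b - a))ᵀ := by
    intro b hb hbs
    have hc : Continuous fun a => N (s - a) * corr r S (a - b) := by fun_prop
    have hsplit := (intervalIntegral.integral_add_adjacent_intervals
      (hc.intervalIntegrable (μ := volume) 0 b) (hc.intervalIntegrable b s))
    have e1 : ∫ a in (0 : ℝ)..b, N (s - a) * corr r S (a - b)
        = ∫ a in (0 : ℝ)..b, N (s - a) * S * (r (b - a))ᵀ := by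
      refine intervalIntegral.integral_congr fun a ha => ?_
      rw [uIcc_of_le hb] at ha
      rcases ha.2.eq_or_lt with h | h
      · simp [h, corr, h0]
      · simp [corr, h.not_ge, mul_assoc]
    have e2 : ∫ a in b..s, N (s - a) * corr r S (a - b) = cconv μl N r (s - b) * S := by
      have hNr : Continuous fun u => N (s - b - u) * r u := by fun_prop
      have f1 := intervalIntegral.integral_comp_sub_right
        (fun u => N (s - b - u) * r u * S) (a := b) (b := s) b
      have f2 := (((μl).flip S).intervalIntegral_comp_comm
        (hNr.intervalIntegrable (μ := volume) 0 (s - b)))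
      simp only [ContinuousLinearMap.flip_apply, ContinuousLinearMap.mul_apply'] at f2
      rw [sub_self] at f1
      simp only [cconv, ContinuousLinearMap.mul_apply']
      rw [← f2, ← f1]
      refine intervalIntegral.integral_congr fun a ha => ?_
      rw [uIcc_of_le hbs] at ha
      have : s - b - (a - b) = s - a := by ring
      simp [corr, ha.1, this, mul_assoc]
    have e3 : corr r S (s - b) = r (s - b) * S := by simp [corr, hbs]
    simp only [volterra₁]
    change corr r S (s - b) + ∫ a in (0 : ℝ)..s, N (s - a) * corr r S (a - b) = _
    rw [← hsplit, e1, e2, e3, add_left_comm, ← add_mul, hrN _ (sub_nonneg.2 hbs), one_mul, add_comm]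
  have hs : 0 ≤ s := ht.trans hts
  set g : ℝ → Mat d := fun a => N (s - a) * S with hg
  have hgc : Continuous g := by fun_prop
  have hrT : Continuous fun u => (r u)ᵀ := hr.matrix_transpose
  have hNT : Continuous fun u => (N u)ᵀ := hN.matrix_transpose
  -- The memory part, as a convolution with factors in reversed order.
  have h2 : ∀ b, ∫ a in (0 : ℝ)..b, N (s - a) * S * (r (b - a))ᵀ
      = cconv (μl).flip (fun u => (r u)ᵀ) g b := fun b => rfl
  have hy : Continuous (cconv (μl).flip (fun u => (r u)ᵀ) g) := continuous_cconv _ hrT hgc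
  have h3 : (cconv μl N (fun b => (volterra₁ N (fun s t => corr r S (s - t)) s b)ᵀ) t)ᵀ
      = S * (∫ u in (0 : ℝ)..t, N u)ᵀ
        + cconv (μl).flip (fun u => (N u)ᵀ) (cconv (μl).flip (fun u => (r u)ᵀ) g) t := by
    have e1 : ∫ b in (0 : ℝ)..t, S * (N (t - b))ᵀ = S * (∫ u in (0 : ℝ)..t, N u)ᵀ := by
      have f := intervalIntegral.integral_comp_sub_left (fun u => S * (N u)ᵀ) (a := 0) (b := t) t
      simp only [sub_self, sub_zero] at f
      rw [f, intervalIntegral_transpose]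
      exact ((μl S).intervalIntegral_comp_comm (hNT.intervalIntegrable 0 t))
    rw [cconv, intervalIntegral_transpose, ← e1, cconv, ← intervalIntegral.integral_add
      ((by fun_prop : Continuous fun b => S * (N (t - b))ᵀ).intervalIntegrable _ _)
      ((by simp only [ContinuousLinearMap.flip_apply, ContinuousLinearMap.mul_apply']; fun_prop :
        Continuous fun b => (μl).flip ((N (t - b))ᵀ)
          (cconv (μl).flip (fun u => (r u)ᵀ) g b)).intervalIntegrable _ _)]
    refine intervalIntegral.integral_congr fun b hb => ?_
    rw [uIcc_of_le ht] at hb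
    simp only [ContinuousLinearMap.flip_apply, ContinuousLinearMap.mul_apply', Matrix.transpose_mul,
      Matrix.transpose_transpose]
    rw [h1 b hb.1 (hb.2.trans hts), h2, add_mul]
  have h4 : cconv (μl).flip (fun u => (r u)ᵀ) g t
      + cconv (μl).flip (fun u => (N u)ᵀ) (cconv (μl).flip (fun u => (r u)ᵀ) g) t
      = ∫ a in (0 : ℝ)..t, N (s - a) * S := by
    rw [cconv_assoc (μl).flip (μl).flip (μl).flip (μl).flip
      (fun a b c => by simp [mul_assoc]) ht hNT hrT (hgc.intervalIntegrable _ _),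
      ← cconv_add_left _ hrT (continuous_cconv _ hNT hrT) (hgc.intervalIntegrable _ _)]
    rw [cconv_congr (x' := fun _ => 1) (y' := g) _ ht (fun u hu => ?_) fun _ _ => rfl]
    · simp [cconv, hg]
    · have := congrArg Matrix.transpose (hrN u hu)
      rw [Matrix.transpose_add, Matrix.transpose_one] at this
      rw [← this]
      congr 1
      simp only [cconv, intervalIntegral_transpose, ContinuousLinearMap.flip_apply,
        ContinuousLinearMap.mul_apply', Matrix.transpose_mul]
  have h5 : ∫ a in (0 : ℝ)..t, N (s - a) * S
      = (∫ u in (0 : ℝ)..s, N u) * S - (∫ u in (0 : ℝ)..(s - t), N u) * S := by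
    rw [← sub_mul, intervalIntegral.integral_interval_sub_left (hN.intervalIntegrable _ _)
      (hN.intervalIntegrable _ _)]
    have f1 := ((μl).flip S).intervalIntegral_comp_comm
      (hN.intervalIntegrable (μ := volume) (s - t) s)
    have f2 := intervalIntegral.integral_comp_sub_left (fun u => N u * S) (a := 0) (b := t) s
    rw [sub_zero] at f2
    rw [f2]
    exact f1
  rw [volterra₂, h1 t ht hts, h3, h2]
  calc _ = S + ((cconv (μl).flip (fun u => (r u)ᵀ) g t
      + cconv (μl).flip (fun u => (N u)ᵀ) (cconv (μl).flip (fun u => (r u)ᵀ) g) t)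
      + S * (∫ u in (0 : ℝ)..t, N u)ᵀ) := by abel
    _ = _ := by rw [h4, h5]; abel

end TwoTimes

section Fluctuation

variable {d : ℕ} {D S : Mat d} {γ : ℝ → Mat d}

local notation "μl" => ContinuousLinearMap.mul ℝ (Mat d)

theorem gammaExt_of_pos {t : ℝ} (ht : 0 < t) : gammaExt γ S t = γ t * S := by
  simp [gammaExt, ht]

theorem gammaExt_of_neg {t : ℝ} (ht : t < 0) : gammaExt γ S t = S * (γ (-t))ᵀ := by
  simp [gammaExt, ht, ht.not_gt]

theorem integrable_gammaExt (hγ : IntegrableOn γ (Ioi 0) volume) :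
    Integrable (gammaExt γ S) volume := by
  have hg := integrable_indicator_Ici hγ
  have h1 : Integrable (fun t => (Ici 0).indicator γ t * S) volume :=
    ((μl).flip S).integrable_comp hg
  have h2 : Integrable (fun t => S * ((Ici 0).indicator γ (-t))ᵀ) volume :=
    (μl S).integrable_comp
      (((Matrix.transposeLinearEquiv (Fin d) (Fin d) ℝ ℝ).toContinuousLinearEquiv :
        Mat d →L[ℝ] Mat d).integrable_comp hg.comp_neg)
  refine (h1.add h2).congr ?_
  filter_upwards [compl_mem_ae_iff.2 (measure_singleton (0 : ℝ))] with t ht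
  rcases lt_or_gt_of_ne ht with h | h
  · simp [gammaExt_of_neg h, h.le, h.not_ge]
  · simp [gammaExt_of_pos h, h.le, h.not_ge]

theorem integral_gammaExt_of_nonneg (hγ : IntegrableOn γ (Ioi 0) volume) {y : ℝ} (hy : 0 ≤ y) :
    ∫ u in (0 : ℝ)..y, gammaExt γ S u = (kern D γ y - D) * S := by
  rw [← integral_eq_kern_sub hy]
  have hγi : IntervalIntegrable γ volume 0 y := by
    rw [intervalIntegrable_iff_integrableOn_Ioc_of_le hy]
    exact hγ.mono_set Ioc_subset_Ioi_self
  refine Eq.trans ?_ (((μl).flip S).intervalIntegral_comp_comm hγi)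
  refine intervalIntegral.integral_congr_ae (Eventually.of_forall fun u hu => ?_)
  rw [uIoc_of_le hy] at hu
  exact gammaExt_of_pos hu.1

theorem integral_gammaExt_neg (hγ : IntegrableOn γ (Ioi 0) volume) {y : ℝ} (hy : 0 ≤ y) :
    ∫ u in (0 : ℝ)..(-y), gammaExt γ S u = -(S * (kern D γ y - D)ᵀ) := by
  rw [← integral_eq_kern_sub hy]
  have hγi : IntervalIntegrable γ volume 0 y := by
    rw [intervalIntegrable_iff_integrableOn_Ioc_of_le hy]
    exact hγ.mono_set Ioc_subset_Ioi_self
  have e := intervalIntegral.integral_comp_neg (gammaExt γ S) (a := 0) (b := y)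
  rw [neg_zero] at e
  rw [intervalIntegral.integral_symm, ← e, neg_inj]
  refine Eq.trans ?_ (((μl S).comp ((Matrix.transposeLinearEquiv (Fin d) (Fin d) ℝ
    ℝ).toContinuousLinearEquiv : Mat d →L[ℝ] Mat d)).intervalIntegral_comp_comm hγi)
  refine intervalIntegral.integral_congr_ae (Eventually.of_forall fun u hu => ?_)
  rw [uIoc_of_le hy] at hu
  rw [gammaExt_of_neg (by linarith [hu.1]), neg_neg]
  rfl

theorem prim₂_gammaExt (hγ : IntegrableOn γ (Ioi 0) volume) {x : ℝ} (hx : 0 ≤ x) :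
    prim₂ (gammaExt γ S) x = (∫ u in (0 : ℝ)..x, kern D γ u) * S - x • (D * S) := by
  have hN := continuous_kern (D := D) hγ
  have e : prim₂ (gammaExt γ S) x = ∫ y in (0 : ℝ)..x, (kern D γ y * S - D * S) := by
    refine intervalIntegral.integral_congr fun y hy => ?_
    rw [uIcc_of_le hx] at hy
    simp only [integral_gammaExt_of_nonneg (D := D) hγ hy.1, sub_mul]
  rw [e, intervalIntegral.integral_sub
    ((by fun_prop : Continuous fun y => kern D γ y * S).intervalIntegrable _ _)
    intervalIntegrable_const, intervalIntegral.integral_const, sub_zero]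
  congr 1
  exact ((μl).flip S).intervalIntegral_comp_comm (hN.intervalIntegrable 0 x)

theorem prim₂_gammaExt_neg (hγ : IntegrableOn γ (Ioi 0) volume) {x : ℝ} (hx : 0 ≤ x) :
    prim₂ (gammaExt γ S) (-x) = S * (∫ u in (0 : ℝ)..x, kern D γ u)ᵀ - x • (S * Dᵀ) := by
  have hN := continuous_kern (D := D) hγ
  have hNT := hN.matrix_transpose
  have e : prim₂ (gammaExt γ S) (-x) = ∫ y in (0 : ℝ)..x, (S * (kern D γ y)ᵀ - S * Dᵀ) := by
    have e' := intervalIntegral.integral_comp_neg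
      (fun y => ∫ u in (0 : ℝ)..y, gammaExt γ S u) (a := 0) (b := x)
    rw [neg_zero] at e'
    rw [prim₂, intervalIntegral.integral_symm, ← e', ← intervalIntegral.integral_neg]
    refine intervalIntegral.integral_congr fun y hy => ?_
    rw [uIcc_of_le hx] at hy
    simp only [integral_gammaExt_neg (D := D) hγ hy.1, Matrix.transpose_sub, mul_sub, neg_neg]
  rw [e, intervalIntegral.integral_sub
    ((by fun_prop : Continuous fun y => S * (kern D γ y)ᵀ).intervalIntegrable _ _)
    intervalIntegrable_const, intervalIntegral.integral_const, sub_zero, intervalIntegral_transpose]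
  congr 1
  exact (μl S).intervalIntegral_comp_comm (hNT.intervalIntegrable 0 x)

/-- The fluctuation-dissipation identity for deterministic kernels: the Volterra operator in both
variables maps the stationary correlation kernel to the covariance of `V₀ + ∫ F`, where `F` has the
covariance `(D S + S D*) δ + γ_S`. -/
theorem volterra₂_corr (hγ : IntegrableOn γ (Ioi 0) volume) (hS : Sᵀ = S) {r : ℝ → Mat d}
    (hr : Continuous r) (h0 : r 0 = 1)
    (hrN : ∀ t, 0 ≤ t → r t + cconv μl (kern D γ) r t = 1) {s t : ℝ} (hs : 0 ≤ s) (ht : 0 ≤ t) :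
    volterra₂ (kern D γ) (fun s t => corr r S (s - t)) s t
      = S + covInc (D * S + S * Dᵀ) (gammaExt γ S) s t := by
  have hN := continuous_kern (D := D) hγ
  have hcorr := continuous_corr (S := S) hr h0
  rcases le_total t s with h | h
  · rw [volterra₂_corr_of_le hN hr h0 hrN ht h, covInc, min_eq_right h,
      prim₂_gammaExt hγ hs (D := D), prim₂_gammaExt_neg hγ ht (D := D),
      prim₂_gammaExt hγ (sub_nonneg.2 h) (D := D), sub_smul, smul_add]
    abel
  · rw [← volterra₂_transpose hN (by fun_prop)
      (fun s t => by rw [corr_transpose hS h0, neg_sub]),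
      volterra₂_corr_of_le hN hr h0 hrN hs h, covInc, min_eq_left h,
      prim₂_gammaExt hγ hs (D := D), prim₂_gammaExt_neg hγ ht (D := D),
      ← neg_sub t s, prim₂_gammaExt_neg hγ (sub_nonneg.2 h) (D := D), sub_smul, smul_add]
    simp only [Matrix.transpose_add, Matrix.transpose_sub, Matrix.transpose_mul, hS,
      Matrix.transpose_transpose]
    abel

end Fluctuation

/-! ### Square integrable functions on products, and Fubini's theorem for second moments -/

section SquareIntegrable

theorem memLp_two_iff_lintegral {Ω E : Type*} [MeasurableSpace Ω] {P : Measure Ω}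
    [NormedAddCommGroup E] {X : Ω → E} (hX : AEStronglyMeasurable X P) :
    MemLp X 2 P ↔ ∫⁻ ω, ‖X ω‖ₑ ^ 2 ∂P < ∞ := by
  rw [MemLp, and_iff_right hX, eLpNorm_lt_top_iff_lintegral_rpow_enorm_lt_top (by simp) (by simp)]
  simp

/-- A jointly measurable process with bounded second moments is square integrable on the product. -/
theorem memLp_uncurry {Ω E T : Type*} [MeasurableSpace Ω] {P : Measure Ω} [SFinite P]
    [NormedAddCommGroup E] [MeasurableSpace T] {μ : Measure T} [IsFiniteMeasure μ] {X : T → Ω → E}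
    (hX : AEStronglyMeasurable (Function.uncurry X) (μ.prod P)) {C : ℝ≥0}
    (hC : ∀ᵐ u ∂μ, ∫⁻ ω, ‖X u ω‖ₑ ^ 2 ∂P ≤ C) :
    MemLp (Function.uncurry X) 2 (μ.prod P) := by
  rw [memLp_two_iff_lintegral hX, lintegral_prod _ (hX.enorm.pow_const 2)]
  refine (lintegral_mono_ae hC).trans_lt ?_
  rw [lintegral_const]
  exact ENNReal.mul_lt_top ENNReal.coe_lt_top (measure_lt_top μ _)

variable {Ω : Type*} [MeasurableSpace Ω] {P : Measure Ω}
  {E F G : Type*} [NormedAddCommGroup E] [NormedSpace ℝ E] [NormedAddCommGroup F] [NormedSpace ℝ F]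
  [NormedAddCommGroup G] [NormedSpace ℝ G]

/-- Integrals of bilinear expressions are continuous with respect to convergence in mean square. -/
theorem tendsto_integral_bilin [CompleteSpace G] (B : E →L[ℝ] F →L[ℝ] G)
    {f : ℕ → Ω → E} {f' : Ω → E} {g : ℕ → Ω → F} {g' : Ω → F}
    (hf : ∀ n, MemLp (f n) 2 P) (hf' : MemLp f' 2 P) (hg : ∀ n, MemLp (g n) 2 P)
    (hg' : MemLp g' 2 P)
    (h : Tendsto (fun n => eLpNorm (fun ω => f' ω - f n ω) 2 P) atTop (𝓝 0))
    (h' : Tendsto (fun n => eLpNorm (fun ω => g' ω - g n ω) 2 P) atTop (𝓝 0)) :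
    Tendsto (fun n => ∫ ω, B (f n ω) (g n ω) ∂P) atTop (𝓝 (∫ ω, B (f' ω) (g' ω) ∂P)) := by
  have h1 : Tendsto (fun n => (hf n).toLp (f n)) atTop (𝓝 (hf'.toLp f')) := by
    rw [Lp.tendsto_Lp_iff_tendsto_eLpNorm'']
    refine h.congr fun n => ?_
    rw [← eLpNorm_neg]
    congr 1; ext ω; simp
  have h2 : Tendsto (fun n => (hg n).toLp (g n)) atTop (𝓝 (hg'.toLp g')) := by
    rw [Lp.tendsto_Lp_iff_tendsto_eLpNorm'']
    refine h'.congr fun n => ?_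
    rw [← eLpNorm_neg]
    congr 1; ext ω; simp
  have h3 : ∀ {f : Ω → E} {g : Ω → F} (hf : MemLp f 2 P) (hg : MemLp g 2 P),
      B.lpPairing P 2 2 (hf.toLp f) (hg.toLp g) = ∫ ω, B (f ω) (g ω) ∂P := by
    intro f g hf hg
    rw [ContinuousLinearMap.lpPairing_eq_integral]
    refine integral_congr_ae ?_
    filter_upwards [hf.coeFn_toLp, hg.coeFn_toLp] with ω e1 e2
    rw [e1, e2]
  have h4 := ((B.lpPairing P 2 2).continuous₂.tendsto (hf'.toLp f', hg'.toLp g')).comp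
    (h1.prodMk_nhds h2)
  simpa only [Function.comp_def, Function.uncurry_apply_pair, h3] using h4

theorem integrable_bilin (B : E →L[ℝ] F →L[ℝ] G) {X : Ω → E} {Y : Ω → F} (hX : MemLp X 2 P)
    (hY : MemLp Y 2 P) : Integrable (fun ω => B (X ω) (Y ω)) P :=
  memLp_one_iff_integrable.1 (B.memLp_of_bilin 1 hX hY)

variable {T : Type*} [MeasurableSpace T] {μ : Measure T}

/-- A bounded deterministic factor preserves square integrability on the product. -/
theorem memLp_uncurry_bilin (L : G →L[ℝ] E →L[ℝ] F) {X : T → Ω → E} {c : T → G} [SFinite P]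
    (hX : MemLp (Function.uncurry X) 2 (μ.prod P)) (hc : AEStronglyMeasurable c μ) {C : ℝ}
    (hC : ∀ᵐ u ∂μ, ‖c u‖ ≤ C) :
    MemLp (Function.uncurry fun u ω => L (c u) (X u ω)) 2 (μ.prod P) := by
  have hc' : AEStronglyMeasurable (fun p : T × Ω => c p.1) (μ.prod P) := hc.comp_fst
  refine MemLp.of_le_mul (c := ‖L‖ * C) hX
    (L.aestronglyMeasurable_comp₂ hc' hX.aestronglyMeasurable) ?_
  filter_upwards [Measure.quasiMeasurePreserving_fst.ae hC] with p hp
  exact (L.le_opNorm₂ _ _).trans (mul_le_mul_of_nonneg_right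
    (mul_le_mul_of_nonneg_left hp (norm_nonneg L)) (norm_nonneg _))

variable [IsFiniteMeasure μ]

theorem memLp_integral [SFinite P] {X : T → Ω → E}
    (hX : MemLp (Function.uncurry X) 2 (μ.prod P)) :
    MemLp (fun ω => ∫ u, X u ω ∂μ) 2 P := by
  have hm := hX.aestronglyMeasurable
  have hm' : AEStronglyMeasurable (fun p : Ω × T => X p.2 p.1) (P.prod μ) := hm.prod_swap
  have hXm : AEStronglyMeasurable (fun ω => ∫ u, X u ω ∂μ) P := hm'.integral_prod_right'
  rw [memLp_two_iff_lintegral hXm]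
  rw [memLp_two_iff_lintegral hm] at hX
  have h1 : ∀ᵐ ω ∂P, ‖∫ u, X u ω ∂μ‖ₑ ^ 2 ≤ μ univ * ∫⁻ u, ‖X u ω‖ₑ ^ 2 ∂μ := by
    filter_upwards [hm'.prodMk_left] with ω hω
    have h2 := ENNReal.lintegral_mul_le_Lp_mul_Lq μ (p := 2) (q := 2) ⟨by norm_num, by norm_num,
      by norm_num⟩ hω.enorm (aemeasurable_const (b := (1 : ℝ≥0∞)))
    have h3 : ‖∫ u, X u ω ∂μ‖ₑ ≤ (∫⁻ u, ‖X u ω‖ₑ ^ (2 : ℝ) ∂μ) ^ (1 / 2 : ℝ)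
        * (μ univ) ^ (1 / 2 : ℝ) := by
      refine (enorm_integral_le_lintegral_enorm _).trans ?_
      simpa using h2
    calc ‖∫ u, X u ω ∂μ‖ₑ ^ 2 ≤ ((∫⁻ u, ‖X u ω‖ₑ ^ (2 : ℝ) ∂μ) ^ (1 / 2 : ℝ)
        * (μ univ) ^ (1 / 2 : ℝ)) ^ 2 := by gcongr
      _ = μ univ * ∫⁻ u, ‖X u ω‖ₑ ^ 2 ∂μ := by
        rw [mul_pow, ← ENNReal.rpow_natCast, ← ENNReal.rpow_mul, ← ENNReal.rpow_natCast,
          ← ENNReal.rpow_mul, mul_comm]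
        norm_num
  refine (lintegral_mono_ae h1).trans_lt ?_
  rw [lintegral_const_mul' _ _ (measure_ne_top μ _), lintegral_lintegral_swap
    (hm'.enorm.pow_const 2)]
  rw [lintegral_prod _ (hm.enorm.pow_const 2)] at hX
  exact ENNReal.mul_lt_top (measure_lt_top μ _) hX

theorem integrable_uncurry_bilin [SFinite P] (B : E →L[ℝ] F →L[ℝ] G) {X : T → Ω → E} {Y : Ω → F}
    (hX : MemLp (Function.uncurry X) 2 (μ.prod P)) (hY : MemLp Y 2 P) :
    Integrable (Function.uncurry fun u ω => B (X u ω) (Y ω)) (μ.prod P) :=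
  integrable_bilin B hX (hY.comp_snd μ)

variable [CompleteSpace E] [CompleteSpace G]

/-- Fubini's theorem for the second moments of the integral of a process. -/
theorem integral_bilin_integral [SFinite P] [IsFiniteMeasure P] (B : E →L[ℝ] F →L[ℝ] G)
    {X : T → Ω → E} {Y : Ω → F}
    (hX : MemLp (Function.uncurry X) 2 (μ.prod P)) (hY : MemLp Y 2 P) :
    ∫ ω, B (∫ u, X u ω ∂μ) (Y ω) ∂P = ∫ u, ∫ ω, B (X u ω) (Y ω) ∂P ∂μ := by
  rw [integral_integral_swap (integrable_uncurry_bilin B hX hY)]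
  refine integral_congr_ae ?_
  have hXi : Integrable (Function.uncurry X) (μ.prod P) := hX.integrable (by norm_num)
  filter_upwards [hXi.swap.prod_right_ae] with ω hω
  exact ((B.flip (Y ω)).integral_comp_comm hω).symm

end SquareIntegrable

/-! ### Calculus of mixed second moments -/

section CrossMoment

variable {Ω : Type*} [MeasurableSpace Ω] {P : Measure Ω} {d : ℕ}

/-- The bilinear map `(A, x) ↦ A x`. -/
def mulVecL (d : ℕ) : Mat d →L[ℝ] Vec d →L[ℝ] Vec d :=
  LinearMap.toContinuousBilinearMap (Matrix.mulVecBilin ℝ ℝ)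

/-- The bilinear map `(x, y) ↦ x y*`. -/
def outerL (d : ℕ) : Vec d →L[ℝ] Vec d →L[ℝ] Mat d :=
  LinearMap.toContinuousBilinearMap (LinearMap.mk₂ ℝ Matrix.vecMulVec
    Matrix.add_vecMulVec Matrix.smul_vecMulVec Matrix.vecMulVec_add Matrix.vecMulVec_smul)

@[simp] theorem mulVecL_apply (A : Mat d) (x : Vec d) : mulVecL d A x = A *ᵥ x := rfl

theorem integral_apply_apply {α : Type*} [MeasurableSpace α] {μ : Measure α} {f : α → Mat d}
    (hf : Integrable f μ) (i j : Fin d) : (∫ x, f x ∂μ) i j = ∫ x, f x i j ∂μ :=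
  ((LinearMap.toContinuousLinearMap (Matrix.entryLinearMap ℝ ℝ i j)).integral_comp_comm hf).symm

variable {X X' Y Y' : Ω → Vec d}

theorem integrable_outer (hX : MemLp X 2 P) (hY : MemLp Y 2 P) :
    Integrable (fun ω => Matrix.vecMulVec (X ω) (Y ω)) P :=
  integrable_bilin (outerL d) hX hY

theorem crossMoment_eq_integral (hX : MemLp X 2 P) (hY : MemLp Y 2 P) :
    crossMoment P X Y = ∫ ω, Matrix.vecMulVec (X ω) (Y ω) ∂P := by
  ext i j
  rw [integral_apply_apply (integrable_outer hX hY)]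
  rfl

theorem crossMoment_transpose (X Y : Ω → Vec d) :
    (crossMoment P X Y)ᵀ = crossMoment P Y X := by
  ext i j
  simp only [crossMoment, Matrix.transpose_apply, Matrix.of_apply, mul_comm]

theorem crossMoment_congr (hX : X =ᵐ[P] X') (hY : Y =ᵐ[P] Y') :
    crossMoment P X Y = crossMoment P X' Y' := by
  ext i j
  simp only [crossMoment, Matrix.of_apply]
  refine integral_congr_ae ?_
  filter_upwards [hX, hY] with ω h1 h2
  rw [h1, h2]

theorem crossMoment_add_left (hX : MemLp X 2 P) (hX' : MemLp X' 2 P) (hY : MemLp Y 2 P) :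
    crossMoment P (X + X') Y = crossMoment P X Y + crossMoment P X' Y := by
  rw [crossMoment_eq_integral (hX.add hX') hY, crossMoment_eq_integral hX hY,
    crossMoment_eq_integral hX' hY, ← integral_add (integrable_outer hX hY)
    (integrable_outer hX' hY)]
  simp only [Pi.add_apply, Matrix.add_vecMulVec]

theorem crossMoment_sub_left (hX : MemLp X 2 P) (hX' : MemLp X' 2 P) (hY : MemLp Y 2 P) :
    crossMoment P (X - X') Y = crossMoment P X Y - crossMoment P X' Y := by
  rw [crossMoment_eq_integral (hX.sub hX') hY, crossMoment_eq_integral hX hY,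
    crossMoment_eq_integral hX' hY, ← integral_sub (integrable_outer hX hY)
    (integrable_outer hX' hY)]
  simp only [Pi.sub_apply, Matrix.sub_vecMulVec]

theorem memLp_mulVec (A : Mat d) (hX : MemLp X 2 P) : MemLp (fun ω => A *ᵥ X ω) 2 P :=
  (mulVecL d A).comp_memLp' hX

theorem crossMoment_mulVec_left (A : Mat d) (hX : MemLp X 2 P) (hY : MemLp Y 2 P) :
    crossMoment P (fun ω => A *ᵥ X ω) Y = A * crossMoment P X Y := by
  rw [crossMoment_eq_integral (memLp_mulVec A hX) hY, crossMoment_eq_integral hX hY]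
  refine Eq.trans ?_ ((ContinuousLinearMap.mul ℝ (Mat d) A).integral_comp_comm
    (integrable_outer hX hY))
  simp [Matrix.mul_vecMulVec]

theorem crossMoment_sum_left {ι : Type*} (s : Finset ι) {X : ι → Ω → Vec d}
    (hX : ∀ i, MemLp (X i) 2 P) (hY : MemLp Y 2 P) :
    crossMoment P (fun ω => ∑ i ∈ s, X i ω) Y = ∑ i ∈ s, crossMoment P (X i) Y := by
  rw [crossMoment_eq_integral (memLp_finsetSum s fun i _ => hX i) hY,
    Finset.sum_congr rfl fun i _ => crossMoment_eq_integral (hX i) hY,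
    ← integral_finsetSum _ fun i _ => integrable_outer (hX i) hY]
  congr 1; ext1 ω
  change outerL d (∑ i ∈ s, X i ω) (Y ω) = ∑ i ∈ s, outerL d (X i ω) (Y ω)
  rw [map_sum, _root_.sum_apply]

theorem crossMoment_add_right (hX : MemLp X 2 P) (hY : MemLp Y 2 P) (hY' : MemLp Y' 2 P) :
    crossMoment P X (Y + Y') = crossMoment P X Y + crossMoment P X Y' := by
  rw [← Matrix.transpose_inj, Matrix.transpose_add]
  simp only [crossMoment_transpose]
  exact crossMoment_add_left hY hY' hX

theorem crossMoment_sub_right (hX : MemLp X 2 P) (hY : MemLp Y 2 P) (hY' : MemLp Y' 2 P) :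
    crossMoment P X (Y - Y') = crossMoment P X Y - crossMoment P X Y' := by
  rw [← Matrix.transpose_inj, Matrix.transpose_sub]
  simp only [crossMoment_transpose]
  exact crossMoment_sub_left hY hY' hX

theorem crossMoment_mulVec_right (A : Mat d) (hX : MemLp X 2 P) (hY : MemLp Y 2 P) :
    crossMoment P X (fun ω => A *ᵥ Y ω) = crossMoment P X Y * Aᵀ := by
  rw [← Matrix.transpose_inj, Matrix.transpose_mul, Matrix.transpose_transpose]
  simp only [crossMoment_transpose]
  exact crossMoment_mulVec_left A hY hX

theorem crossMoment_sum_right {ι : Type*} (s : Finset ι) {Y : ι → Ω → Vec d}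
    (hX : MemLp X 2 P) (hY : ∀ i, MemLp (Y i) 2 P) :
    crossMoment P X (fun ω => ∑ i ∈ s, Y i ω) = ∑ i ∈ s, crossMoment P X (Y i) := by
  rw [← Matrix.transpose_inj, Matrix.transpose_sum]
  simp only [crossMoment_transpose]
  exact crossMoment_sum_left s hY hX

/-- The second moment of the norm is controlled by the trace of the second moment matrix. -/
theorem lintegral_enorm_sq_le (hX : MemLp X 2 P) :
    ∫⁻ ω, ‖X ω‖ₑ ^ 2 ∂P ≤ ENNReal.ofReal (crossMoment P X X).trace := by
  have hi : ∀ i, Integrable (fun ω => X ω i * X ω i) P := fun i =>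
    (hX.eval i).integrable_mul (hX.eval i)
  have h1 : (crossMoment P X X).trace = ∫ ω, ∑ i, X ω i * X ω i ∂P := by
    rw [integral_finsetSum _ fun i _ => hi i]
    rfl
  rw [h1, ofReal_integral_eq_lintegral_ofReal (integrable_finsetSum _ fun i _ => hi i)
    (Eventually.of_forall fun ω => Finset.sum_nonneg fun i _ => mul_self_nonneg _)]
  refine lintegral_mono fun ω => ?_
  rw [← ofReal_norm, ← ENNReal.ofReal_pow (norm_nonneg _)]
  refine ENNReal.ofReal_le_ofReal ?_
  have h2 : ‖X ω‖ ≤ Real.sqrt (∑ i, X ω i * X ω i) := by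
    refine (pi_norm_le_iff_of_nonneg (Real.sqrt_nonneg _)).2 fun i => ?_
    refine Real.le_sqrt_of_sq_le ?_
    rw [Real.norm_eq_abs, sq_abs, sq]
    exact Finset.single_le_sum (f := fun i => X ω i * X ω i) (fun j _ => mul_self_nonneg _)
      (Finset.mem_univ i)
  calc ‖X ω‖ ^ 2 ≤ Real.sqrt (∑ i, X ω i * X ω i) ^ 2 := by gcongr
    _ = _ := Real.sq_sqrt (Finset.sum_nonneg fun i _ => mul_self_nonneg _)

variable {T : Type*} [MeasurableSpace T] {μ : Measure T} [IsFiniteMeasure μ] [IsFiniteMeasure P]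

/-- The mixed moment of the integral of a process is the integral of the mixed moments. -/
theorem crossMoment_integral_left {X : T → Ω → Vec d}
    (hX : MemLp (Function.uncurry X) 2 (μ.prod P)) (hY : MemLp Y 2 P) :
    crossMoment P (fun ω => ∫ u, X u ω ∂μ) Y = ∫ u, crossMoment P (X u) Y ∂μ := by
  rw [crossMoment_eq_integral (memLp_integral hX) hY]
  refine (integral_bilin_integral (outerL d) hX hY).trans (integral_congr_ae ?_)
  have h1 := hX.aestronglyMeasurable.prodMk_left
  have h2 := (memLp_two_iff_lintegral hX.aestronglyMeasurable).1 hX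
  rw [lintegral_prod _ (hX.aestronglyMeasurable.enorm.pow_const 2)] at h2
  have h3 := ae_lt_top' (hX.aestronglyMeasurable.enorm.pow_const 2).lintegral_prod_right' h2.ne
  filter_upwards [h1, h3] with u hu hu'
  exact (crossMoment_eq_integral ((memLp_two_iff_lintegral hu).2 hu') hY).symm

end CrossMoment

/-! ### Second moments of Wiener integrals -/

section Wiener

variable {Ω : Type*} [MeasurableSpace Ω] {P : Measure Ω} {d : ℕ} {W : ℝ → Ω → Vec d}

theorem IsTwoSidedBrownian.memLp (hW : IsTwoSidedBrownian W P) (t : ℝ) : MemLp (W t) 2 P :=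
  (hW.isGaussianProcess.hasGaussianLaw_eval t).memLp_two

theorem IsTwoSidedBrownian.ae_eq_zero (hW : IsTwoSidedBrownian W P) : W 0 =ᵐ[P] 0 := by
  have h := lintegral_enorm_sq_le (hW.memLp 0)
  rw [hW.covariance 0 0] at h
  simp only [abs_zero, add_zero, sub_self, zero_div, zero_smul, Matrix.trace_zero,
    ENNReal.ofReal_zero, nonpos_iff_eq_zero] at h
  rw [lintegral_eq_zero_iff' ((hW.memLp 0).aestronglyMeasurable.enorm.pow_const 2)] at h
  filter_upwards [h] with ω hω
  simpa using hω

/-- The covariance of two increments is the length of the overlap. -/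
theorem IsTwoSidedBrownian.crossMoment_increments (hW : IsTwoSidedBrownian W P) {a b c e : ℝ}
    (hab : a ≤ b) (hce : c ≤ e) :
    crossMoment P (W b - W a) (W e - W c)
      = volume.real (Ioc a b ∩ Ioc c e) • (1 : Mat d) := by
  rw [crossMoment_sub_left (hW.memLp b) (hW.memLp a) ((hW.memLp e).sub (hW.memLp c)),
    crossMoment_sub_right (hW.memLp b) (hW.memLp e) (hW.memLp c),
    crossMoment_sub_right (hW.memLp a) (hW.memLp e) (hW.memLp c),
    hW.covariance, hW.covariance, hW.covariance, hW.covariance, ← sub_smul, ← sub_smul, ← sub_smul]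
  congr 1
  rw [Ioc_inter_Ioc, Real.volume_real_Ioc]
  have key : ∀ x y : ℝ, |x - y| = max x y - min x y := fun x y => by
    rw [abs_sub_comm, max_sub_min_eq_abs]
  rcases le_total a c with h1 | h1 <;> rcases le_total b e with h2 | h2 <;>
    rcases le_total a e with h3 | h3 <;> rcases le_total b c with h4 | h4 <;>
    simp only [key, h1, h2, h3, h4, max_eq_left, max_eq_right, min_eq_left, min_eq_right] <;>
    first
      | (rw [max_eq_left (by linarith)]; linarith)
      | (rw [max_eq_right (by linarith)]; linarith)

theorem StepFunction.memLp_toFun (g : StepFunction d) : MemLp g.toFun 2 volume := by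
  unfold StepFunction.toFun
  refine memLp_finsetSum _ fun i _ => ?_
  exact memLp_indicator_const 2 measurableSet_Ioc _ (Or.inr (by simp))

theorem StepFunction.memLp_integral (g : StepFunction d) (hW : IsTwoSidedBrownian W P) :
    MemLp (g.integral W) 2 P := by
  unfold StepFunction.integral
  exact memLp_finsetSum _ fun i _ =>
    memLp_mulVec (g.coeff i) ((hW.memLp (g.right i)).sub (hW.memLp (g.left i)))

/-- The Wiener isometry for step functions. -/
theorem StepFunction.crossMoment_integral (g h : StepFunction d) (hW : IsTwoSidedBrownian W P) :
    crossMoment P (g.integral W) (h.integral W) = ∫ s, g.toFun s * (h.toFun s)ᵀ := by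
  have hinc : ∀ a b, MemLp (W b - W a) 2 P := fun a b => (hW.memLp b).sub (hW.memLp a)
  have hm : ∀ (A : Mat d) a b, MemLp (fun ω => A *ᵥ (W b - W a) ω) 2 P := fun A a b =>
    memLp_mulVec A (hinc a b)
  have h1 : crossMoment P (g.integral W) (h.integral W) = ∑ i, ∑ j,
      volume.real (Ioc (g.left i) (g.right i) ∩ Ioc (h.left j) (h.right j)) •
        (g.coeff i * (h.coeff j)ᵀ) := by
    have e1 := crossMoment_sum_left (Y := h.integral W) Finset.univ
      (fun i => hm (g.coeff i) (g.left i) (g.right i)) (h.memLp_integral hW)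
    refine e1.trans (Finset.sum_congr rfl fun i _ => ?_)
    have e2 := crossMoment_sum_right Finset.univ (hm (g.coeff i) (g.left i) (g.right i))
      (fun j => hm (h.coeff j) (h.left j) (h.right j))
    refine e2.trans (Finset.sum_congr rfl fun j _ => ?_)
    rw [crossMoment_mulVec_left _ (hinc _ _) (hm _ _ _), crossMoment_mulVec_right _ (hinc _ _)
      (hinc _ _), hW.crossMoment_increments (g.left_le_right i) (h.left_le_right j)]
    simp
  have h2 : ∀ s, g.toFun s * (h.toFun s)ᵀ = ∑ i, ∑ j,
      (Ioc (g.left i) (g.right i) ∩ Ioc (h.left j) (h.right j)).indicator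
        (fun _ => g.coeff i * (h.coeff j)ᵀ) s := by
    intro s
    simp only [StepFunction.toFun, Matrix.transpose_sum, Finset.sum_mul_sum]
    refine Finset.sum_congr rfl fun i _ => Finset.sum_congr rfl fun j _ => ?_
    by_cases hi : s ∈ Ioc (g.left i) (g.right i) <;>
      by_cases hj : s ∈ Ioc (h.left j) (h.right j) <;>
      simp only [indicator, mem_inter_iff, hi, hj, and_true, and_false, if_true, if_false,
        Matrix.transpose_zero, mul_zero, zero_mul]
  have hmeas : ∀ i j, MeasurableSet
      (Ioc (g.left i) (g.right i) ∩ Ioc (h.left j) (h.right j)) := fun i j =>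
    measurableSet_Ioc.inter measurableSet_Ioc
  have hfin : ∀ i j, volume (Ioc (g.left i) (g.right i) ∩ Ioc (h.left j) (h.right j)) ≠ ∞ :=
    fun i j => ((measure_mono inter_subset_left).trans_lt measure_Ioc_lt_top).ne
  have hint : ∀ i j, Integrable ((Ioc (g.left i) (g.right i) ∩
      Ioc (h.left j) (h.right j)).indicator fun _ => g.coeff i * (h.coeff j)ᵀ) volume := fun i j =>
    (integrable_indicator_iff (hmeas i j)).2 (integrableOn_const (hfin i j))
  simp only [h1, h2]
  rw [integral_finsetSum _ fun i _ => integrable_finsetSum _ fun j _ => hint i j]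
  refine Finset.sum_congr rfl fun i _ => ?_
  rw [integral_finsetSum _ fun j _ => hint i j]
  refine Finset.sum_congr rfl fun j _ => ?_
  rw [integral_indicator_const _ (hmeas i j)]

variable {f f' : ℝ → Mat d} {X Y : Ω → Vec d}

theorem IsWienerIntegral.memLp_two (hW : IsTwoSidedBrownian W P) (hX : IsWienerIntegral W P f X) :
    MemLp X 2 P := by
  obtain ⟨-, hXm, g, -, hg⟩ := hX
  obtain ⟨n, hn⟩ := (hg.eventually (gt_mem_nhds ENNReal.zero_lt_top)).exists
  have hd : MemLp (fun ω => X ω - (g n).integral W ω) 2 P :=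
    ⟨hXm.sub ((g n).memLp_integral hW).aestronglyMeasurable, hn⟩
  refine (hd.add ((g n).memLp_integral hW)).ae_eq (Eventually.of_forall fun ω => ?_)
  simp

/-- The Wiener isometry. -/
theorem IsWienerIntegral.crossMoment_eq (hW : IsTwoSidedBrownian W P)
    (hX : IsWienerIntegral W P f X) (hY : IsWienerIntegral W P f' Y) :
    crossMoment P X Y = ∫ s, f s * (f' s)ᵀ := by
  have hX2 := hX.memLp_two hW
  have hY2 := hY.memLp_two hW
  obtain ⟨hf, -, g, hg, hgX⟩ := hX
  obtain ⟨hf', -, h, hh, hhY⟩ := hY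
  have l1 := tendsto_integral_bilin (outerL d) (fun n => (g n).memLp_integral hW) hX2
    (fun n => (h n).memLp_integral hW) hY2 hgX hhY
  -- The bilinear map `(A, B) ↦ A B*`.
  have l2 := tendsto_integral_bilin ((ContinuousLinearMap.mul ℝ (Mat d)).bilinearComp
    (ContinuousLinearMap.id ℝ (Mat d)) (((Matrix.transposeLinearEquiv (Fin d) (Fin d) ℝ
      ℝ).toContinuousLinearEquiv : Mat d →L[ℝ] Mat d)))
    (fun n => (g n).memLp_toFun) hf (fun n => (h n).memLp_toFun) hf' hg hh
  rw [crossMoment_eq_integral hX2 hY2]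
  refine tendsto_nhds_unique l1 (l2.congr fun n => ?_)
  refine Eq.trans ?_ (crossMoment_eq_integral ((g n).memLp_integral hW)
    ((h n).memLp_integral hW))
  rw [StepFunction.crossMoment_integral _ _ hW]
  rfl

theorem IsTwoSidedBrownian.isWienerIntegral (hW : IsTwoSidedBrownian W P) {t : ℝ} (ht : 0 ≤ t) :
    IsWienerIntegral W P ((Ioc 0 t).indicator fun _ => 1) (W t) := by
  refine ⟨memLp_indicator_const 2 measurableSet_Ioc _ (Or.inr (by simp)),
    (hW.memLp t).aestronglyMeasurable,
    fun _ => ⟨1, fun _ => 0, fun _ => t, fun _ => ht, fun _ => 1⟩, ?_, ?_⟩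
  · simp [StepFunction.toFun]
  · refine tendsto_const_nhds.congr fun _ => ?_
    rw [eq_comm, eLpNorm_congr_ae (g := fun _ => 0), eLpNorm_zero']
    filter_upwards [hW.ae_eq_zero] with ω hω
    simp [StepFunction.integral, hω]

end Wiener

/-! ### Measurable modifications of processes with continuous paths -/

section Modification

variable {Ω : Type*} [MeasurableSpace Ω] {P : Measure Ω} {E : Type*} [TopologicalSpace E] [Zero E]
  [TopologicalSpace.PseudoMetrizableSpace E] [MeasurableSpace E] [BorelSpace E]

/-- A process with almost surely continuous paths is indistinguishable from a jointly measurable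
process. -/
theorem exists_measurable_modification {X : ℝ → Ω → E} (hX : ∀ t, AEMeasurable (X t) P)
    (hc : ∀ᵐ ω ∂P, Continuous fun t => X t ω) :
    ∃ X' : ℝ → Ω → E, Measurable (Function.uncurry X') ∧ ∀ᵐ ω ∂P, ∀ t, X t ω = X' t ω := by
  have h : ∀ᵐ ω ∂P, (Continuous fun t => X t ω) ∧
      ∀ q : ℚ, X q ω = (hX q).mk (X q) ω :=
    hc.and (ae_all_iff.2 fun q => (hX q).ae_eq_mk)
  obtain ⟨N, hN, hNm, hN0⟩ := exists_measurable_superset_of_null h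
  have hgood : ∀ ω ∉ N, (Continuous fun t => X t ω) ∧
      ∀ q : ℚ, X q ω = (hX q).mk (X q) ω := fun ω hω => by
    by_contra hcon
    exact hω (hN hcon)
  refine ⟨fun t => Nᶜ.indicator (X t), ?_, ?_⟩
  · have hcont : ∀ ω, Continuous fun t => Nᶜ.indicator (X t) ω := by
      intro ω
      by_cases hω : ω ∈ N
      · simp [hω, continuous_const]
      · simpa [hω] using (hgood ω hω).1
    refine measurable_uncurry_of_continuous_of_measurable hcont fun t => ?_
    have hq : ∀ q : ℚ, Measurable (Nᶜ.indicator (X q)) := by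
      intro q
      have : Nᶜ.indicator (X q) = Nᶜ.indicator ((hX q).mk (X q)) := by
        refine indicator_congr fun ω hω => ?_
        exact (hgood ω hω).2 q
      rw [this]
      exact (hX q).measurable_mk.indicator hNm.compl
    obtain ⟨u, -, -, hu⟩ := Real.exists_seq_rat_strictMono_tendsto t
    exact measurable_of_tendsto_metrizable (fun n => hq (u n)) (tendsto_pi_nhds.2 fun ω =>
      ((hcont ω).tendsto t).comp hu)
  · filter_upwards [compl_mem_ae_iff.2 hN0] with ω hω t
    exact (indicator_of_mem hω _).symm

end Modification

/-! ### Second moments of the integrated force -/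

section Force

variable {Ω : Type*} [MeasurableSpace Ω] {P : Measure Ω} {d : ℕ} {W W' : ℝ → Ω → Vec d}
  {F₀ : ℝ → Ω → Vec d} {φ : ℝ → Mat d} {G : Mat d}

local notation "μl" => ContinuousLinearMap.mul ℝ (Mat d)

theorem crossMoment_force (hW' : IsTwoSidedBrownian W' P)
    (hF : ∀ t, IsWienerIntegral W' P (fun s => φ (t - s)) (F₀ t)) (a b : ℝ) :
    crossMoment P (F₀ a) (F₀ b) = matConv φ (revT φ) (a - b) := by
  rw [(hF a).crossMoment_eq hW' (hF b)]
  have h := integral_sub_left_eq_self (fun s => φ s * (φ (b - a + s))ᵀ) volume a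
  have e : ∀ x, b - a + (a - x) = b - x := fun x => by ring
  simp only [e] at h
  rw [h, matConv, convolution]
  refine integral_congr_ae (Eventually.of_forall fun s => ?_)
  have : -(a - b - s) = b - a + s := by ring
  simp [revT, this]

theorem crossMoment_brownian (hW : IsTwoSidedBrownian W P) {s t : ℝ} (hs : 0 ≤ s) (ht : 0 ≤ t) :
    crossMoment P (W s) (W t) = min s t • (1 : Mat d) := by
  rw [hW.covariance, abs_of_nonneg hs, abs_of_nonneg ht]
  congr 1
  rcases le_total s t with h | h
  · rw [abs_of_nonpos (sub_nonpos.2 h), min_eq_left h]; ring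
  · rw [abs_of_nonneg (sub_nonneg.2 h), min_eq_right h]; ring

theorem crossMoment_force_brownian (hW : IsTwoSidedBrownian W P)
    (hF : ∀ t, IsWienerIntegral W P (fun s => φ (t - s)) (F₀ t)) (a : ℝ) {t : ℝ} (ht : 0 ≤ t) :
    crossMoment P (F₀ a) (W t) = ∫ u in (0 : ℝ)..t, φ (a - u) := by
  rw [(hF a).crossMoment_eq hW (hW.isWienerIntegral ht), intervalIntegral.integral_of_le ht,
    ← integral_indicator measurableSet_Ioc]
  refine integral_congr_ae (Eventually.of_forall fun s => ?_)
  by_cases hs : s ∈ Ioc 0 t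
  · simp only [indicator_of_mem hs]; simp
  · simp only [indicator_of_notMem hs]; simp

variable [IsProbabilityMeasure P]

theorem memLp_uncurry_force (hW' : IsTwoSidedBrownian W' P)
    (hFm : Measurable (Function.uncurry F₀))
    (hF : ∀ t, IsWienerIntegral W' P (fun s => φ (t - s)) (F₀ t)) (μ : Measure ℝ)
    [IsFiniteMeasure μ] : MemLp (Function.uncurry F₀) 2 (μ.prod P) := by
  refine memLp_uncurry hFm.aestronglyMeasurable
    (C := Real.toNNReal (matConv φ (revT φ) 0).trace) (Eventually.of_forall fun u => ?_)
  have := lintegral_enorm_sq_le ((hF u).memLp_two hW')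
  rwa [crossMoment_force hW' hF, sub_self] at this

theorem locallyIntegrable_conv (hW' : IsTwoSidedBrownian W' P)
    (hFm : Measurable (Function.uncurry F₀))
    (hF : ∀ t, IsWienerIntegral W' P (fun s => φ (t - s)) (F₀ t)) :
    LocallyIntegrable (matConv φ (revT φ)) volume := by
  rw [locallyIntegrable_iff]
  intro K hK
  have : IsFiniteMeasure (volume.restrict K) := ⟨by simpa using hK.measure_lt_top⟩
  have h0 := (hF 0).memLp_two hW'
  have hi := (integrable_uncurry_bilin (outerL d) (memLp_uncurry_force hW' hFm hF
    (volume.restrict K)) h0).integral_prod_left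
  refine hi.congr (Eventually.of_forall fun u => ?_)
  have h1 := crossMoment_force hW' hF u 0
  rw [sub_zero, crossMoment_eq_integral ((hF u).memLp_two hW') h0] at h1
  exact h1

theorem ae_locallyIntegrable_force (hW' : IsTwoSidedBrownian W' P)
    (hFm : Measurable (Function.uncurry F₀))
    (hF : ∀ t, IsWienerIntegral W' P (fun s => φ (t - s)) (F₀ t)) :
    ∀ᵐ ω ∂P, LocallyIntegrable (fun t => F₀ t ω) volume := by
  have h : ∀ n : ℕ, ∀ᵐ ω ∂P, IntegrableOn (fun t => F₀ t ω) (Icc (-n : ℝ) n) volume := by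
    intro n
    have hXi : Integrable (Function.uncurry F₀) ((volume.restrict (Icc (-n : ℝ) n)).prod P) :=
      (memLp_uncurry_force hW' hFm hF _).integrable (by norm_num)
    exact hXi.swap.prod_right_ae
  filter_upwards [ae_all_iff.2 h] with ω hω
  rw [locallyIntegrable_iff]
  intro K hK
  obtain ⟨R, hR⟩ := hK.isBounded.subset_closedBall 0
  obtain ⟨n, hn⟩ := exists_nat_ge R
  refine (hω n).mono_set (hR.trans ?_)
  rw [Real.closedBall_eq_Icc]
  exact Icc_subset_Icc (by linarith) (by linarith)

theorem memLp_integral_force (hW' : IsTwoSidedBrownian W' P)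
    (hFm : Measurable (Function.uncurry F₀))
    (hF : ∀ t, IsWienerIntegral W' P (fun s => φ (t - s)) (F₀ t)) {t : ℝ} (ht : 0 ≤ t) :
    MemLp (fun ω => ∫ u in (0 : ℝ)..t, F₀ u ω) 2 P := by
  simp only [intervalIntegral.integral_of_le ht]
  exact memLp_integral (memLp_uncurry_force hW' hFm hF _)

theorem crossMoment_integral_force (hW' : IsTwoSidedBrownian W' P)
    (hFm : Measurable (Function.uncurry F₀))
    (hF : ∀ t, IsWienerIntegral W' P (fun s => φ (t - s)) (F₀ t)) {t : ℝ} (ht : 0 ≤ t)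
    {Y : Ω → Vec d} (hY : MemLp Y 2 P) :
    crossMoment P (fun ω => ∫ u in (0 : ℝ)..t, F₀ u ω) Y
      = ∫ u in (0 : ℝ)..t, crossMoment P (F₀ u) Y := by
  simp only [intervalIntegral.integral_of_le ht]
  exact crossMoment_integral_left (memLp_uncurry_force hW' hFm hF _) hY

theorem memLp_integratedForce (hW : IsTwoSidedBrownian W P) (hW' : IsTwoSidedBrownian W' P)
    (hFm : Measurable (Function.uncurry F₀))
    (hF : ∀ t, IsWienerIntegral W' P (fun s => φ (t - s)) (F₀ t)) {t : ℝ} (ht : 0 ≤ t) :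
    MemLp (integratedForce F₀ G W t) 2 P :=
  (memLp_integral_force hW' hFm hF ht).add (memLp_mulVec G (hW.memLp t))

theorem ae_continuous_integratedForce (hW : IsTwoSidedBrownian W P)
    (hW' : IsTwoSidedBrownian W' P) (hFm : Measurable (Function.uncurry F₀))
    (hF : ∀ t, IsWienerIntegral W' P (fun s => φ (t - s)) (F₀ t)) :
    ∀ᵐ ω ∂P, Continuous fun t => integratedForce F₀ G W t ω := by
  filter_upwards [ae_locallyIntegrable_force hW' hFm hF, hW.continuous_paths] with ω h1 h2
  exact (continuous_prim h1).add (((mulVecL d) G).continuous.comp h2)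

theorem prim₂_mul_const {k : ℝ → Mat d} (hk : LocallyIntegrable k volume) (B : Mat d) (x : ℝ) :
    prim₂ (fun u => k u * B) x = prim₂ k x * B := by
  have h1 : ∀ y, ∫ u in (0 : ℝ)..y, k u * B = (∫ u in (0 : ℝ)..y, k u) * B := fun y =>
    ((μl).flip B).intervalIntegral_comp_comm (intervalIntegrable_of_loc hk 0 y)
  simp only [prim₂, h1]
  exact ((μl).flip B).intervalIntegral_comp_comm ((continuous_prim hk).intervalIntegrable 0 x)

theorem prim₂_const_mul {k : ℝ → Mat d} (hk : LocallyIntegrable k volume) (B : Mat d) (x : ℝ) :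
    prim₂ (fun u => B * k u) x = B * prim₂ k x := by
  have h1 : ∀ y, ∫ u in (0 : ℝ)..y, B * k u = B * ∫ u in (0 : ℝ)..y, k u := fun y =>
    (μl B).intervalIntegral_comp_comm (intervalIntegrable_of_loc hk 0 y)
  simp only [prim₂, h1]
  exact (μl B).intervalIntegral_comp_comm ((continuous_prim hk).intervalIntegrable 0 x)

theorem prim₂_revT (k : ℝ → Mat d) (x : ℝ) : prim₂ (revT k) x = (prim₂ k (-x))ᵀ := by
  rw [← prim₂_neg_comp]
  simp only [prim₂, intervalIntegral_transpose]
  rfl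

theorem locallyIntegrable_comp {k : ℝ → Mat d} (L : Mat d →L[ℝ] Mat d)
    (hk : LocallyIntegrable k volume) : LocallyIntegrable (fun u => L (k u)) volume := by
  rw [locallyIntegrable_iff] at hk ⊢
  exact fun K hK => L.integrable_comp (hk K hK)

theorem locallyIntegrable_revT {k : ℝ → Mat d} (hk : LocallyIntegrable k volume) :
    LocallyIntegrable (revT k) volume := by
  refine locallyIntegrable_comp ((Matrix.transposeLinearEquiv (Fin d) (Fin d) ℝ
    ℝ).toContinuousLinearEquiv : Mat d →L[ℝ] Mat d) (k := fun u => k (-u)) ?_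
  rw [locallyIntegrable_iff] at hk ⊢
  intro K hK
  have := ((Measure.measurePreserving_neg (volume : Measure ℝ)).integrableOn_comp_preimage
    (MeasurableEquiv.neg ℝ).measurableEmbedding).2 (hk (-K) hK.neg)
  simpa [Function.comp_def] using this

/-- The covariance of the integrated force, if the cross covariance of `F₀(a)` and the white noise
at time `u` is `ψ(a - u)`. -/
theorem crossMoment_integratedForce (hW : IsTwoSidedBrownian W P) (hW' : IsTwoSidedBrownian W' P)
    (hFm : Measurable (Function.uncurry F₀))
    (hF : ∀ t, IsWienerIntegral W' P (fun s => φ (t - s)) (F₀ t)) {ψ : ℝ → Mat d}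
    (hψ : LocallyIntegrable ψ volume)
    (hcross : ∀ a t, 0 ≤ t → crossMoment P (F₀ a) (W t) = ∫ u in (0 : ℝ)..t, ψ (a - u))
    {s t : ℝ} (hs : 0 ≤ s) (ht : 0 ≤ t) :
    crossMoment P (integratedForce F₀ G W s) (integratedForce F₀ G W t)
      = covInc (G * Gᵀ)
          (fun u => matConv φ (revT φ) u + (ψ u * Gᵀ + G * revT ψ u)) s t := by
  have hI : ∀ t, 0 ≤ t → MemLp (fun ω => ∫ u in (0 : ℝ)..t, F₀ u ω) 2 P := fun t ht =>
    memLp_integral_force hW' hFm hF ht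
  have hWm := hW.memLp
  have hGW : ∀ t, MemLp (fun ω => G *ᵥ W t ω) 2 P := fun t => memLp_mulVec G (hWm t)
  have hκ := locallyIntegrable_conv hW' hFm hF
  have e1 : crossMoment P (fun ω => ∫ u in (0 : ℝ)..s, F₀ u ω) (fun ω => ∫ u in (0 : ℝ)..t, F₀ u ω)
      = prim₂ (matConv φ (revT φ)) s + prim₂ (matConv φ (revT φ)) (-t)
        - prim₂ (matConv φ (revT φ)) (s - t) := by
    rw [crossMoment_integral_force hW' hFm hF hs (hI t ht), ← integral_integral_sub hκ]
    refine intervalIntegral.integral_congr fun a _ => ?_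
    rw [← crossMoment_transpose, crossMoment_integral_force hW' hFm hF ht
      ((hF a).memLp_two hW'), intervalIntegral_transpose]
    refine intervalIntegral.integral_congr fun b _ => ?_
    change (crossMoment P (F₀ b) (F₀ a))ᵀ = _
    rw [crossMoment_transpose, crossMoment_force hW' hF]
  have e2 : ∀ s t, 0 ≤ s → 0 ≤ t →
      crossMoment P (fun ω => ∫ u in (0 : ℝ)..s, F₀ u ω) (W t)
      = prim₂ ψ s + prim₂ ψ (-t) - prim₂ ψ (s - t) := by
    intro s t hs ht
    rw [crossMoment_integral_force hW' hFm hF hs (hWm t), ← integral_integral_sub hψ]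
    refine intervalIntegral.integral_congr fun a _ => hcross a t ht
  have hsum : ∀ x, prim₂ (fun u => matConv φ (revT φ) u + (ψ u * Gᵀ + G * revT ψ u)) x
      = prim₂ (matConv φ (revT φ)) x + (prim₂ ψ x * Gᵀ + G * (prim₂ ψ (-x))ᵀ) := by
    intro x
    have hψG : LocallyIntegrable (fun u => ψ u * Gᵀ) volume :=
      locallyIntegrable_comp ((μl).flip Gᵀ) hψ
    have hrev := locallyIntegrable_revT hψ
    have hGψ : LocallyIntegrable (fun u => G * revT ψ u) volume :=
      locallyIntegrable_comp (μl G) hrev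
    rw [prim₂_add hκ (k' := fun u => ψ u * Gᵀ + G * revT ψ u) (hψG.add hGψ),
      prim₂_add hψG hGψ, prim₂_mul_const hψ, prim₂_const_mul hrev, prim₂_revT]
  have hZ : ∀ t, integratedForce F₀ G W t
      = (fun ω => ∫ u in (0 : ℝ)..t, F₀ u ω) + fun ω => G *ᵥ W t ω := fun t => rfl
  rw [hZ, hZ, crossMoment_add_left (hI s hs) (hGW s) ((hI t ht).add (hGW t)),
    crossMoment_add_right (hI s hs) (hI t ht) (hGW t),
    crossMoment_add_right (hGW s) (hI t ht) (hGW t),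
    crossMoment_mulVec_right G (hI s hs) (hWm t), crossMoment_mulVec_left G (hWm s) (hI t ht),
    crossMoment_mulVec_left G (hWm s) (hGW t), crossMoment_mulVec_right G (hWm s) (hWm t),
    ← crossMoment_transpose _ (W s), e1, e2 s t hs ht, e2 t s ht hs,
    crossMoment_brownian hW hs ht, covInc, hsum, hsum, hsum]
  simp only [neg_neg, neg_sub, smul_mul_assoc, one_mul, mul_smul_comm, Matrix.transpose_add,
    Matrix.transpose_sub, mul_add, mul_sub, add_mul, sub_mul]
  abel

end Force

/-! ### Characteristic functions and Gaussian Hilbert spaces -/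

section CharFun

variable {Ω : Type*} [MeasurableSpace Ω] {P : Measure Ω} [IsProbabilityMeasure P]

theorem norm_exp_mul_I_sub_exp_mul_I_le (a b : ℝ) :
    ‖Complex.exp (a * Complex.I) - Complex.exp (b * Complex.I)‖ ≤ |a - b| := by
  have h : Complex.exp (a * Complex.I) - Complex.exp (b * Complex.I)
      = Complex.exp (b * Complex.I) * (Complex.exp (Complex.I * ((a - b : ℝ) : ℂ)) - 1) := by
    rw [mul_sub, ← Complex.exp_add, mul_one]
    congr 2
    push_cast
    ring
  rw [h, norm_mul, Complex.norm_exp_ofReal_mul_I, one_mul]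
  exact Real.norm_exp_I_mul_ofReal_sub_one_le

theorem integrable_exp_mul_I {Y : Ω → ℝ} (hY : AEStronglyMeasurable Y P) :
    Integrable (fun ω => Complex.exp (Y ω * Complex.I)) P := by
  refine Integrable.of_bound (C := 1) ?_ (Eventually.of_forall fun ω => ?_)
  · exact (Complex.continuous_exp.comp
      (Complex.continuous_ofReal.mul continuous_const)).comp_aestronglyMeasurable hY
  · rw [Complex.norm_exp_ofReal_mul_I]

theorem continuous_integral_exp_mul_I :
    Continuous fun Y : Lp ℝ 2 P => ∫ ω, Complex.exp (Y ω * Complex.I) ∂P := by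
  refine (LipschitzWith.of_dist_le_mul (K := 1) fun Y Z => ?_).continuous
  rw [dist_eq_norm, dist_eq_norm,
    ← integral_sub (integrable_exp_mul_I (Lp.aestronglyMeasurable Y))
      (integrable_exp_mul_I (Lp.aestronglyMeasurable Z)), NNReal.coe_one, one_mul]
  have hi : MemLp (fun ω => (Y - Z) ω) 2 P := Lp.memLp (Y - Z)
  calc ‖∫ ω, Complex.exp (Y ω * Complex.I) - Complex.exp (Z ω * Complex.I) ∂P‖
      ≤ ∫ ω, ‖(Y - Z) ω‖ ∂P := by
        refine norm_integral_le_of_norm_le (hi.integrable (by norm_num)).norm ?_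
        filter_upwards [Lp.coeFn_sub Y Z] with ω hω
        rw [hω, Real.norm_eq_abs]
        exact norm_exp_mul_I_sub_exp_mul_I_le _ _
    _ = (eLpNorm (Y - Z : Lp ℝ 2 P) 1 P).toReal := by
        rw [integral_norm_eq_lintegral_enorm hi.aestronglyMeasurable,
          eLpNorm_one_eq_lintegral_enorm]
    _ ≤ ‖Y - Z‖ := by
        rw [Lp.norm_def]
        exact ENNReal.toReal_mono hi.2.ne
          (eLpNorm_le_eLpNorm_of_exponent_le (by norm_num) hi.aestronglyMeasurable)

/-- The Gaussian law of centered variables passes to limits in mean square, because the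
characteristic function is continuous there. -/
theorem integral_exp_mul_I_of_mem_topologicalClosure {K : Submodule ℝ (Lp ℝ 2 P)}
    (hK : ∀ Y ∈ K, ∫ ω, Complex.exp (Y ω * Complex.I) ∂P = Complex.exp (-(‖Y‖ ^ 2 / 2 : ℝ)))
    {Y : Lp ℝ 2 P} (hY : Y ∈ K.topologicalClosure) :
    ∫ ω, Complex.exp (Y ω * Complex.I) ∂P = Complex.exp (-(‖Y‖ ^ 2 / 2 : ℝ)) := by
  have hc : IsClosed {Y : Lp ℝ 2 P |
      ∫ ω, Complex.exp (Y ω * Complex.I) ∂P = Complex.exp (-(‖Y‖ ^ 2 / 2 : ℝ))} :=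
    isClosed_eq continuous_integral_exp_mul_I (by fun_prop)
  exact hc.closure_subset_iff.2 (fun Y hY => hK Y hY) hY

end CharFun

theorem norm_toLp_sq {Ω : Type*} [MeasurableSpace Ω] {P : Measure Ω} {Y : Ω → ℝ}
    (hY : MemLp Y 2 P) :
    ‖hY.toLp Y‖ ^ 2 = ∫ ω, Y ω * Y ω ∂P := by
  rw [← real_inner_self_eq_norm_sq, L2.inner_def]
  refine integral_congr_ae ?_
  filter_upwards [hY.coeFn_toLp] with ω hω
  simp [hω, sq]

/-- A centered Gaussian variable has the characteristic function `exp (-‖Y‖² / 2)`. -/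
theorem HasGaussianLaw.integral_exp_mul_I {Ω : Type*} [MeasurableSpace Ω] {P : Measure Ω}
    {Y : Ω → ℝ} (hY : HasGaussianLaw Y P)
    (h0 : ∫ ω, Y ω ∂P = 0) :
    ∫ ω, Complex.exp (Y ω * Complex.I) ∂P
      = Complex.exp (-((∫ ω, Y ω * Y ω ∂P) / 2 : ℝ)) := by
  have h := hY.charFunDual_map_eq_fun (ContinuousLinearMap.id ℝ ℝ)
  rw [charFunDual_apply, integral_map hY.aemeasurable
    (by fun_prop : Continuous _).aestronglyMeasurable] at h
  simp only [ContinuousLinearMap.id_apply, h0] at h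
  rw [h, variance_of_integral_eq_zero hY.aemeasurable h0]
  congr 1
  push_cast
  simp only [sq]
  rw [zero_mul, zero_sub]

/-! ### The closed linear span of a process -/

section Span

variable {Ω : Type*} [MeasurableSpace Ω] {P : Measure Ω} {d : ℕ}
  {S T : Type*} {X : T → Ω → Vec d} {Y Y' : Ω → Vec d}

/-- `Y` belongs to the closed linear span (with matrix coefficients) of the process `X` in
`L²(P; ℝᵈ)`. The span is encoded as a double orthogonal complement with respect to the
matrix-valued form `E (X Y*)`. -/
def MemClosedSpan (P : Measure Ω) (X : T → Ω → Vec d) (Y : Ω → Vec d) : Prop :=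
  MemLp Y 2 P ∧ ∀ Z, MemLp Z 2 P → (∀ t, crossMoment P (X t) Z = 0) → crossMoment P Y Z = 0

theorem memClosedSpan_self {t : T} (hX : MemLp (X t) 2 P) : MemClosedSpan P X (X t) :=
  ⟨hX, fun _ _ h => h t⟩

theorem MemClosedSpan.congr (hY : MemClosedSpan P X Y) (h : Y =ᵐ[P] Y') : MemClosedSpan P X Y' :=
  ⟨hY.1.ae_eq h, fun Z hZ hXZ => (crossMoment_congr h.symm EventuallyEq.rfl).trans (hY.2 Z hZ hXZ)⟩

theorem MemClosedSpan.add (hY : MemClosedSpan P X Y) (hY' : MemClosedSpan P X Y') :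
    MemClosedSpan P X (Y + Y') :=
  ⟨hY.1.add hY'.1, fun Z hZ h => by
    rw [crossMoment_add_left hY.1 hY'.1 hZ, hY.2 Z hZ h, hY'.2 Z hZ h, add_zero]⟩

theorem MemClosedSpan.sub (hY : MemClosedSpan P X Y) (hY' : MemClosedSpan P X Y') :
    MemClosedSpan P X (Y - Y') :=
  ⟨hY.1.sub hY'.1, fun Z hZ h => by
    rw [crossMoment_sub_left hY.1 hY'.1 hZ, hY.2 Z hZ h, hY'.2 Z hZ h, sub_zero]⟩

theorem MemClosedSpan.mulVec (A : Mat d) (hY : MemClosedSpan P X Y) :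
    MemClosedSpan P X (fun ω => A *ᵥ Y ω) :=
  ⟨memLp_mulVec A hY.1, fun Z hZ h => by
    rw [crossMoment_mulVec_left A hY.1 hZ, hY.2 Z hZ h, mul_zero]⟩

theorem MemClosedSpan.sum {ι : Type*} (s : Finset ι) {Y : ι → Ω → Vec d}
    (hY : ∀ i, MemClosedSpan P X (Y i)) : MemClosedSpan P X (fun ω => ∑ i ∈ s, Y i ω) :=
  ⟨memLp_finsetSum s fun i _ => (hY i).1, fun Z hZ h => by
    rw [crossMoment_sum_left s (fun i => (hY i).1) hZ,
      Finset.sum_eq_zero fun i _ => (hY i).2 Z hZ h]⟩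

theorem MemClosedSpan.trans {X' : S → Ω → Vec d} (hY : MemClosedSpan P X' Y)
    (h : ∀ s, MemClosedSpan P X (X' s)) : MemClosedSpan P X Y :=
  ⟨hY.1, fun Z hZ hXZ => hY.2 Z hZ fun s => (h s).2 Z hZ hXZ⟩

/-- The closed linear span is closed under convergence in mean square. -/
theorem MemClosedSpan.of_tendsto {Y : ℕ → Ω → Vec d} {Y' : Ω → Vec d}
    (hY : ∀ n, MemClosedSpan P X (Y n)) (hY' : MemLp Y' 2 P)
    (h : Tendsto (fun n => eLpNorm (fun ω => Y' ω - Y n ω) 2 P) atTop (𝓝 0)) :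
    MemClosedSpan P X Y' := by
  refine ⟨hY', fun Z hZ hXZ => ?_⟩
  have hlim := tendsto_integral_bilin (outerL d) (fun n => (hY n).1) hY' (fun _ => hZ) hZ h
    (by simp)
  refine (crossMoment_eq_integral hY' hZ).trans (tendsto_nhds_unique hlim ?_)
  refine tendsto_const_nhds.congr fun n => ?_
  rw [← (hY n).2 Z hZ hXZ]
  exact crossMoment_eq_integral (hY n).1 hZ

/-- The closed linear span is closed under integration with respect to a parameter. -/
theorem MemClosedSpan.integral [IsFiniteMeasure P] {U : Type*} [MeasurableSpace U] {μ : Measure U}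
    [IsFiniteMeasure μ] {Y : U → Ω → Vec d} (hm : MemLp (Function.uncurry Y) 2 (μ.prod P))
    (hY : ∀ᵐ u ∂μ, MemClosedSpan P X (Y u)) : MemClosedSpan P X (fun ω => ∫ u, Y u ω ∂μ) := by
  refine ⟨memLp_integral hm, fun Z hZ hXZ => ?_⟩
  rw [crossMoment_integral_left hm hZ]
  refine integral_eq_zero_of_ae ?_
  filter_upwards [hY] with u hu
  exact hu.2 Z hZ hXZ

theorem MemClosedSpan.integral_eq_zero [IsProbabilityMeasure P] (hY : MemClosedSpan P X Y)
    (hX : ∀ t, MemLp (X t) 2 P) (h0 : ∀ t, ∫ ω, X t ω ∂P = 0) : ∫ ω, Y ω ∂P = 0 := by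
  have key : ∀ Y : Ω → Vec d, MemLp Y 2 P → ∀ i j,
      crossMoment P Y (fun _ => 1) i j = (∫ ω, Y ω ∂P) i := by
    intro Y hY i j
    rw [eval_integral fun i => (hY.eval i).integrable (by norm_num)]
    simp [crossMoment]
  have h := hY.2 (fun _ => 1) (memLp_const _) fun t => by
    ext i j
    rw [key _ (hX t), h0]
    rfl
  ext i
  rw [← key Y hY.1 i i, h]
  rfl

end Span

section Gaussian

variable {Ω : Type*} [MeasurableSpace Ω] {P : Measure Ω} {d : ℕ}
  {S T : Type*} {X : T → Ω → Vec d} {Y : S → Ω → Vec d}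

/-- Linear combinations of the components of a centered Gaussian process are centered Gaussian. -/
theorem integral_exp_mul_I_of_mem_span [IsProbabilityMeasure P] (hX : IsGaussianProcess X P)
    (h0 : ∀ t, ∫ ω, X t ω ∂P = 0) {y : Lp ℝ 2 P}
    (hy : y ∈ Submodule.span ℝ (range fun p : T × Fin d =>
      ((hX.hasGaussianLaw_eval p.1).memLp_two.eval p.2).toLp (fun ω => X p.1 ω p.2))) :
    ∫ ω, Complex.exp (y ω * Complex.I) ∂P = Complex.exp (-(‖y‖ ^ 2 / 2 : ℝ)) := by
  have hp : ∀ p : T × Fin d, MemLp (fun ω => X p.1 ω p.2) 2 P := fun p =>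
    (hX.hasGaussianLaw_eval p.1).memLp_two.eval p.2
  obtain ⟨c, rfl⟩ := Finsupp.mem_span_range_iff_exists_finsupp.1 hy
  have hg : IsGaussianProcess (fun (p : T × Fin d) ω => c p • X p.1 ω p.2) P := by
    refine IsGaussianProcess.smul c (X := fun (p : T × Fin d) ω => X p.1 ω p.2) ?_
    refine hX.of_isGaussianProcess fun p => ⟨{p.1}, (ContinuousLinearMap.proj (R := ℝ)
      (φ := fun _ : Fin d => ℝ) p.2).comp (ContinuousLinearMap.proj (R := ℝ)
      (φ := fun _ : ({p.1} : Finset T) => Vec d) ⟨p.1, by simp⟩), fun ω => rfl⟩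
  have hs := hg.hasGaussianLaw_fun_sum (I := c.support)
  have hms : MemLp (fun ω => ∑ p ∈ c.support, c p • X p.1 ω p.2) 2 P :=
    memLp_finsetSum _ fun p _ => (hp p).const_smul (c p)
  have hy' : (c.sum fun p a => a • (hp p).toLp (fun ω => X p.1 ω p.2)) = hms.toLp _ := by
    refine Lp.ext ((Lp.coeFn_fun_finsetSum _ _).trans ?_)
    have h1 : ∀ᵐ ω ∂P, ∀ p ∈ c.support,
        (c p • (hp p).toLp (fun ω => X p.1 ω p.2) : Lp ℝ 2 P) ω = c p • X p.1 ω p.2 := by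
      refine (eventually_all_finset _).2 fun p _ => ?_
      filter_upwards [Lp.coeFn_smul (c p) ((hp p).toLp _), (hp p).coeFn_toLp] with ω h1 h2
      rw [h1, Pi.smul_apply, h2]
    filter_upwards [h1, hms.coeFn_toLp] with ω h1 h2
    rw [h2]
    exact Finset.sum_congr rfl h1
  have h00 : ∫ ω, ∑ p ∈ c.support, c p • X p.1 ω p.2 ∂P = 0 := by
    refine (integral_finsetSum _ fun p _ =>
      ((hp p).const_smul (c p)).integrable (by norm_num)).trans ?_
    refine Finset.sum_eq_zero fun p _ => ?_
    simp only [Pi.smul_apply]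
    rw [integral_smul, ← eval_integral fun i => (hp (p.1, i)).integrable (by norm_num), h0]
    simp
  rw [hy', norm_toLp_sq, ← HasGaussianLaw.integral_exp_mul_I hs h00]
  refine integral_congr_ae ?_
  filter_upwards [hms.coeFn_toLp] with ω hω
  rw [hω]

/-- Every continuous linear functional on `(ℝᵈ)ᴵ` is given by coefficients. -/
theorem exists_coeff (I : Finset S) (L : StrongDual ℝ (I → Vec d)) :
    ∃ c : I → Fin d → ℝ, ∀ x, L x = ∑ t, ∑ i, c t i * x t i := by
  classical
  refine ⟨fun t i => L (Pi.single t (Pi.single i 1)), fun x => ?_⟩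
  have hx : x = ∑ t, ∑ i, x t i • (Pi.single t (Pi.single i (1 : ℝ)) : I → Vec d) := by
    ext t i
    simp [Finset.sum_apply, Pi.single_apply, apply_ite, ite_apply]
  conv_lhs => rw [hx]
  simp [map_sum, mul_comm]

theorem integral_exp_mul_I_of_memClosedSpan [IsProbabilityMeasure P] (hX : IsGaussianProcess X P)
    (h0 : ∀ t, ∫ ω, X t ω ∂P = 0) (hY : ∀ s, MemClosedSpan P X (Y s)) (I : Finset S)
    (c : I → Fin d → ℝ) :
    ∫ ω, Complex.exp ((∑ t, ∑ i, c t i * Y t ω i : ℝ) * Complex.I) ∂P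
      = Complex.exp (-((∫ ω, (∑ t, ∑ i, c t i * Y t ω i) * (∑ t, ∑ i, c t i * Y t ω i) ∂P) / 2
        : ℝ)) := by
  have hYm : ∀ (t : I) i, MemLp (fun ω => c t i * Y t ω i) 2 P := fun t i =>
    ((hY t).1.eval i).const_mul (c t i)
  have hm : MemLp (fun ω => ∑ t, ∑ i, c t i * Y t ω i) 2 P :=
    memLp_finsetSum _ fun t _ => memLp_finsetSum _ fun i _ => hYm t i
  have hmem : hm.toLp _ ∈ (Submodule.span ℝ (range fun p : T × Fin d =>
      ((hX.hasGaussianLaw_eval p.1).memLp_two.eval p.2).toLp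
        (fun ω => X p.1 ω p.2))).topologicalClosure := by
    rw [← Submodule.orthogonal_orthogonal_eq_closure, Submodule.mem_orthogonal]
    intro z hz
    rw [Submodule.mem_orthogonal] at hz
    -- the vector all of whose components are equal to `z` is orthogonal to the process
    have hZ : MemLp (fun ω (_ : Fin d) => z ω) 2 P := memLp_pi_iff.2 fun _ => Lp.memLp z
    have hXZ : ∀ t, crossMoment P (X t) (fun ω _ => z ω) = 0 := by
      intro t
      ext i j
      have := hz _ (Submodule.subset_span ⟨(t, i), rfl⟩)
      rw [L2.inner_def] at this
      rw [Matrix.zero_apply, ← this]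
      refine integral_congr_ae ?_
      filter_upwards [((hX.hasGaussianLaw_eval t).memLp_two.eval i).coeFn_toLp] with ω hω
      simp [hω, mul_comm]
    have hYZ : ∀ (t : I) i, ∫ ω, c t i * (Y t ω i * z ω) ∂P = 0 := by
      intro t i
      rw [integral_const_mul]
      have := congrFun (congrFun ((hY t).2 _ hZ hXZ) i) i
      simp only [crossMoment, Matrix.of_apply, Matrix.zero_apply] at this
      rw [this, mul_zero]
    have hint : ∀ (t : I) i, Integrable (fun ω => c t i * (Y t ω i * z ω)) P := fun t i =>
      (((hY t).1.eval i).integrable_mul (Lp.memLp z)).const_mul _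
    rw [L2.inner_def]
    calc _ = ∫ ω, ∑ t, ∑ i, c t i * (Y t ω i * z ω) ∂P := by
          refine integral_congr_ae ?_
          filter_upwards [hm.coeFn_toLp] with ω hω
          simp only [hω, RCLike.inner_apply, conj_trivial, Finset.sum_mul, mul_assoc]
      _ = 0 := by
          rw [integral_finsetSum _ fun t _ => integrable_finsetSum _ fun i _ => hint t i]
          refine Finset.sum_eq_zero fun t _ => ?_
          rw [integral_finsetSum _ fun i _ => hint t i]
          exact Finset.sum_eq_zero fun i _ => hYZ t i
  have h := integral_exp_mul_I_of_mem_topologicalClosure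
    (fun y hy => integral_exp_mul_I_of_mem_span hX h0 hy) hmem
  rw [norm_toLp_sq] at h
  rw [← h]
  refine integral_congr_ae ?_
  filter_upwards [hm.coeFn_toLp] with ω hω
  rw [hω]

/-- The second moment of a linear combination of components. -/
theorem integral_coeff_mul_self {Y : S → Ω → Vec d} (hY : ∀ s, MemLp (Y s) 2 P) (I : Finset S)
    (c : I → Fin d → ℝ) :
    ∫ ω, (∑ t, ∑ i, c t i * Y t ω i) * (∑ t, ∑ i, c t i * Y t ω i) ∂P
      = ∑ t, ∑ i, ∑ t', ∑ i', c t i * c t' i' * crossMoment P (Y t) (Y t') i i' := by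
  have hint : ∀ (t t' : I) i i', Integrable
      (fun ω => c t i * c t' i' * (Y t ω i * Y t' ω i')) P := fun t t' i i' =>
    (((hY t).eval i).integrable_mul ((hY t').eval i')).const_mul _
  have h : ∀ ω, (∑ t, ∑ i, c t i * Y t ω i) * (∑ t, ∑ i, c t i * Y t ω i)
      = ∑ t : I, ∑ i, ∑ t' : I, ∑ i', c t i * c t' i' * (Y t ω i * Y t' ω i') := by
    intro ω
    simp only [Finset.sum_mul, Finset.mul_sum]
    refine Finset.sum_congr rfl fun t _ => Finset.sum_congr rfl fun i _ =>
      Finset.sum_congr rfl fun t' _ => Finset.sum_congr rfl fun i' _ => by ring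
  simp only [h]
  rw [integral_finsetSum _ fun t _ => integrable_finsetSum _ fun i _ => integrable_finsetSum _
    fun t' _ => integrable_finsetSum _ fun i' _ => hint t t' i i']
  refine Finset.sum_congr rfl fun t _ => ?_
  rw [integral_finsetSum _ fun i _ => integrable_finsetSum _ fun t' _ => integrable_finsetSum _
    fun i' _ => hint t t' i i']
  refine Finset.sum_congr rfl fun i _ => ?_
  rw [integral_finsetSum _ fun t' _ => integrable_finsetSum _ fun i' _ => hint t t' i i']
  refine Finset.sum_congr rfl fun t' _ => ?_
  rw [integral_finsetSum _ fun i' _ => hint t t' i i']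
  refine Finset.sum_congr rfl fun i' _ => ?_
  rw [integral_const_mul]
  rfl

theorem aemeasurable_restrict {Y : S → Ω → Vec d} (hY : ∀ s, MemLp (Y s) 2 P) (I : Finset S) :
    AEMeasurable (fun ω (t : I) => Y t ω) P :=
  aemeasurable_pi_iff.2 fun t => (hY t).aestronglyMeasurable.aemeasurable

/-- The characteristic function of the finite-dimensional distributions of a process in the closed
linear span of a centered Gaussian process. -/
theorem charFunDual_map_of_memClosedSpan [IsProbabilityMeasure P] (hX : IsGaussianProcess X P)
    (h0 : ∀ t, ∫ ω, X t ω ∂P = 0) (hY : ∀ s, MemClosedSpan P X (Y s)) (I : Finset S)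
    (L : StrongDual ℝ (I → Vec d)) :
    charFunDual (P.map fun ω (t : I) => Y t ω) L
      = Complex.exp (-((∫ ω, L (fun t : I => Y t ω) * L (fun t : I => Y t ω) ∂P) / 2 : ℝ)) := by
  obtain ⟨c, hc⟩ := exists_coeff I L
  rw [charFunDual_apply, integral_map (aemeasurable_restrict (fun s => (hY s).1) I)
    (by fun_prop : Continuous _).aestronglyMeasurable]
  simp only [hc]
  exact integral_exp_mul_I_of_memClosedSpan hX h0 hY I c

/-- A process in the closed linear span of a centered Gaussian process is Gaussian. -/
theorem isGaussianProcess_of_memClosedSpan [IsProbabilityMeasure P] (hX : IsGaussianProcess X P)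
    (h0 : ∀ t, ∫ ω, X t ω ∂P = 0) (hY : ∀ s, MemClosedSpan P X (Y s)) :
    IsGaussianProcess Y P := by
  have hY0 : ∀ s, ∫ ω, Y s ω ∂P = 0 := fun s =>
    (hY s).integral_eq_zero (fun t => (hX.hasGaussianLaw_eval t).memLp_two) h0
  refine ⟨fun I => (hasGaussianLaw_iff_charFunDual_map_eq
    (aemeasurable_restrict (fun s => (hY s).1) I)).2 fun L => ?_⟩
  have hm : MemLp (fun ω => (fun t : I => Y t ω)) 2 P := memLp_pi_iff.2 fun t => (hY t).1
  have hL0 : ∫ ω, L (fun t : I => Y t ω) ∂P = 0 := by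
    rw [L.integral_comp_comm (hm.integrable (by norm_num)),
      show ∫ ω, (fun t : I => Y t ω) ∂P = 0 from funext fun t => by
        rw [eval_integral fun t : I => (hY t).1.integrable (by norm_num), hY0]; rfl, map_zero]
  refine (charFunDual_map_of_memClosedSpan hX h0 hY I L).trans ?_
  change _ = Complex.exp (((∫ ω, L (fun t : I => Y t ω) ∂P : ℝ) : ℂ) * Complex.I
    - Var[fun ω => L (fun t : I => Y t ω); P] / 2)
  rw [variance_of_integral_eq_zero (L.continuous.comp_aestronglyMeasurable
    hm.aestronglyMeasurable).aemeasurable hL0, hL0]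
  congr 1
  push_cast
  simp only [sq]
  rw [zero_mul, zero_sub]

/-- The laws of centered jointly Gaussian vectors are determined by their second moments. -/
theorem map_eq_of_crossMoment_eq [IsProbabilityMeasure P] (hX : IsGaussianProcess X P)
    (h0 : ∀ t, ∫ ω, X t ω ∂P = 0) {Y Y' : S → Ω → Vec d} (hY : ∀ s, MemClosedSpan P X (Y s))
    (hY' : ∀ s, MemClosedSpan P X (Y' s))
    (h : ∀ s t, crossMoment P (Y s) (Y t) = crossMoment P (Y' s) (Y' t)) (I : Finset S) :
    (P.map fun ω (t : I) => Y t ω) = P.map fun ω (t : I) => Y' t ω := by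
  refine Measure.ext_of_charFunDual (funext fun L => ?_)
  rw [charFunDual_map_of_memClosedSpan hX h0 hY, charFunDual_map_of_memClosedSpan hX h0 hY']
  obtain ⟨c, hc⟩ := exists_coeff I L
  simp only [hc, integral_coeff_mul_self (fun s => (hY s).1),
    integral_coeff_mul_self (fun s => (hY' s).1), h]

end Gaussian

/-! ### Independent Gaussian processes -/

section Independent

variable {Ω : Type*} [MeasurableSpace Ω] {P : Measure Ω} {d : ℕ}
  {S T : Type*} {X : T → Ω → Vec d} {Y : S → Ω → Vec d}

/-- Independent Gaussian processes are jointly Gaussian. -/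
theorem isGaussianProcess_sumElim (hX : IsGaussianProcess X P) (hY : IsGaussianProcess Y P)
    (h : IndepFun (fun ω t => X t ω) (fun ω s => Y s ω) P) :
    IsGaussianProcess (Sum.elim X Y) P := by
  refine ⟨fun I => ?_⟩
  have hXY := IndepFun.hasGaussianLaw (hX.hasGaussianLaw I.toLeft) (hY.hasGaussianLaw I.toRight)
    (h.comp (φ := fun x => I.toLeft.restrict x) (ψ := fun y => I.toRight.restrict y)
      (Finset.measurable_restrict _) (Finset.measurable_restrict _))
  let L : ((I.toLeft → Vec d) × (I.toRight → Vec d)) →L[ℝ] (I → Vec d) :=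
    ContinuousLinearMap.pi fun p => match p with
      | ⟨Sum.inl t, ht⟩ => (ContinuousLinearMap.proj (R := ℝ) (φ := fun _ : I.toLeft => Vec d)
          ⟨t, Finset.mem_toLeft.2 ht⟩).comp (ContinuousLinearMap.fst ℝ _ _)
      | ⟨Sum.inr s, hs⟩ => (ContinuousLinearMap.proj (R := ℝ) (φ := fun _ : I.toRight => Vec d)
          ⟨s, Finset.mem_toRight.2 hs⟩).comp (ContinuousLinearMap.snd ℝ _ _)
  refine (hXY.map L).congr (Eventually.of_forall fun ω => ?_)
  ext ⟨p, hp⟩ i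
  rcases p with t | s <;> rfl

end Independent

/-! ### The Gaussian structure of the force and of the initial value -/

section GaussianForce

variable {Ω : Type*} [MeasurableSpace Ω] {P : Measure Ω} {d : ℕ} {W W' : ℝ → Ω → Vec d}
  {F₀ : ℝ → Ω → Vec d} {φ : ℝ → Mat d} {G S : Mat d} {V₀ : Ω → Vec d}

theorem IsWienerIntegral.memClosedSpan (hW : IsTwoSidedBrownian W P) {f : ℝ → Mat d}
    {X : Ω → Vec d} (hX : IsWienerIntegral W P f X) : MemClosedSpan P W X := by
  have hX2 := hX.memLp_two hW
  obtain ⟨-, -, g, -, hg⟩ := hX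
  refine MemClosedSpan.of_tendsto (fun n => ?_) hX2 hg
  exact MemClosedSpan.sum _ fun i => MemClosedSpan.mulVec ((g n).coeff i)
    ((memClosedSpan_self (hW.memLp _)).sub (memClosedSpan_self (hW.memLp _)))

theorem memClosedSpan_integratedForce [IsProbabilityMeasure P] (hW' : IsTwoSidedBrownian W' P)
    (hFm : Measurable (Function.uncurry F₀))
    (hF : ∀ t, IsWienerIntegral W' P (fun s => φ (t - s)) (F₀ t)) {T : Type*}
    {U : T → Ω → Vec d} (hUW : ∀ t, MemClosedSpan P U (W t))
    (hUW' : ∀ t, MemClosedSpan P U (W' t)) {t : ℝ} (ht : 0 ≤ t) :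
    MemClosedSpan P U (integratedForce F₀ G W t) := by
  refine MemClosedSpan.add (Y := fun ω => ∫ u in (0 : ℝ)..t, F₀ u ω)
    (Y' := fun ω => G *ᵥ W t ω) ?_ ((hUW t).mulVec G)
  simp only [intervalIntegral.integral_of_le ht]
  exact MemClosedSpan.integral (memLp_uncurry_force hW' hFm hF _)
    (Eventually.of_forall fun u => ((hF u).memClosedSpan hW').trans hUW')

/-- The primitive of the force is a centered Gaussian process, because the two Brownian motions are
jointly Gaussian. -/
theorem isGaussianProcess_integratedForce [IsProbabilityMeasure P] (hW : IsTwoSidedBrownian W P)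
    (hW' : IsTwoSidedBrownian W' P)
    (hWW' : W' = W ∨ IndepFun (fun ω t => W t ω) (fun ω t => W' t ω) P)
    (hFm : Measurable (Function.uncurry F₀))
    (hF : ∀ t, IsWienerIntegral W' P (fun s => φ (t - s)) (F₀ t)) :
    IsGaussianProcess (fun t : ℝ≥0 => integratedForce F₀ G W t) P ∧
      ∀ t : ℝ≥0, ∫ ω, integratedForce F₀ G W t ω ∂P = 0 := by
  obtain ⟨T, U, hU, hU0, hUW, hUW'⟩ : ∃ (T : Type) (U : T → Ω → Vec d), IsGaussianProcess U P ∧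
      (∀ t, ∫ ω, U t ω ∂P = 0) ∧ (∀ t, MemClosedSpan P U (W t)) ∧
      ∀ t, MemClosedSpan P U (W' t) := by
    rcases hWW' with rfl | h
    · exact ⟨ℝ, W', hW.isGaussianProcess, hW.mean_zero,
        fun t => memClosedSpan_self (hW.memLp t), fun t => memClosedSpan_self (hW.memLp t)⟩
    · refine ⟨ℝ ⊕ ℝ, Sum.elim W W',
        isGaussianProcess_sumElim hW.isGaussianProcess hW'.isGaussianProcess h, ?_,
        fun t => memClosedSpan_self (X := Sum.elim W W') (t := Sum.inl t) (hW.memLp t),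
        fun t => memClosedSpan_self (X := Sum.elim W W') (t := Sum.inr t) (hW'.memLp t)⟩
      rintro (t | t)
      · exact hW.mean_zero t
      · exact hW'.mean_zero t
  have hZ : ∀ t : ℝ≥0, MemClosedSpan P U (integratedForce F₀ G W t) := fun t =>
    memClosedSpan_integratedForce hW' hFm hF hUW hUW' t.2
  exact ⟨isGaussianProcess_of_memClosedSpan hU hU0 hZ, fun t => (hZ t).integral_eq_zero
    (fun t => (hU.hasGaussianLaw_eval t).memLp_two) hU0⟩

theorem hasGaussianLaw_initial
    (hV₀ : HasLaw (fun ω => WithLp.toLp 2 (V₀ ω)) (multivariateGaussian 0 S) P) :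
    HasGaussianLaw V₀ P :=
  hV₀.hasGaussianLaw.map_equiv_fun (EuclideanSpace.equiv (Fin d) ℝ)

theorem integral_initial
    (hV₀ : HasLaw (fun ω => WithLp.toLp 2 (V₀ ω)) (multivariateGaussian 0 S) P) :
    ∫ ω, V₀ ω ∂P = 0 := by
  have h1 := (EuclideanSpace.equiv (Fin d) ℝ).toContinuousLinearMap.integral_comp_comm
    hV₀.hasGaussianLaw.integrable
  refine h1.trans ?_
  rw [hV₀.integral_eq, integral_id_multivariateGaussian, map_zero]

theorem crossMoment_initial (hS : S.PosSemidef)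
    (hV₀ : HasLaw (fun ω => WithLp.toLp 2 (V₀ ω)) (multivariateGaussian 0 S) P) :
    crossMoment P V₀ V₀ = S := by
  have h0 := integral_initial hV₀
  have hm := (hasGaussianLaw_initial hV₀).memLp_two
  have := (hasGaussianLaw_initial hV₀).isProbabilityMeasure
  have h00 : ∀ i, ∫ ω, V₀ ω i ∂P = 0 := fun i => by
    rw [← eval_integral fun i => (hm.eval i).integrable (by norm_num), h0]
    rfl
  ext i j
  rw [← covariance_eval_multivariateGaussian (μ := 0) hS i j,
    ← hV₀.covariance_fun_comp (by fun_prop) (by fun_prop)]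
  change ∫ ω, V₀ ω i * V₀ ω j ∂P = cov[fun ω => V₀ ω i, fun ω => V₀ ω j; P]
  rw [covariance_eq_sub (hm.eval i) (hm.eval j), h00, zero_mul, sub_zero]
  rfl

end GaussianForce

/-! ### Linear Volterra equations driven by a square integrable process -/

section VolterraProcess

variable {Ω : Type*} [MeasurableSpace Ω] {P : Measure Ω} [IsProbabilityMeasure P] {d : ℕ}
  {f : ℝ → Ω → Vec d} {A : ℝ → ℝ → Mat d} {ρ : ℝ → Mat d}

local notation "μl" => ContinuousLinearMap.mul ℝ (Mat d)

/-- The pathwise solution `f - ρ * f` of the Volterra equation with resolvent `ρ` and forcing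
`f`. -/
def volterraProcess (ρ : ℝ → Mat d) (f : ℝ → Ω → Vec d) (t : ℝ) (ω : Ω) : Vec d :=
  f t ω - cconv (mulVecL d) ρ (fun s => f s ω) t

theorem memLp_uncurry_of_continuous_crossMoment (hf : Measurable (Function.uncurry f))
    (hfm : ∀ t, 0 ≤ t → MemLp (f t) 2 P) (hA : Continuous fun p : ℝ × ℝ => A p.1 p.2)
    (hfA : ∀ s t, 0 ≤ s → 0 ≤ t → crossMoment P (f s) (f t) = A s t) (t : ℝ) :
    MemLp (Function.uncurry f) 2 ((volume.restrict (Ioc 0 t)).prod P) := by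
  have hc : Continuous fun u => (A u u).trace :=
    (hA.comp (continuous_id.prodMk continuous_id)).matrix_trace
  obtain ⟨C, hC⟩ := (isCompact_Icc (a := (0 : ℝ)) (b := t)).bddAbove_image hc.continuousOn
  refine memLp_uncurry hf.aestronglyMeasurable (C := C.toNNReal) ?_
  refine (ae_restrict_iff' measurableSet_Ioc).2 (Eventually.of_forall fun u hu => ?_)
  have := lintegral_enorm_sq_le (hfm u hu.1.le)
  rw [hfA u u hu.1.le hu.1.le] at this
  exact this.trans (ENNReal.ofReal_le_ofReal (hC (mem_image_of_mem _ (Ioc_subset_Icc_self hu))))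

theorem memLp_uncurry_resolvent (hρ : Continuous ρ) {t : ℝ}
    (hf : MemLp (Function.uncurry f) 2 ((volume.restrict (Ioc 0 t)).prod P)) :
    MemLp (Function.uncurry fun u ω => mulVecL d (ρ (t - u)) (f u ω)) 2
      ((volume.restrict (Ioc 0 t)).prod P) := by
  have hc : Continuous fun u => ρ (t - u) := by fun_prop
  obtain ⟨C, hC⟩ := (isCompact_Icc (a := (0 : ℝ)) (b := t)).exists_bound_of_continuousOn
    hc.continuousOn
  exact memLp_uncurry_bilin (mulVecL d) hf hc.aestronglyMeasurable
    ((ae_restrict_iff' measurableSet_Ioc).2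
      (Eventually.of_forall fun u hu => hC u (Ioc_subset_Icc_self hu)))

theorem memLp_cconv (hρ : Continuous ρ) {t : ℝ} (ht : 0 ≤ t)
    (hf : MemLp (Function.uncurry f) 2 ((volume.restrict (Ioc 0 t)).prod P)) :
    MemLp (fun ω => cconv (mulVecL d) ρ (fun s => f s ω) t) 2 P := by
  simp only [cconv, intervalIntegral.integral_of_le ht]
  exact memLp_integral (memLp_uncurry_resolvent hρ hf)

theorem memLp_volterraProcess (hρ : Continuous ρ) {t : ℝ} (ht : 0 ≤ t) (hft : MemLp (f t) 2 P)
    (hf : MemLp (Function.uncurry f) 2 ((volume.restrict (Ioc 0 t)).prod P)) :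
    MemLp (volterraProcess ρ f t) 2 P :=
  hft.sub (memLp_cconv hρ ht hf)

theorem memClosedSpan_volterraProcess (hρ : Continuous ρ) {T : Type*} {U : T → Ω → Vec d}
    (hU : ∀ t, 0 ≤ t → MemClosedSpan P U (f t)) {t : ℝ} (ht : 0 ≤ t)
    (hf : MemLp (Function.uncurry f) 2 ((volume.restrict (Ioc 0 t)).prod P)) :
    MemClosedSpan P U (volterraProcess ρ f t) := by
  refine (hU t ht).sub (Y' := fun ω => cconv (mulVecL d) ρ (fun s => f s ω) t) ?_
  simp only [cconv, intervalIntegral.integral_of_le ht]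
  refine MemClosedSpan.integral (memLp_uncurry_resolvent hρ hf) ?_
  exact (ae_restrict_iff' measurableSet_Ioc).2
    (Eventually.of_forall fun u hu => (hU u hu.1.le).mulVec _)

theorem crossMoment_volterraProcess_left (hρ : Continuous ρ)
    (hfm : ∀ t, 0 ≤ t → MemLp (f t) 2 P) {t : ℝ} (ht : 0 ≤ t)
    (hf : MemLp (Function.uncurry f) 2 ((volume.restrict (Ioc 0 t)).prod P))
    {Y : Ω → Vec d} (hY : MemLp Y 2 P) :
    crossMoment P (volterraProcess ρ f t) Y
      = crossMoment P (f t) Y - cconv μl ρ (fun u => crossMoment P (f u) Y) t := by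
  refine (crossMoment_sub_left (hfm t ht) (memLp_cconv hρ ht hf) hY).trans ?_
  congr 1
  simp only [cconv, intervalIntegral.integral_of_le ht]
  rw [crossMoment_integral_left (memLp_uncurry_resolvent hρ hf) hY]
  refine setIntegral_congr_fun measurableSet_Ioc fun u hu => ?_
  exact crossMoment_mulVec_left _ (hfm u hu.1.le) hY

/-- The covariance of the solution is obtained from that of the forcing by resolving both time
variables. -/
theorem crossMoment_volterraProcess (hρ : Continuous ρ) (hf : Measurable (Function.uncurry f))
    (hfm : ∀ t, 0 ≤ t → MemLp (f t) 2 P) (hA : Continuous fun p : ℝ × ℝ => A p.1 p.2)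
    (hfA : ∀ s t, 0 ≤ s → 0 ≤ t → crossMoment P (f s) (f t) = A s t) {s t : ℝ} (hs : 0 ≤ s)
    (ht : 0 ≤ t) :
    crossMoment P (volterraProcess ρ f s) (volterraProcess ρ f t) = resolve₂ ρ A s t := by
  have hu := memLp_uncurry_of_continuous_crossMoment hf hfm hA hfA
  have h1 : ∀ a, 0 ≤ a → crossMoment P (f a) (volterraProcess ρ f t) = resolve₁ ρ A a t := by
    intro a ha
    rw [← crossMoment_transpose, crossMoment_volterraProcess_left hρ hfm ht (hu t) (hfm a ha),
      Matrix.transpose_sub, crossMoment_transpose, hfA a t ha ht, resolve₁]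
    congr 2
    refine cconv_congr _ ht (fun _ _ => rfl) fun b hb => ?_
    rw [← hfA a b ha hb, crossMoment_transpose]
  rw [crossMoment_volterraProcess_left hρ hfm hs (hu s) (memLp_volterraProcess hρ ht (hfm t ht)
    (hu t)), h1 s hs, resolve₂]
  congr 1
  exact cconv_congr μl hs (fun _ _ => rfl) fun a ha => h1 a ha

end VolterraProcess

/-! ### Pathwise solution of the Langevin equation -/

section Pathwise

variable {Ω : Type*} [MeasurableSpace Ω] {P : Measure Ω} {d : ℕ} {D : Mat d} {γ ρ : ℝ → Mat d}
  {Z V : ℝ → Ω → Vec d} {V₀ : Ω → Vec d}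

local notation "μl" => ContinuousLinearMap.mul ℝ (Mat d)

/-- In integrated form the Langevin equation is a Volterra equation with the bounded continuous
kernel `kern D γ`. -/
theorem isStrongSolution_iff (hγ : IntegrableOn γ (Ioi 0) volume) :
    IsStrongSolution P D γ Z V₀ V ↔ ∀ᵐ ω ∂P,
      (∀ t, 0 ≤ t → IntervalIntegrable (fun s => V s ω) volume 0 t) ∧
      ∀ t, 0 ≤ t →
        V t ω + cconv (mulVecL d) (kern D γ) (fun s => V s ω) t = V₀ ω + Z t ω := by
  refine eventually_congr (Eventually.of_forall fun ω => and_congr_right fun hi =>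
    forall_congr' fun t => forall_congr' fun ht => ?_)
  have h := integral_friction_add_memory (D := D) (mulVecL d) hγ ht (hi t ht)
  simp only [mulVecL_apply] at h
  rw [← h, ← sub_eq_zero, ← sub_eq_zero (b := V₀ ω + Z t ω)]
  refine Eq.congr ?_ rfl
  abel

/-- Strong solutions are given by the resolvent of the kernel. -/
theorem IsStrongSolution.eq_volterraProcess (hγ : IntegrableOn γ (Ioi 0) volume)
    (hρ : Continuous ρ) (hl : ∀ t, 0 ≤ t → ρ t + cconv μl ρ (kern D γ) t = kern D γ t)
    (hZ : ∀ᵐ ω ∂P, Continuous fun t => Z t ω) (hV : IsStrongSolution P D γ Z V₀ V) :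
    ∀ᵐ ω ∂P, ∀ t, 0 ≤ t → V t ω = volterraProcess ρ (fun t ω => V₀ ω + Z t ω) t ω := by
  filter_upwards [(isStrongSolution_iff hγ).1 hV, hZ] with ω h hc t ht
  exact eq_sub_cconv_of_add_cconv_eq (mulVecL d) (fun a b x => by simp)
    (continuous_kern hγ) hρ hl ht (h.1 t ht)
    ((continuous_const.add hc).intervalIntegrable _ _) fun s hs _ => h.2 s hs

theorem isStrongSolution_volterraProcess (hγ : IntegrableOn γ (Ioi 0) volume)
    (hρ : Continuous ρ) (hr : ∀ t, 0 ≤ t → ρ t + cconv μl (kern D γ) ρ t = kern D γ t)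
    (hZ : ∀ᵐ ω ∂P, Continuous fun t => Z t ω) :
    IsStrongSolution P D γ Z V₀ (volterraProcess ρ fun t ω => V₀ ω + Z t ω) := by
  rw [isStrongSolution_iff hγ]
  filter_upwards [hZ] with ω hc
  have hf : Continuous fun t => V₀ ω + Z t ω := continuous_const.add hc
  exact ⟨fun t _ => (hf.sub (continuous_cconv _ hρ hf)).intervalIntegrable _ _, fun t ht =>
    add_cconv_eq_of_eq_sub_cconv (mulVecL d) (fun a b x => by simp) (continuous_kern hγ) hρ hr
      hf ht⟩

end Pathwise

/-! ### Independence and the fluctuation-dissipation relation -/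

section Independence

variable {Ω : Type*} [MeasurableSpace Ω] {P : Measure Ω} {d : ℕ} {W W' : ℝ → Ω → Vec d}
  {F₀ : ℝ → Ω → Vec d} {φ γ : ℝ → Mat d} {G S : Mat d}

theorem crossMoment_eq_zero_of_indepFun [IsProbabilityMeasure P] {X Y : Ω → Vec d}
    (hX : MemLp X 2 P) (hY : MemLp Y 2 P) (hX0 : ∫ ω, X ω ∂P = 0) (h : IndepFun X Y P) :
    crossMoment P X Y = 0 := by
  ext i j
  have hij : IndepFun (fun ω => X ω i) (fun ω => Y ω j) P :=
    h.comp (measurable_pi_apply i) (measurable_pi_apply j)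
  have := hij.integral_mul_eq_mul_integral (hX.eval i).aestronglyMeasurable
    (hY.eval j).aestronglyMeasurable
  refine Eq.trans this ?_
  rw [← eval_integral fun i => (hX.eval i).integrable (by norm_num), hX0]
  simp

/-- A Brownian motion that is independent of itself has dimension zero. -/
theorem IsTwoSidedBrownian.isEmpty_of_indepFun_self [IsProbabilityMeasure P]
    (hW : IsTwoSidedBrownian W P)
    (h : IndepFun (fun ω t => W t ω) (fun ω t => W t ω) P) : IsEmpty (Fin d) := by
  refine ⟨fun i => ?_⟩
  have h1 := crossMoment_eq_zero_of_indepFun (hW.memLp 1) (hW.memLp 1) (hW.mean_zero 1)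
    (h.comp (measurable_pi_apply 1) (measurable_pi_apply 1))
  rw [crossMoment_brownian hW zero_le_one zero_le_one] at h1
  have := congrFun (congrFun h1 i) i
  simp at this

theorem crossMoment_force_brownian_of_indepFun [IsProbabilityMeasure P]
    (hW : IsTwoSidedBrownian W P) (hW' : IsTwoSidedBrownian W' P)
    (h : IndepFun (fun ω t => W t ω) (fun ω t => W' t ω) P)
    (hF : ∀ t, IsWienerIntegral W' P (fun s => φ (t - s)) (F₀ t)) (a t : ℝ) :
    crossMoment P (F₀ a) (W t) = 0 :=
  ((hF a).memClosedSpan hW').2 _ (hW.memLp t) fun u =>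
    crossMoment_eq_zero_of_indepFun (hW'.memLp u) (hW.memLp t) (hW'.mean_zero u)
      (h.symm.comp (measurable_pi_apply u) (measurable_pi_apply t))

/-- The cross-covariance density `ψ` of `F₀` and the white noise, which is `φ` or `0`, and the
resulting form of the fluctuation-dissipation relation. -/
theorem exists_crossDensity [IsProbabilityMeasure P] (hφ : MemLp φ 2 volume)
    (hW : IsTwoSidedBrownian W P) (hW' : IsTwoSidedBrownian W' P)
    (hWW' : W' = W ∨ IndepFun (fun ω t => W t ω) (fun ω t => W' t ω) P)
    (hF : ∀ t, IsWienerIntegral W' P (fun s => φ (t - s)) (F₀ t)) :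
    ∃ ψ : ℝ → Mat d, LocallyIntegrable ψ volume ∧
      (∀ a t, 0 ≤ t → crossMoment P (F₀ a) (W t) = ∫ u in (0 : ℝ)..t, ψ (a - u)) ∧
      (FluctuationDissipation P W W' G S γ φ ↔
        (fun u => matConv φ (revT φ) u + (ψ u * Gᵀ + G * revT ψ u)) =ᵐ[volume] gammaExt γ S) := by
  rcases hWW' with rfl | h
  · refine ⟨φ, hφ.locallyIntegrable (by norm_num),
      fun a t ht => crossMoment_force_brownian hW hF a ht, ?_⟩
    have hiff : (∀ᵐ t : ℝ, matConv φ (revT φ) t = gammaExt γ S t - φ t * Gᵀ - G * revT φ t) ↔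
        (fun u => matConv φ (revT φ) u + (φ u * Gᵀ + G * revT φ u)) =ᵐ[volume] gammaExt γ S :=
      eventually_congr (Eventually.of_forall fun t => by
        rw [sub_sub, eq_sub_iff_add_eq])
    rw [← hiff]
    refine ⟨fun hfd => hfd.1 rfl, fun hae => ⟨fun _ => hae, fun hind => ?_⟩⟩
    -- both alternatives hold at once only in dimension zero, where all matrices agree
    have := hW.isEmpty_of_indepFun_self hind
    exact Eventually.of_forall fun t => Subsingleton.elim _ _
  · refine ⟨0, locallyIntegrable_zero, fun a t _ => ?_, ?_⟩
    · rw [crossMoment_force_brownian_of_indepFun hW hW' h hF]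
      simp
    have hiff : (∀ᵐ t : ℝ, matConv φ (revT φ) t = gammaExt γ S t) ↔
        (fun u => matConv φ (revT φ) u + ((0 : ℝ → Mat d) u * Gᵀ + G * revT 0 u))
          =ᵐ[volume] gammaExt γ S :=
      eventually_congr (Eventually.of_forall fun t => by simp [revT])
    rw [← hiff]
    refine ⟨fun hfd => hfd.2 h, fun hae => ⟨?_, fun _ => hae⟩⟩
    rintro rfl
    have := hW.isEmpty_of_indepFun_self h
    exact Eventually.of_forall fun t => Subsingleton.elim _ _

end Independence

/-! ### Stationarity of centered Gaussian processes -/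

section Stationarity

variable {Ω : Type*} [MeasurableSpace Ω] {P : Measure Ω} {d : ℕ}
  {T : Type*} {U : T → Ω → Vec d} {V : ℝ → Ω → Vec d} {r : ℝ → Mat d} {S : Mat d}

theorem isSecondOrderStationary_iff (hm : ∀ t, 0 ≤ t → MemLp (V t) 2 P)
    (h0 : ∀ t, 0 ≤ t → ∫ ω, V t ω ∂P = 0) (hS : Sᵀ = S) (hr0 : r 0 = 1)
    (hV : ∀ t, 0 ≤ t → crossMoment P (V t) (V 0) = r t * S) :
    IsSecondOrderStationary P V ↔
      ∀ s t, 0 ≤ s → 0 ≤ t → crossMoment P (V s) (V t) = corr r S (s - t) := by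
  have hc : ∀ u, 0 ≤ u → corr r S u = r u * S := fun u hu => if_pos hu
  constructor
  · intro h
    have key : ∀ s t, 0 ≤ t → t ≤ s → crossMoment P (V s) (V t) = corr r S (s - t) := by
      intro s t ht hts
      have := h.2.2 t (s - t) ht (sub_nonneg.2 hts)
      rwa [add_sub_cancel, hV _ (sub_nonneg.2 hts), ← hc _ (sub_nonneg.2 hts)] at this
    intro s t hs ht
    rcases le_total t s with hts | hst
    · exact key s t ht hts
    · rw [← crossMoment_transpose, key t s hs hst, corr_transpose hS hr0, neg_sub]
  · intro h
    refine ⟨hm, fun t ht => by rw [h0 t ht, h0 0 le_rfl], fun s t hs ht => ?_⟩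
    rw [h _ _ (add_nonneg hs ht) hs, h t 0 ht le_rfl, add_sub_cancel_left, sub_zero]

/-- For centered processes that are jointly Gaussian, strict stationarity and second order
stationarity agree. -/
theorem isStationary_iff_isSecondOrderStationary [IsProbabilityMeasure P]
    (hU : IsGaussianProcess U P)
    (hU0 : ∀ t, ∫ ω, U t ω ∂P = 0) (hV : ∀ t, 0 ≤ t → MemClosedSpan P U (V t)) :
    IsStationary P V ↔ IsSecondOrderStationary P V := by
  have hm : ∀ t, 0 ≤ t → MemLp (V t) 2 P := fun t ht => (hV t ht).1
  have h0 : ∀ t, 0 ≤ t → ∫ ω, V t ω ∂P = 0 := fun t ht =>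
    (hV t ht).integral_eq_zero (fun t => (hU.hasGaussianLaw_eval t).memLp_two) hU0
  have hmap : ∀ (h : ℝ≥0) (I : Finset ℝ≥0),
      AEMeasurable (fun ω (t : I) => V ((t : ℝ≥0) + h) ω) P := fun h I =>
    aemeasurable_restrict (Y := fun (t : ℝ≥0) => V (t + h))
      (fun t => hm _ (add_nonneg t.2 h.2)) I
  have hmap0 : ∀ I : Finset ℝ≥0, AEMeasurable (fun ω (t : I) => V (t : ℝ≥0) ω) P := fun I =>
    aemeasurable_restrict (Y := fun (t : ℝ≥0) => V t) (fun t => hm _ t.2) I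
  constructor
  · intro h
    refine ⟨hm, fun t ht => by rw [h0 t ht, h0 0 le_rfl], fun s t hs ht => ?_⟩
    lift s to ℝ≥0 using hs
    lift t to ℝ≥0 using ht
    have heq := h s {t, 0}
    ext i j
    let g : (({t, 0} : Finset ℝ≥0) → Vec d) → ℝ := fun x => x ⟨t, by simp⟩ i * x ⟨0, by simp⟩ j
    have hg : Continuous g := by fun_prop
    have h1 := integral_map (hmap s {t, 0}) hg.aestronglyMeasurable
    have h2 := integral_map (hmap0 {t, 0}) hg.aestronglyMeasurable
    rw [heq, h2] at h1
    simp only [g, NNReal.coe_zero, zero_add, add_comm (t : ℝ)] at h1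
    exact h1.symm
  · intro h h' I
    refine map_eq_of_crossMoment_eq hU hU0 (Y := fun t : ℝ≥0 => V (t + h'))
      (Y' := fun t : ℝ≥0 => V t) (fun t => hV _ (add_nonneg t.2 h'.2)) (fun t => hV _ t.2)
      (fun s t => ?_) I
    have key : ∀ s t a : ℝ≥0, t ≤ s →
        crossMoment P (V (s + a)) (V (t + a)) = crossMoment P (V s) (V t) := by
      intro s t a hts
      have hst : (0 : ℝ) ≤ s - t := sub_nonneg.2 (NNReal.coe_le_coe.2 hts)
      have e1 := h.2.2 (t + a) (s - t) (add_nonneg t.2 a.2) hst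
      have e2 := h.2.2 t (s - t) t.2 hst
      rw [show (t : ℝ) + a + (s - t) = s + a by ring] at e1
      rw [add_sub_cancel] at e2
      rw [e1, e2]
    rcases le_total t s with hts | hst
    · exact key s t h' hts
    · rw [← crossMoment_transpose, key t s h' hst, crossMoment_transpose]

end Stationarity

/-! ### Covariance of the solution of the Langevin equation -/

section Solution

variable {Ω : Type*} [MeasurableSpace Ω] {P : Measure Ω} {d : ℕ} {D G S B B' : Mat d}
  {γ ρ k : ℝ → Mat d}

local notation "μl" => ContinuousLinearMap.mul ℝ (Mat d)

/-- The covariance obtained by resolving `S + covInc B k` is stationary exactly if `B` and `k`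
satisfy the fluctuation-dissipation relation. -/
theorem resolve₂_eq_corr_iff (hγ : IntegrableOn γ (Ioi 0) volume) (hS : Sᵀ = S)
    (hρ : Continuous ρ) (hr : ∀ t, 0 ≤ t → ρ t + cconv μl (kern D γ) ρ t = kern D γ t)
    (hl : ∀ t, 0 ≤ t → ρ t + cconv μl ρ (kern D γ) t = kern D γ t)
    (hk : LocallyIntegrable k volume) :
    (∀ s t, 0 ≤ s → 0 ≤ t → resolve₂ ρ (fun s t => S + covInc B k s t) s t
      = corr (fun t => 1 - ∫ s in (0 : ℝ)..t, ρ s) S (s - t)) ↔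
      B = D * S + S * Dᵀ ∧ k =ᵐ[volume] gammaExt γ S := by
  have hres := isDifferentialResolvent_one_sub_integral hγ hρ hr
  have hrc : Continuous fun t => (1 : Mat d) - ∫ s in (0 : ℝ)..t, ρ s :=
    continuous_iff_continuousAt.2 fun t => (hasDerivAt_one_sub_integral hρ t).continuousAt
  have hg : LocallyIntegrable (gammaExt γ S) volume := (integrable_gammaExt hγ).locallyIntegrable
  rw [resolve₂_eq_iff (continuous_kern hγ) hρ hr hl (continuous_const.add (continuous_covInc hk B))
    (C := fun s t => corr (fun t => 1 - ∫ s in (0 : ℝ)..t, ρ s) S (s - t))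
    ((continuous_corr hrc hres.1).comp (continuous_fst.sub continuous_snd)),
    ← covInc_eq_iff hk hg]
  refine forall_congr' fun s => forall_congr' fun t => forall_congr' fun hs =>
    forall_congr' fun ht => ?_
  rw [volterra₂_corr hγ hS hrc hres.1 (fun t ht => (hres.add_cconv hγ ht).2) hs ht,
    add_right_inj, eq_comm]

/-- At time `0` in the second variable, `S + covInc B k` is constant. -/
theorem resolve₂_zero_right (hρ : Continuous ρ) {t : ℝ} (ht : 0 ≤ t) :
    resolve₂ ρ (fun s t => S + covInc B k s t) t 0 = (1 - ∫ s in (0 : ℝ)..t, ρ s) * S := by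
  have h1 : ∀ u, 0 ≤ u → resolve₁ ρ (fun s t => S + covInc B k s t) u 0 = S := by
    intro u hu
    simp [resolve₁, cconv, covInc, prim₂, hu]
  rw [resolve₂, h1 t ht, cconv_congr _ ht (fun _ _ => rfl) (y' := fun _ => S) h1, sub_mul, one_mul]
  congr 1
  simp only [cconv, ContinuousLinearMap.mul_apply']
  rw [intervalIntegral.integral_comp_sub_left (fun u => ρ u * S), sub_self, sub_zero]
  exact ((μl).flip S).intervalIntegral_comp_comm (hρ.intervalIntegrable 0 t)

end Solution

end GLE

end

theorem theorem2 {Ω : Type*} [MeasurableSpace Ω] (P : Measure Ω) [IsProbabilityMeasure P]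
    {d : ℕ} (D G S : GLE.Mat d) (hS : S.PosDef)
    (γ : ℝ → GLE.Mat d) (hγ : IntegrableOn γ (Ioi 0) volume)
    (φ : ℝ → GLE.Mat d) (hφ : MemLp φ 2 volume)
    (W W' : ℝ → Ω → GLE.Vec d)
    (hW : GLE.IsTwoSidedBrownian W P) (hW' : GLE.IsTwoSidedBrownian W' P)
    (hWW' : W' = W ∨ IndepFun (fun ω t => W t ω) (fun ω t => W' t ω) P)
    (F₀ : ℝ → Ω → GLE.Vec d) (hF₀_meas : Measurable (Function.uncurry F₀))
    (hF₀ : ∀ t, GLE.IsWienerIntegral W' P (fun s => φ (t - s)) (F₀ t))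
    (V₀ : Ω → GLE.Vec d)
    (hV₀ : HasLaw (fun ω => WithLp.toLp 2 (V₀ ω)) (multivariateGaussian 0 S) P)
    (hindep : IndepFun V₀ (fun ω t => GLE.integratedForce F₀ G W t ω) P) :
    ∃ r : ℝ → GLE.Mat d, GLE.IsDifferentialResolvent D γ r ∧
      (∀ r₁, GLE.IsDifferentialResolvent D γ r₁ → EqOn r₁ r (Ici 0)) ∧
      (∃ V, GLE.IsStrongSolution P D γ (GLE.integratedForce F₀ G W) V₀ V) ∧
      (∀ V V₁, GLE.IsStrongSolution P D γ (GLE.integratedForce F₀ G W) V₀ V →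
        GLE.IsStrongSolution P D γ (GLE.integratedForce F₀ G W) V₀ V₁ →
        ∀ᵐ ω ∂P, ∀ t, 0 ≤ t → V t ω = V₁ t ω) ∧
      ∀ V, GLE.IsStrongSolution P D γ (GLE.integratedForce F₀ G W) V₀ V →
        IsGaussianProcess (fun t : ℝ≥0 => V t) P ∧
        (∀ t, 0 ≤ t → ∫ ω, V t ω ∂P = 0) ∧
        (GLE.IsStationary P V ↔
          G * Gᵀ = D * S + S * Dᵀ ∧ GLE.FluctuationDissipation P W W' G S γ φ) ∧
        (GLE.IsSecondOrderStationary P V ↔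
          G * Gᵀ = D * S + S * Dᵀ ∧ GLE.FluctuationDissipation P W W' G S γ φ) ∧
        (GLE.IsSecondOrderStationary P V → ∀ s t, 0 ≤ s → 0 ≤ t →
          GLE.crossMoment P (V (s + t)) (V s) = r t * S) := by
  have hST : Sᵀ = S := by
    have := hS.isHermitian.eq
    rwa [Matrix.conjTranspose_eq_transpose_of_trivial] at this
  obtain ⟨ρ, hρ, hr, hl⟩ := GLE.exists_resolvent (GLE.norm_kern_le (D := D) hγ)
    (GLE.continuous_kern hγ)
  obtain ⟨ψ, hψ, hcross, hFD⟩ := GLE.exists_crossDensity (G := G) (S := S) (γ := γ) hφ hW hW' hWW'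
    hF₀
  have hcZ := GLE.ae_continuous_integratedForce (G := G) hW hW' hF₀_meas hF₀
  have hres := GLE.isDifferentialResolvent_one_sub_integral hγ hρ hr
  -- the covariance `S + covInc (G Gᵀ) k` of the forcing `V₀ + ∫ F`
  set k : ℝ → GLE.Mat d := fun u =>
    GLE.matConv φ (GLE.revT φ) u + (ψ u * Gᵀ + G * GLE.revT ψ u)
  have hk : LocallyIntegrable k volume :=
    (GLE.locallyIntegrable_conv hW' hF₀_meas hF₀).add
      ((GLE.locallyIntegrable_comp ((ContinuousLinearMap.mul ℝ (GLE.Mat d)).flip Gᵀ) hψ).add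
        (GLE.locallyIntegrable_comp (ContinuousLinearMap.mul ℝ (GLE.Mat d) G)
          (GLE.locallyIntegrable_revT hψ)))
  have hV₀m : MemLp V₀ 2 P := (GLE.hasGaussianLaw_initial hV₀).memLp_two
  have hV₀0 := GLE.integral_initial hV₀
  obtain ⟨hZG, hZ0⟩ := GLE.isGaussianProcess_integratedForce (G := G) hW hW' hWW' hF₀_meas hF₀
  have hZm : ∀ t, 0 ≤ t → MemLp (GLE.integratedForce F₀ G W t) 2 P := fun t ht =>
    GLE.memLp_integratedForce hW hW' hF₀_meas hF₀ ht
  -- `V₀` and the force are jointly Gaussian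
  let U : Unit ⊕ ℝ≥0 → Ω → GLE.Vec d :=
    Sum.elim (fun _ => V₀) (fun t => GLE.integratedForce F₀ G W t)
  have hV₀G : IsGaussianProcess (fun (_ : Unit) => V₀) P :=
    ⟨fun I => (GLE.hasGaussianLaw_initial hV₀).map_fun
      (ContinuousLinearMap.pi fun _ : I => ContinuousLinearMap.id ℝ (GLE.Vec d))⟩
  have hU : IsGaussianProcess U P := GLE.isGaussianProcess_sumElim hV₀G hZG
    (hindep.comp (φ := fun (v : GLE.Vec d) (_ : Unit) => v)
      (ψ := fun (z : ℝ → GLE.Vec d) (t : ℝ≥0) => z (t : ℝ)) (by fun_prop) (by fun_prop))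
  have hU0 : ∀ t, ∫ ω, U t ω ∂P = 0 := by
    rintro (t | t)
    · exact hV₀0
    · exact hZ0 t
  have hUm : ∀ t, MemLp (U t) 2 P := fun t => (hU.hasGaussianLaw_eval t).memLp_two
  have hUf : ∀ t, 0 ≤ t →
      GLE.MemClosedSpan P U (V₀ + GLE.integratedForce F₀ G W t) := fun t ht =>
    (GLE.memClosedSpan_self (X := U) (t := Sum.inl ()) (hUm _)).add
      (GLE.memClosedSpan_self (X := U) (t := Sum.inr ⟨t, ht⟩) (hUm _))
  -- a jointly measurable modification of the forcing
  obtain ⟨f, hfm, hf⟩ := GLE.exists_measurable_modification (P := P)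
    (X := fun t ω => V₀ ω + GLE.integratedForce F₀ G W (max t 0) ω)
    (fun t => (hV₀m.add (hZm _ (le_max_right t 0))).aestronglyMeasurable.aemeasurable) (by
      filter_upwards [hcZ] with ω hω
      exact continuous_const.add (hω.comp (continuous_id.max continuous_const)))
  have hft : ∀ t, 0 ≤ t → V₀ + GLE.integratedForce F₀ G W t =ᵐ[P] f t := by
    intro t ht
    filter_upwards [hf] with ω hω
    rw [← hω t, max_eq_left ht]
    rfl
  have hfs : ∀ t, 0 ≤ t → GLE.MemClosedSpan P U (f t) := fun t ht => (hUf t ht).congr (hft t ht)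
  have hfL : ∀ t, 0 ≤ t → MemLp (f t) 2 P := fun t ht => (hfs t ht).1
  have hA : Continuous fun p : ℝ × ℝ => S + GLE.covInc (G * Gᵀ) k p.1 p.2 :=
    continuous_const.add (GLE.continuous_covInc hk _)
  have hfA : ∀ s t, 0 ≤ s → 0 ≤ t →
      GLE.crossMoment P (f s) (f t) = S + GLE.covInc (G * Gᵀ) k s t := by
    intro s t hs ht
    have hVZ : ∀ t, 0 ≤ t → GLE.crossMoment P V₀ (GLE.integratedForce F₀ G W t) = 0 := fun t ht =>
      GLE.crossMoment_eq_zero_of_indepFun hV₀m (hZm t ht) hV₀0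
        (hindep.comp (φ := id) measurable_id (measurable_pi_apply t))
    rw [← GLE.crossMoment_congr (hft s hs) (hft t ht),
      GLE.crossMoment_add_left hV₀m (hZm s hs) (hV₀m.add (hZm t ht)),
      GLE.crossMoment_add_right hV₀m hV₀m (hZm t ht),
      GLE.crossMoment_add_right (hZm s hs) hV₀m (hZm t ht), hVZ t ht,
      ← GLE.crossMoment_transpose V₀ (GLE.integratedForce F₀ G W s), hVZ s hs,
      GLE.crossMoment_initial hS.posSemidef hV₀,
      GLE.crossMoment_integratedForce hW hW' hF₀_meas hF₀ hψ hcross hs ht]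
    simp [k]
  have hfu := GLE.memLp_uncurry_of_continuous_crossMoment
    (A := fun s t => S + GLE.covInc (G * Gᵀ) k s t) hfm hfL hA hfA
  refine ⟨fun t => 1 - ∫ s in (0 : ℝ)..t, ρ s, hres, fun r₁ h₁ => hres.eqOn hγ h₁,
    ⟨_, GLE.isStrongSolution_volterraProcess hγ hρ hr hcZ⟩, fun V V₁ hV hV₁ => ?_, fun V hV => ?_⟩
  · filter_upwards [hV.eq_volterraProcess hγ hρ hl hcZ, hV₁.eq_volterraProcess hγ hρ hl hcZ]
      with ω h h₁ t ht
    rw [h t ht, h₁ t ht]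
  · have hVf : ∀ t, 0 ≤ t → GLE.volterraProcess ρ f t =ᵐ[P] V t := by
      intro t ht
      filter_upwards [hV.eq_volterraProcess hγ hρ hl hcZ, hf] with ω h hω
      have hfω : ∀ s, 0 ≤ s → V₀ ω + GLE.integratedForce F₀ G W s ω = f s ω := fun s hs => by
        rw [← hω s, max_eq_left hs]
      rw [h t ht, GLE.volterraProcess, GLE.volterraProcess, hfω t ht,
        GLE.cconv_congr _ ht (fun _ _ => rfl) hfω]
    have hVs : ∀ t, 0 ≤ t → GLE.MemClosedSpan P U (V t) := fun t ht =>
      (GLE.memClosedSpan_volterraProcess hρ hfs ht (hfu t)).congr (hVf t ht)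
    have hV0 : ∀ t, 0 ≤ t → ∫ ω, V t ω ∂P = 0 := fun t ht => (hVs t ht).integral_eq_zero hUm hU0
    have hVV : ∀ s t, 0 ≤ s → 0 ≤ t → GLE.crossMoment P (V s) (V t)
        = GLE.resolve₂ ρ (fun s t => S + GLE.covInc (G * Gᵀ) k s t) s t := fun s t hs ht => by
      rw [← GLE.crossMoment_congr (hVf s hs) (hVf t ht),
        GLE.crossMoment_volterraProcess hρ hfm hfL hA hfA hs ht]
    have hVt0 : ∀ t, 0 ≤ t → GLE.crossMoment P (V t) (V 0)
        = (1 - ∫ s in (0 : ℝ)..t, ρ s) * S := fun t ht => by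
      rw [hVV t 0 ht le_rfl, GLE.resolve₂_zero_right hρ ht]
    have hmain : GLE.IsSecondOrderStationary P V ↔
        G * Gᵀ = D * S + S * Dᵀ ∧ GLE.FluctuationDissipation P W W' G S γ φ := by
      rw [GLE.isSecondOrderStationary_iff (fun t ht => (hVs t ht).1) hV0 hST hres.1 hVt0, hFD,
        ← GLE.resolve₂_eq_corr_iff hγ hST hρ hr hl hk]
      refine forall_congr' fun s => forall_congr' fun t => forall_congr' fun hs =>
        forall_congr' fun ht => ?_
      rw [hVV s t hs ht]
    refine ⟨GLE.isGaussianProcess_of_memClosedSpan hU hU0 fun t : ℝ≥0 => hVs t t.2, hV0, ?_, hmain,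
      fun h s t hs ht => ?_⟩
    · rw [GLE.isStationary_iff_isSecondOrderStationary hU hU0 hVs, hmain]
    · rw [h.2.2 s t hs ht, hVt0 t ht]
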